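/- **Setting (quotient tower).** Let $(\Lambda,m)$ be a standard Borel space with a finite non-zero measure, partitioned into countably many measurable pieces $\Lambda_i$, with return times $R=R_i\ge 1$ on $\Lambda_i$ and a measurable return map $T^R:\Lambda\to\Lambda$ that takes every $\Lambda_i$ bijectively onto $\Lambda$. On each $\Lambda_i$ the map $T^R$ has a positive measurable Jacobian $J(T^R)$ with respect to $m$. Let $$\bar\Delta=\{(x,l):x\in\Lambda,\ 0\le l<R(x)\},\qquad \bar F(x,l)=\begin{cases}(x,l+1)&l+1<R(x)\\(T^Rx,0)&l+1=R(x),\end{cases}$$ let $\bar\Delta_l$ be the $l$-th level, let $\bar m$ be the measure on $\bar\Delta$ that is a copy of $m$ on each level (restricted to $\{R>l\}$), and let $J\bar F(x,l)=1$ if $l+1<R(x)$ and $J\bar F(x,l)=J(T^R)(x)$ otherwise. Each level $\bar\Delta_l$ is partitioned into finitely many sets $\bar\Delta_{l,j}$ (the elements of $\mathcal D$), each the copy on that level of a union of pieces $\Lambda_i$; $\mathcal D|_{\bar\Delta_{l+1}}$ refines $\bar F(\mathcal D|_{\bar\Delta_l})$; and if $R_i=R_{i'}$ with $i\ne i'$,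 then $\Lambda_i$ and $\Lambda_{i'}$ lie in different elements on level $R_i-1$. The separation time $s(p,q)$ is the largest $n$ such that $\bar F^ip,\bar F^iq$ lie in the same $\bar\Delta_{l,j}$ for all $i\le n$ ($s=0$ if there is none, $s=\infty$ if this holds for all $n$), and $s(p,q)=\infty$ only if $p=q$. There are constants $\beta,\theta_0\in(0,1)$, $C_0,C_1>0$ such that $m\{R\ge n\}\le C_0\theta_0^n$ for all $n\ge 0$; $R\ge N$ for some $N$ with $C_1e^{C_1}\beta^N\le\frac1{100}$; and $|J\bar F(p)/J\bar F(q)-1|\le C_1\beta^{s(\bar Fp,\bar Fq)}$ for all $p,q$ in the same set $\bar\Delta^*_{l,j}:=\bar\Delta_{l,j}\cap\bar F^{-1}\bar\Delta_0$ (with $\beta^\infty=0$). Let $\bar\nu\ll\bar m$ be a probability measure such that $\bar F^n$ preserves $\bar\nu$ and is ergodic for every $n\ge1$, and let $\rho=d\bar\nu/d\bar m$. Fix $\varepsilon>0$ with $e^{2\varepsilon}\theta_0<1$ and $\bar m(\bar\Delta_0)^{-1}\sum_{l,j}\bar m(\bar\Delta^*_{l,j})e^{l\varepsilon}\le2$.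 Let $\mathcal L$ be the space of measurable $\varphi:\bar\Delta\to\mathbb C$ (modulo equality a.e.) for which $$\sup_{l,j}e^{-l\varepsilon}\operatorname*{ess\,sup}_{\bar\Delta_{l,j}}|\varphi|+\sup_{l,j}e^{-l\varepsilon}\operatorname*{ess\,sup}_{p,q\in\bar\Delta_{l,j}}\frac{|\varphi(p)-\varphi(q)|}{\beta^{s(p,q)}}<\infty .$$ Let $\bar f:\bar\Delta\to\mathbb R^d$ be bounded and satisfy $|\bar f(p)-\bar f(q)|\le C\beta^{s(p,q)}$ for all $p,q$ and some constant $C$. For $t\in\mathbb R^d$ put $$P\varphi(p)=\sum_{q:\ \bar Fq=p}\frac{\varphi(q)}{J\bar F(q)},\qquad P_t^\rho\varphi=\frac1\rho P\big(\rho\,e^{i\langle t,\bar f\rangle}\varphi\big)\qquad(\varphi\in\mathcal L).$$ **Definitions.** Two functions $f,g:\bar\Delta\to\mathbb R^d$ are cohomologous, $f\sim g$, if $f-g=h-h\circ\bar F$ $\bar\nu$-a.e. for some measurable $h:\bar\Delta\to\mathbb R^d$. $S(f)$ is the smallest translated closed subgroup of $\mathbb R^d$ that contains $f(p)$ for $\bar\nu$-a.e.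 $p$. The minimal lattice of $f$ is $M(f)=\bigcap_{g\sim f}S(g)$, and $f$ is minimal if $S(f)=M(f)$. **Theorem 3.1.** Let $G$ be the set of $t\in\mathbb R^d$ for which $P_t^\rho$ has an eigenvalue $\lambda$ with $|\lambda|=1$ on $\mathcal L$. Then $G$ is a closed subgroup of $\mathbb R^d$, and there is $r\in\mathbb R^d$ such that for every $t\in G$ the only unimodular eigenvalue of $P_t^\rho$ is $\lambda_t=e^{i\langle t,r\rangle}$, and $$M(\bar f)=\widehat{\mathbb R^d/G}+r ,$$ where the dual group $\widehat{\mathbb R^d/G}$ is identified with the set of those $x\in\mathbb R^d$ for which $t\mapsto e^{i\langle t,x\rangle}$ is induced by a continuous character of $\mathbb R^d/G$. The cohomology class of $\bar f$ contains a minimal function. A minimal function $g$ in this class is the only one (up to equality $\bar\nu$-a.e.) if and only if $g$ is $\bar\nu$-a.e. constant. -/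

import Mathlib

open MeasureTheory Set Filter
open scoped ENNReal Topology

noncomputable section

/-! ## Cohomology, minimal supports, minimal lattices (for an arbitrary dynamical system) -/

section Minimality

variable {X E : Type*} [MeasurableSpace X] [NormedAddCommGroup E]

/-- `f ∼ g`: there is a measurable `h` with `f - g = h - h ∘ T` (`ν`-almost everywhere). -/
def Cohomologous [MeasurableSpace E] (T : X → X) (ν : Measure X) (f g : X → E) : Prop :=
  ∃ h : X → E, Measurable h ∧ ∀ᵐ x ∂ν, f x - g x = h x - h (T x)

/-- `A` is a translated closed subgroup `r + V` of `E`. -/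
def IsTranslatedClosedSubgroup (A : Set E) : Prop :=
  ∃ (V : AddSubgroup E) (r : E), IsClosed (V : Set E) ∧ A = {x | x - r ∈ V}

/-- `A` supports the values of `f`. -/
def SupportsValues (ν : Measure X) (f : X → E) (A : Set E) : Prop :=
  IsTranslatedClosedSubgroup A ∧ ∀ᵐ x ∂ν, f x ∈ A

/-- The minimal support `S(f)`: the smallest translated closed subgroup that supports the values
of `f` (it is the smallest one by `isLeast_minimalSupport`). -/
def minimalSupport (ν : Measure X) (f : X → E) : Set E :=
  ⋂₀ {A | SupportsValues ν f A}

/-- The minimal lattice `M(f)`: the intersection of the minimal supports `S(g)`, `g ∼ f`. -/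
def minimalLattice [MeasurableSpace E] (T : X → X) (ν : Measure X) (f : X → E) : Set E :=
  ⋂₀ {A | ∃ g : X → E, Cohomologous T ν f g ∧ A = minimalSupport ν g}

/-- `f` is minimal if `S(f) = M(f)`. -/
def IsMinimalFunction [MeasurableSpace E] (T : X → X) (ν : Measure X) (f : X → E) : Prop :=
  minimalSupport ν f = minimalLattice T ν f

theorem isLeast_minimalSupport [SecondCountableTopology E] (ν : Measure X) [NeZero ν]
    (f : X → E) : IsLeast {A | SupportsValues ν f A} (minimalSupport ν f) := by
  refine ⟨?_, fun A hA => sInter_subset_of_mem hA⟩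
  have hcl : ∀ A ∈ {A | SupportsValues ν f A}, IsClosed A := by
    rintro A ⟨⟨V, r, hV, rfl⟩, -⟩
    exact hV.preimage (continuous_id.sub continuous_const)
  have hae : ∀ᵐ x ∂ν, f x ∈ minimalSupport ν f := by
    obtain ⟨S, hS, hSc, hSU⟩ := TopologicalSpace.isOpen_sUnion_countable
      (compl '' {A | SupportsValues ν f A})
      (by rintro _ ⟨A, hA, rfl⟩; exact (hcl A hA).isOpen_compl)
    have h1 : ∀ᵐ x ∂ν, ∀ B ∈ S, f x ∉ B := by
      rw [ae_ball_iff hS]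
      intro B hB
      obtain ⟨A, hA, rfl⟩ := hSc hB
      filter_upwards [hA.2] with x hx using fun h => h hx
    filter_upwards [h1] with x hx A hA
    by_contra hxA
    have : f x ∈ ⋃₀ S := by
      rw [hSU]
      exact ⟨Aᶜ, ⟨A, hA, rfl⟩, hxA⟩
    obtain ⟨B, hB, hxB⟩ := this
    exact hx B hB hxB
  refine ⟨?_, hae⟩
  obtain ⟨x₀, hx₀⟩ := hae.exists
  set r := f x₀
  refine ⟨⨅ V ∈ {V : AddSubgroup E | SupportsValues ν f {x | x - r ∈ V}}, V, r, ?_, ?_⟩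
  · simp only [AddSubgroup.coe_iInf]
    refine isClosed_biInter fun V hV => ?_
    have := (hcl _ hV).preimage (continuous_id.add (continuous_const (y := r)))
    simpa [preimage] using this
  · ext x
    simp only [minimalSupport, mem_sInter, mem_ofPred_eq, AddSubgroup.mem_iInf]
    constructor
    · intro h V hV
      exact h _ hV
    · rintro h A hA
      obtain ⟨⟨V, a, hV, rfl⟩, hA2⟩ := id hA
      have hr : r - a ∈ V := hx₀ _ hA
      have heq : {x | x - a ∈ V} = {x | x - r ∈ V} := by
        ext y
        have : y - a = (y - r) + (r - a) := by abel
        rw [mem_ofPred_eq, mem_ofPred_eq, this, V.add_mem_cancel_right hr]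
      have := h V (by rw [← heq]; exact hA)
      have h2 : x ∈ {x | x - r ∈ V} := this
      rwa [← heq] at h2

end Minimality

/-- The dual `(E ⧸ G)^` of a quotient of a Euclidean space, as a subset of `E`: a vector `x` stands
for the character `t ↦ exp (i ⟨t, x⟩)`, and `x` belongs to the set if that character is (induced by)
a continuous character of `E ⧸ G`. -/
def dualOfQuotient {E : Type*} [NormedAddCommGroup E] [InnerProductSpace ℝ E]
    (G : AddSubgroup E) : Set E :=
  {x | ∃ χ : PontryaginDual (Multiplicative (E ⧸ G)),
    ∀ t : E, χ (Multiplicative.ofAdd (t : E ⧸ G)) = Circle.exp (inner ℝ t x)}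

theorem mem_dualOfQuotient {E : Type*} [NormedAddCommGroup E] [InnerProductSpace ℝ E]
    (G : AddSubgroup E) (x : E) :
    x ∈ dualOfQuotient G ↔ ∀ t ∈ G, Circle.exp (inner ℝ t x) = 1 := by
  constructor
  · rintro ⟨χ, hχ⟩ t ht
    rw [← hχ t, (QuotientAddGroup.eq_zero_iff t).2 ht]
    exact map_one χ
  · intro h
    let ψ : E →+ Additive Circle :=
      { toFun := fun t => Additive.ofMul (Circle.exp (inner ℝ t x))
        map_zero' := by simp
        map_add' := fun s t => by simp [inner_add_left, Circle.exp_add] }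
    let φ : E ⧸ G →+ Additive Circle := QuotientAddGroup.lift G ψ (fun t ht => h t ht)
    refine ⟨⟨AddMonoidHom.toMultiplicativeLeft φ, ?_⟩, fun t => rfl⟩
    have : Continuous φ := by
      refine continuous_quot_lift _ ?_
      exact Circle.exp.continuous.comp (continuous_id.inner continuous_const)
    exact this

/-! ## The quotient tower -/

/-- The combinatorial data of a quotient tower over the base `Λ`: the partition of `Λ` into the
pieces `Λ_i = cell ⁻¹' {i}`, the return times `R_i ≥ 1`, the return map `T^R : Λ → Λ`, and the
partition `𝒟`, whose elements on the level `l` are unions of pieces: `Δ_{l,j}` consists of the points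
`(x, l)` of the tower for which the piece of `x` has the label `j` on the level `l`. -/
structure TowerData (Λ ι : Type*) where
  cell : Λ → ι
  R : ι → ℕ
  R_pos : ∀ i, 0 < R i
  ret : Λ → Λ
  label : ℕ → ι → ℕ

namespace TowerData

variable {Λ ι : Type*} (D : TowerData Λ ι)

/-- The tower `Δ = {(x, l) : x ∈ Λ, 0 ≤ l < R(x)}`. -/
abbrev Tower : Type _ := {p : Λ × ℕ // p.2 < D.R (D.cell p.1)}

variable {D} in
/-- The point of the base below a point of the tower. -/
def base (p : D.Tower) : Λ := p.1.1

variable {D} in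
/-- The level of a point of the tower. -/
def level (p : D.Tower) : ℕ := p.1.2

/-- The tower map: one level up, or back to the base by the return map. -/
def F (p : D.Tower) : D.Tower :=
  if h : level p + 1 < D.R (D.cell (base p)) then ⟨(base p, level p + 1), h⟩
  else ⟨(D.ret (base p), 0), D.R_pos _⟩

/-- The element `Δ_{l,j}` of the partition `𝒟`. -/
def element (l j : ℕ) : Set D.Tower :=
  {p | level p = l ∧ D.label l (D.cell (base p)) = j}

/-- The level `Δ_l`. -/
def levelSet (l : ℕ) : Set D.Tower := {p | level p = l}

/-- `Δ*_{l,j} = Δ_{l,j} ∩ F⁻¹ Δ_0`, the part of `Δ_{l,j}` that returns to the base. -/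
def returning (l j : ℕ) : Set D.Tower := D.element l j ∩ D.F ⁻¹' D.levelSet 0

/-- `p` and `q` lie in the same element of `𝒟`. -/
def SameElement (p q : D.Tower) : Prop := ∃ l j, p ∈ D.element l j ∧ q ∈ D.element l j

/-- The separation time `s(p, q)`: the largest `n` such that `F^i p` and `F^i q` lie in the same
element of `𝒟` for all `i ≤ n`; it is `⊤` if they always do, and `0` if there is no such `n`. -/
def sep (p q : D.Tower) : ℕ∞ :=
  ⨆ (n : ℕ) (_ : ∀ i ≤ n, D.SameElement (D.F^[i] p) (D.F^[i] q)), (n : ℕ∞)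

/-- `β ^ s(p, q)`, with `β ^ ∞ = 0`. -/
def sepDist (β : ℝ) (p q : D.Tower) : ℝ :=
  if D.sep p q = ⊤ then 0 else β ^ (D.sep p q).toNat

end TowerData

/-- A quotient tower (Young's symbolic system). The base `Λ` stands for the hyperbolic product set
modulo stable disks, from which the null set of points that do not return infinitely often has been
removed, so that the return map is defined everywhere. -/
structure QuotientTower (Λ ι : Type*) [MeasurableSpace Λ] extends TowerData Λ ι where
  /-- the reference measure on the base -/
  m : Measure Λ
  m_finite : IsFiniteMeasure m
  m_ne_zero : m ≠ 0
  measurableSet_cell : ∀ i, MeasurableSet (cell ⁻¹' {i})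
  measurable_ret : Measurable ret
  /-- the return map takes each piece bijectively onto the base -/
  bijOn_ret : ∀ i, BijOn ret (cell ⁻¹' {i}) univ
  /-- each level has finitely many elements of `𝒟` -/
  finite_label : ∀ l, {j | ∃ i, l < R i ∧ label l i = j}.Finite
  /-- `𝒟_{l+1}` refines `F 𝒟_l` -/
  label_refines : ∀ l i i', l + 1 < R i → l + 1 < R i' →
    label (l + 1) i = label (l + 1) i' → label l i = label l i'
  /-- different pieces with the same return time are separated by `𝒟` on the top level -/
  label_top : ∀ l i i', R i = l + 1 → R i' = l + 1 → label l i = label l i' → i = i'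
  /-- `𝒟` is generating: points that are never separated are equal -/
  eq_of_sep_eq_top : ∀ p q : toTowerData.Tower, toTowerData.sep p q = ⊤ → p = q
  /-- the Jacobian `J(T^R)` of the return map with respect to `m` -/
  J : Λ → ℝ
  measurable_J : Measurable J
  J_pos : ∀ x, 0 < J x
  measure_image_ret : ∀ i, ∀ A ⊆ cell ⁻¹' {i}, MeasurableSet A →
    m (ret '' A) = ∫⁻ x in A, ENNReal.ofReal (J x) ∂m
  /-- the constants of the tower -/
  β : ℝ
  C₁ : ℝ
  C₀ : ℝ
  θ₀ : ℝ
  β_pos : 0 < β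
  β_lt_one : β < 1
  C₁_pos : 0 < C₁
  C₀_pos : 0 < C₀
  θ₀_pos : 0 < θ₀
  θ₀_lt_one : θ₀ < 1
  /-- height of the tower -/
  le_R : ∃ N : ℕ, C₁ * Real.exp C₁ * β ^ N ≤ 1 / 100 ∧ ∀ i, N ≤ R i
  /-- exponential tail of the return time -/
  tail : ∀ n : ℕ, m {x | n ≤ R (cell x)} ≤ ENNReal.ofReal (C₀ * θ₀ ^ n)
  /-- regularity of the Jacobian: for `p`, `q` in the same `Δ*_{l,j}`,
  `|JF(p) / JF(q) - 1| ≤ C₁ β ^ s(F p, F q)` -/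
  distortion : ∀ l j, ∀ p ∈ toTowerData.returning l j, ∀ q ∈ toTowerData.returning l j,
    |J (TowerData.base p) / J (TowerData.base q) - 1| ≤
      C₁ * toTowerData.sepDist β (toTowerData.F p) (toTowerData.F q)

namespace QuotientTower

variable {Λ ι : Type*} [MeasurableSpace Λ] (Y : QuotientTower Λ ι)

/-- The reference measure on the tower: the copy of `m` on each level. -/
def mbar : Measure Y.Tower :=
  Measure.comap (Subtype.val : Y.Tower → Λ × ℕ) (Y.m.prod Measure.count)

/-- The Jacobian of the tower map: `1` below the top, `J(T^R)` at the top. -/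
def JF (p : Y.Tower) : ℝ :=
  if TowerData.level p + 1 < Y.R (Y.cell (TowerData.base p)) then 1 else Y.J (TowerData.base p)

/-- The Perron-Frobenius operator `P φ (x) = ∑_{F y = x} φ(y) / JF(y)`. -/
def transfer (φ : Y.Tower → ℂ) (x : Y.Tower) : ℂ :=
  ∑' y : {y : Y.Tower // Y.F y = x}, φ y / (Y.JF y : ℂ)

/-- `f` is bounded, and Lipschitz with respect to `β ^ s`. -/
def BoundedLipschitz {E : Type*} [NormedAddCommGroup E] (f : Y.Tower → E) : Prop :=
  (∃ B : ℝ, ∀ p, ‖f p‖ ≤ B) ∧ ∃ C : ℝ, ∀ p q, ‖f p - f q‖ ≤ C * Y.sepDist Y.β p q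

/-- The conditions on the weight `ε > 0` of the function spaces: `e^{2ε} θ₀ < 1` and
`m(Δ_0)⁻¹ ∑_{l,j} m(Δ*_{l,j}) e^{lε} ≤ 2`. -/
def AdmissibleWeight (ε : ℝ) : Prop :=
  0 < ε ∧ Real.exp (2 * ε) * Y.θ₀ < 1 ∧
    (Y.mbar (Y.levelSet 0))⁻¹ *
      ∑' (l : ℕ) (j : ℕ), Y.mbar (Y.returning l j) * ENNReal.ofReal (Real.exp (l * ε)) ≤ 2

/-- The norm of `𝒞`: the supremum over the `Δ_{l,j}` of `‖φ|Δ_{l,j}‖_∞ e^{-lε}`. -/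
def normC (ε : ℝ) (φ : Y.Tower → ℂ) : ℝ≥0∞ :=
  ⨆ (l : ℕ) (j : ℕ), essSup (fun p => ‖φ p‖ₑ) (Y.mbar.restrict (Y.element l j)) *
    ENNReal.ofReal (Real.exp (-(l * ε)))

/-- The Lipschitz seminorm `‖φ‖_h`: the supremum over the `Δ_{l,j}` of `e^{-lε}` times the essential
supremum of `|φ(p) - φ(q)| / β ^ s(p, q)` over `p, q ∈ Δ_{l,j}`. -/
def seminormH (ε : ℝ) (φ : Y.Tower → ℂ) : ℝ≥0∞ :=
  ⨆ (l : ℕ) (j : ℕ),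
    essSup (fun z : Y.Tower × Y.Tower =>
        ‖φ z.1 - φ z.2‖ₑ / ENNReal.ofReal (Y.sepDist Y.β z.1 z.2))
      ((Y.mbar.prod Y.mbar).restrict (Y.element l j ×ˢ Y.element l j)) *
    ENNReal.ofReal (Real.exp (-(l * ε)))

/-- `φ` belongs to `ℒ`: its norm `‖φ‖_𝒞 + ‖φ‖_h` is finite. -/
def MemL (ε : ℝ) (φ : Y.Tower → ℂ) : Prop :=
  AEMeasurable φ Y.mbar ∧ Y.normC ε φ + Y.seminormH ε φ < ∞

/-- The density `ρ = dν/dm`. -/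
def density (ν : Measure Y.Tower) (p : Y.Tower) : ℝ := (ν.rnDeriv Y.mbar p).toReal

variable {d : ℕ}

/-- `P_t^ρ φ = ρ⁻¹ P (ρ e^{i⟨t,f⟩} φ)`. -/
def fourierTransfer (ν : Measure Y.Tower) (f : Y.Tower → EuclideanSpace ℝ (Fin d))
    (t : EuclideanSpace ℝ (Fin d)) (φ : Y.Tower → ℂ) (x : Y.Tower) : ℂ :=
  (Y.density ν x : ℂ)⁻¹ *
    Y.transfer
      (fun y => (Y.density ν y : ℂ) * (Complex.exp (Complex.I * (inner ℝ t (f y) : ℝ)) * φ y)) x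

/-- `lam` is a unimodular eigenvalue of `P_t^ρ` on `ℒ` (functions are identified when they agree
almost everywhere). -/
def IsUnimodularEigenvalue (ν : Measure Y.Tower) (f : Y.Tower → EuclideanSpace ℝ (Fin d))
    (ε : ℝ) (t : EuclideanSpace ℝ (Fin d)) (lam : ℂ) : Prop :=
  ‖lam‖ = 1 ∧ ∃ φ : Y.Tower → ℂ, Y.MemL ε φ ∧ ¬ φ =ᵐ[Y.mbar] 0 ∧
    ∀ᵐ x ∂Y.mbar, Y.fourierTransfer ν f t φ x = lam * φ x

end QuotientTower

end

open MeasureTheory Set Filter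
open scoped ENNReal Topology

/-! Consider the pairs `(t, z)` for which `exp (i⟨t, f⟩) * u = z * u ∘ F` almost everywhere for some
measurable circle-valued `u`. They form a subgroup `Γ` of `ℝ^d × 𝕋`. The theorem follows once the
unimodular eigenvalues of `P_t^ρ` are identified with the `z` of such pairs, and `Γ` is shown to be
closed and to be a graph over its projection `G`.

From eigenvalues to solutions (`ae_eq_of_fourierTransfer_eq`): the eigenvalue equation says that `λ
φ(x)` is the mean of `e^{i⟨t, f⟩} φ` over the preimages `y` of `x`, with weights `ρ(y) / (JF(y)
ρ(x))`. Since `φ` is square integrable and `P` preserves integrals, the integrated variance of these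
means is zero, so all the averaged values coincide. Ergodicity makes `|φ|` constant, and `φ / |φ|`
is a solution.

From solutions to eigenfunctions (`exists_lipschitz_solution`): bounded distortion and martingale
convergence give inverse branches of iterates of the return map along which `u` becomes almost
constant. Iterating forward, only the differences of the Birkhoff sums of `f` remain, so `u` is
Lipschitz almost everywhere with a constant `C ‖t‖` that does not depend on `u` or `z`; hence `u`
lies in `ℒ`.

The factor `‖t‖` also yields the other analytic inputs. For `t = 0` a solution is constant on the
base, and ergodicity of all powers of `F` forces `z = 1`. Quotients of solutions for nearby
frequencies are almost constant on the base, so normalized solutions converge and `Γ` is closed.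
Solutions for `s v` with small `s` have a consistent logarithm, so a line in `G` produces a real
coboundary.

The rest is duality. A closed graph subgroup is the graph of `t ↦ e^{i⟨t, r⟩}` over `G`. If some `g
∼ f` has values in `V + c`, then the annihilator of `V` lies in `G`, so `V + c` contains `G^⊥ + r`;
conversely, in coordinates adapted to `G`, one builds `g ∼ f` with values in `G^⊥ + r`. Modifying a
minimal function by the coboundary of `v 1_B`, `v ∈ G^⊥`, decides uniqueness. -/

noncomputable section

/-! ### Closed subgroups of Euclidean spaces and their annihilators -/

section ClosedSubgroups

open Module Submodule

universe u

variable {E : Type u} [NormedAddCommGroup E] [InnerProductSpace ℝ E] [FiniteDimensional ℝ E]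

/-- The largest linear subspace contained in an additive subgroup. -/
def AddSubgroup.linearPart {E : Type*} [AddCommGroup E] [Module ℝ E] (V : AddSubgroup E) :
    Submodule ℝ E where
  carrier := {v | ∀ s : ℝ, s • v ∈ V}
  add_mem' := fun ha hb s => by rw [smul_add]; exact V.add_mem (ha s) (hb s)
  zero_mem' := fun s => by simp [V.zero_mem]
  smul_mem' := fun c x hx s => by rw [smul_smul]; exact hx _

omit [FiniteDimensional ℝ E] in
theorem AddSubgroup.linearPart_le {V : AddSubgroup E} {v : E} (h : v ∈ V.linearPart) : v ∈ V := by
  simpa using h 1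

omit [FiniteDimensional ℝ E] in
/-- Multiples of vectors of a closed subgroup that tend to zero fill a line in the limit. -/
theorem smul_mem_of_tendsto_normalize {V : AddSubgroup E} (hV : IsClosed (V : Set E))
    {x : ℕ → E} (hxV : ∀ n, x n ∈ V) (hx0 : ∀ n, x n ≠ 0) (hx : Tendsto x atTop (𝓝 0)) {v : E}
    (hv : Tendsto (fun n => ‖x n‖⁻¹ • x n) atTop (𝓝 v)) (s : ℝ) : s • v ∈ V := by
  -- Rounding the multiplier `s / ‖x n‖` to an integer stays in `V` and moves the vector by at most
  -- `‖x n‖`, which tends to zero.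
  refine hV.mem_of_tendsto (f := fun n => ⌊s / ‖x n‖⌋ • x n) (b := atTop) ?_
    (Eventually.of_forall fun n => V.zsmul_mem (hxV n) _)
  have h1 : Tendsto (fun n => s • (‖x n‖⁻¹ • x n)) atTop (𝓝 (s • v)) := hv.const_smul s
  have h2 : Tendsto (fun n => ⌊s / ‖x n‖⌋ • x n - s • (‖x n‖⁻¹ • x n)) atTop (𝓝 0) := by
    refine squeeze_zero_norm (a := fun n => ‖x n‖) (fun n => ?_) (by simpa using hx.norm)
    have hpos : 0 < ‖x n‖ := norm_pos_iff.2 (hx0 n)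
    rw [← Int.cast_smul_eq_zsmul ℝ, smul_smul, ← sub_smul, norm_smul]
    have : ‖(⌊s / ‖x n‖⌋ : ℝ) - s * ‖x n‖⁻¹‖ ≤ 1 := by
      rw [← div_eq_mul_inv, Real.norm_eq_abs, abs_le]
      constructor <;> linarith [Int.floor_le (s / ‖x n‖), Int.lt_floor_add_one (s / ‖x n‖)]
    nlinarith
  simpa using h2.add h1

/-- By compactness of the unit sphere: the directions of ever shorter vectors of `V` orthogonal to
its linear part would have a limit that lies both in the linear part and in its orthogonal
complement, yet has norm one. Hence `V` is discrete transversally to its linear part. -/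
theorem exists_ball_inter_orthogonal_linearPart {V : AddSubgroup E} (hV : IsClosed (V : Set E)) :
    ∃ r > 0, ∀ x ∈ V, x ∈ V.linearPartᗮ → ‖x‖ < r → x = 0 := by
  by_contra! hcon
  choose x hxV hxU hxn hx0 using fun n : ℕ => hcon (1 / (n + 1)) (by positivity)
  have hx : Tendsto x atTop (𝓝 0) :=
    squeeze_zero_norm (fun n => (hxn n).le) tendsto_one_div_add_atTop_nhds_zero_nat
  have hs : ∀ n, ‖x n‖⁻¹ • x n ∈ Metric.sphere (0 : E) 1 := fun n => by
    simp [norm_smul, norm_ne_zero_iff.2 (hx0 n)]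
  obtain ⟨v, hv, φ, hφ, hlim⟩ := (isCompact_sphere (0 : E) 1).tendsto_subseq hs
  have hvU : v ∈ V.linearPart := fun s =>
    smul_mem_of_tendsto_normalize hV (fun n => hxV (φ n)) (fun n => hx0 (φ n))
      (hx.comp hφ.tendsto_atTop) hlim s
  have hvU' : v ∈ V.linearPartᗮ :=
    (Submodule.isClosed_orthogonal _).mem_of_tendsto hlim
      (Eventually.of_forall fun n => Submodule.smul_mem _ _ (hxU _))
  have : v = 0 := by
    have := (Submodule.mem_orthogonal _ _).1 hvU' v hvU
    simpa using this
  simp [this] at hv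

/-- A discrete subgroup of a finite-dimensional space is the integral span of a linearly
independent family. -/
theorem exists_linearIndependent_of_discrete (L : Submodule ℤ E) [DiscreteTopology L] :
    ∃ (κ : Type) (_ : Fintype κ) (c : κ → E), LinearIndependent ℝ c ∧ (∀ k, c k ∈ L) ∧
      ∀ x, x ∈ L → ∃ a : κ → ℤ, x = ∑ k, (a k : ℝ) • c k := by
  -- Inside its own real span the group is a full lattice, so an integral basis is automatically a
  -- real basis there.
  let f := (span ℝ (L : Set E)).subtype
  let L₀ := L.comap (f.restrictScalars ℤ)
  have h_img : f '' L₀ = L := by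
    rw [← LinearMap.coe_restrictScalars ℤ f, ← Submodule.map_coe (f.restrictScalars ℤ),
      Submodule.map_comap_eq_self]
    exact fun x hx ↦ LinearMap.mem_range.mpr ⟨⟨x, Submodule.subset_span hx⟩, rfl⟩
  have : DiscreteTopology L₀ := by
    refine DiscreteTopology.preimage_of_continuous_injective (L : Set E) ?_ (injective_subtype _)
    exact LinearMap.continuous_of_finiteDimensional f
  have : IsZLattice ℝ L₀ := ⟨by
    rw [← (Submodule.map_injective_of_injective (injective_subtype _)).eq_iff, Submodule.map_span,
      Submodule.map_top, range_subtype, h_img]⟩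
  let b := Free.chooseBasis ℤ L₀
  let e := Fintype.equivFin (Free.ChooseBasisIndex ℤ L₀)
  let b' := b.reindex e
  let c := b'.ofZLatticeBasis ℝ
  refine ⟨_, inferInstance, fun k => f (c k), ?_, fun k => ?_, fun x hx => ?_⟩
  · exact c.linearIndependent.map' f (by simp [f])
  · have : f (c k) = f (b' k) := by simp only [c, Basis.ofZLatticeBasis_apply]
    change f (c k) ∈ L
    rw [this]
    exact (b' k).2
  · let y : L₀ := ⟨⟨x, Submodule.subset_span hx⟩, hx⟩
    refine ⟨fun k => b'.repr y k, ?_⟩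
    have := congrArg f (c.sum_repr (y : span ℝ (L : Set E)))
    simp only [c, Basis.ofZLatticeBasis_repr_apply, map_sum, map_smul] at this
    rw [← show f (y : span ℝ (L : Set E)) = x from rfl, ← this]

/-- The structure of the closed subgroups of a Euclidean space: in suitable coordinates, some of
the coordinates are arbitrary, some are integers and the others vanish. -/
theorem exists_basis_of_isClosed {V : AddSubgroup E} (hV : IsClosed (V : Set E)) :
    ∃ (α κ γ : Type u) (_ : Fintype α) (_ : Fintype κ) (_ : Fintype γ)
      (b : Basis ((α ⊕ κ) ⊕ γ) ℝ E),
      ∀ x, x ∈ V ↔ (∀ k, ∃ n : ℤ, b.repr x (.inl (.inr k)) = n) ∧ ∀ c, b.repr x (.inr c) = 0 := by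
  set U := V.linearPart with hU
  -- `V` splits as `U ⊕ L` with `L` discrete. A basis of `U` gives the free coordinates, a lattice
  -- basis of `L` the integer ones, and an extension to a basis of `E` the vanishing ones.
  let L : Submodule ℤ E := (V ⊓ (Uᗮ).toAddSubgroup).toIntSubmodule
  have hL : ∀ x, x ∈ L ↔ x ∈ V ∧ x ∈ Uᗮ := fun x => Iff.rfl
  have hdisc : DiscreteTopology L := by
    obtain ⟨r, hr, h⟩ := exists_ball_inter_orthogonal_linearPart hV
    refine discreteTopology_of_isOpen_singleton_zero ?_
    rw [Metric.isOpen_singleton_iff]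
    refine ⟨r, hr, fun y hy => ?_⟩
    rw [dist_zero_right] at hy
    exact Subtype.ext (h y y.2.1 y.2.2 hy)
  obtain ⟨κ, hκ, c, hc, hcL, hcs⟩ := exists_linearIndependent_of_discrete L
  let w := finBasis ℝ U
  have hw : LinearIndependent ℝ fun i => (w i : E) := w.linearIndependent.map' U.subtype (by simp)
  have hdisj : Disjoint (span ℝ (range fun i => (w i : E))) (span ℝ (range c)) := by
    refine Disjoint.mono ?_ ?_ (Submodule.orthogonal_disjoint U)
    · rw [span_le]; rintro _ ⟨i, rfl⟩; exact (w i).2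
    · rw [span_le]; rintro _ ⟨i, rfl⟩; exact ((hL _).1 (hcL i)).2
  have hli : LinearIndependent ℝ (Sum.elim (fun i => (w i : E)) c) := hw.sum_type hc hdisj
  let b := Basis.sumExtend hli
  have : Finite ((Fin (finrank ℝ U) ⊕ κ) ⊕ Basis.sumExtendIndex hli) :=
    Module.Finite.finite_basis b
  have hfin : Finite (Basis.sumExtendIndex hli) :=
    Finite.of_injective (Sum.inr : _ → (Fin (finrank ℝ U) ⊕ κ) ⊕ Basis.sumExtendIndex hli)
      Sum.inr_injective
  have hγ : Fintype (Basis.sumExtendIndex hli) := Fintype.ofFinite _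
  have hb : ∀ i, b (.inl i) = Sum.elim (fun i => (w i : E)) c i := fun i => by
    simp only [b, Basis.sumExtend, Basis.reindex_apply, Basis.coe_extend]
    rfl
  refine ⟨ULift (Fin (finrank ℝ U)), ULift κ, Basis.sumExtendIndex hli, inferInstance,
    inferInstance, hγ, b.reindex (Equiv.sumCongr (Equiv.sumCongr Equiv.ulift.symm
      Equiv.ulift.symm) (Equiv.refl _)), fun x => ?_⟩
  simp only [Basis.repr_reindex_apply]
  constructor
  · intro hx
    obtain ⟨y, hy, z, hz, rfl⟩ := U.exists_add_mem_mem_orthogonal x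
    have hzV : z ∈ V := by
      have := V.sub_mem hx (AddSubgroup.linearPart_le hy)
      simpa using this
    obtain ⟨a, ha⟩ := hcs z ⟨hzV, hz⟩
    have hy' : y = ∑ i, w.repr ⟨y, hy⟩ i • (w i : E) := by
      have := congrArg U.subtype (w.sum_repr ⟨y, hy⟩).symm
      rw [map_sum] at this
      exact this
    have key : y + z = ∑ i, (Sum.elim (Sum.elim (fun i => w.repr ⟨y, hy⟩ i) fun k => (a k : ℝ))
        fun _ => 0) i • b i := by
      rw [Fintype.sum_sum_type, Fintype.sum_sum_type]
      simp only [hb, Sum.elim_inl, Sum.elim_inr, zero_smul, Finset.sum_const_zero, add_zero]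
      rw [← hy', ← ha]
    rw [key, b.repr_sum_self]
    exact ⟨fun k => ⟨a k.down, rfl⟩, fun c => rfl⟩
  · rintro ⟨h1, h2⟩
    rw [← b.sum_repr x, Fintype.sum_sum_type, Fintype.sum_sum_type]
    refine V.add_mem (V.add_mem (V.sum_mem fun i _ => ?_) (V.sum_mem fun i _ => ?_))
      (V.sum_mem fun i _ => ?_)
    · rw [hb]; exact (w i).2 _
    · rw [hb]
      obtain ⟨n, hn⟩ := h1 ⟨i⟩
      have hn' : b.repr x (.inl (.inr i)) = n := hn
      rw [hn', Int.cast_smul_eq_zsmul]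
      exact V.zsmul_mem ((hL _).1 (hcL i)).1 _
    · have h3 : b.repr x (.inr i) = 0 := h2 i
      rw [h3, zero_smul]; exact V.zero_mem

theorem circle_exp_eq_one_iff {x : ℝ} : Circle.exp x = 1 ↔ ∃ n : ℤ, x = n * (2 * Real.pi) := by
  rw [← Circle.exp_zero, Circle.exp_eq_exp]
  simp

theorem circle_exp_pi_ne_one : Circle.exp Real.pi ≠ 1 := by
  intro h
  obtain ⟨n, hn⟩ := circle_exp_eq_one_iff.1 h
  have h1 : (2 * n - 1 : ℝ) * Real.pi = 0 := by linarith
  have h2 : (2 * n - 1 : ℝ) = 0 := (mul_eq_zero.1 h1).resolve_right Real.pi_ne_zero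
  have h3 : 2 * n - 1 = 0 := by exact_mod_cast h2
  omega

/-- The annihilator of a set of vectors, as a closed subgroup. -/
def charAnnihilator {E : Type*} [NormedAddCommGroup E] [InnerProductSpace ℝ E] (V : AddSubgroup E) :
    AddSubgroup E where
  carrier := {x | ∀ t ∈ V, Circle.exp (inner ℝ t x) = 1}
  add_mem' := fun ha hb t ht => by rw [inner_add_right, Circle.exp_add, ha t ht, hb t ht, one_mul]
  zero_mem' := fun t _ => by simp
  neg_mem' := fun ha t ht => by rw [inner_neg_right, Circle.exp_neg, ha t ht, inv_one]

omit [FiniteDimensional ℝ E] in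
theorem mem_charAnnihilator {V : AddSubgroup E} {x : E} :
    x ∈ charAnnihilator V ↔ ∀ t ∈ V, Circle.exp (inner ℝ t x) = 1 := Iff.rfl

omit [FiniteDimensional ℝ E] in
theorem isClosed_charAnnihilator (V : AddSubgroup E) : IsClosed (charAnnihilator V : Set E) := by
  have : (charAnnihilator V : Set E) = ⋂ t ∈ V, {x | Circle.exp (inner ℝ t x) = 1} := by
    ext x; simp [mem_charAnnihilator]
  rw [this]
  refine isClosed_biInter fun t _ => isClosed_eq ?_ continuous_const
  exact Circle.exp.continuous.comp (continuous_const.inner continuous_id)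

omit [FiniteDimensional ℝ E] in
theorem coe_charAnnihilator_eq_dualOfQuotient (G : AddSubgroup E) :
    (charAnnihilator G : Set E) = dualOfQuotient G := by
  ext x; rw [mem_dualOfQuotient]; rfl

/-- A point outside a closed subgroup is detected by a character that annihilates the subgroup. -/
theorem exists_charAnnihilator_of_notMem {V : AddSubgroup E} (hV : IsClosed (V : Set E)) {x : E}
    (hx : x ∉ V) : ∃ t ∈ charAnnihilator V, Circle.exp (inner ℝ t x) ≠ 1 := by
  obtain ⟨α, κ, γ, _, _, _, b, hb⟩ := exists_basis_of_isClosed hV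
  have hdual : ∀ φ : E →ₗ[ℝ] ℝ, ∃ t : E, ∀ y, inner ℝ t y = φ y := fun φ =>
    ⟨(InnerProductSpace.toDual ℝ E).symm (LinearMap.toContinuousLinearMap φ), fun y => by simp⟩
  rw [hb, not_and_or] at hx
  rcases hx with hx | hx
  · push Not at hx
    obtain ⟨k, hk⟩ := hx
    -- This functional has values in `2πℤ` on `V`, but not at `x`, whose coordinate `k` is not an
    -- integer.
    obtain ⟨t, ht⟩ := hdual ((2 * Real.pi) • b.coord (.inl (.inr k)))
    refine ⟨t, fun y hy => ?_, fun h => ?_⟩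
    · rw [real_inner_comm, ht]
      obtain ⟨n, hn⟩ := ((hb y).1 hy).1 k
      rw [circle_exp_eq_one_iff]
      exact ⟨n, by simp [hn]; ring⟩
    · rw [ht, circle_exp_eq_one_iff] at h
      obtain ⟨n, hn⟩ := h
      simp only [LinearMap.smul_apply, Basis.coord_apply, smul_eq_mul] at hn
      exact hk n (mul_left_cancel₀ (by positivity : (2 * Real.pi) ≠ 0) (by rw [hn]; ring))
  · push Not at hx
    obtain ⟨c, hc⟩ := hx
    -- The functional vanishes on `V` and is scaled to equal `π` at `x`.
    obtain ⟨t, ht⟩ := hdual ((Real.pi / b.repr x (.inr c)) • b.coord (.inr c))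
    refine ⟨t, fun y hy => ?_, fun h => ?_⟩
    · rw [real_inner_comm, ht]
      simp [((hb y).1 hy).2 c]
    · rw [ht] at h
      simp only [LinearMap.smul_apply, Basis.coord_apply, smul_eq_mul, div_mul_cancel₀ _ hc] at h
      exact circle_exp_pi_ne_one h

theorem charAnnihilator_charAnnihilator {V : AddSubgroup E} (hV : IsClosed (V : Set E)) :
    charAnnihilator (charAnnihilator V) = V := by
  ext x
  constructor
  · intro hx
    by_contra hcon
    obtain ⟨t, ht, h⟩ := exists_charAnnihilator_of_notMem hV hcon
    exact h (hx t ht)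
  · intro hx t ht
    rw [real_inner_comm]
    exact ht x hx

/-- A closed subgroup of `E × 𝕋` that is the graph of a function on its projection to `E` is the
graph of the restriction of a character of `E`. -/
theorem exists_character_of_isClosed_graph (Γ : AddSubgroup (E × Additive Circle))
    (hΓ : IsClosed (Γ : Set (E × Additive Circle)))
    (hgraph : ∀ z : Circle, ((0 : E), Additive.ofMul z) ∈ Γ → z = 1) :
    ∃ r : E, ∀ t z, (t, Additive.ofMul z) ∈ Γ → z = Circle.exp (inner ℝ t r) := by
  -- Unrolling the circle turns `Γ` into a closed subgroup of a Euclidean space, where double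
  -- annihilators are available. A vector of the annihilator with last coordinate `-1` is exactly a
  -- character whose graph contains `Γ`; the task is to find one.
  let π : WithLp 2 (E × ℝ) →+ E × Additive Circle :=
    { toFun := fun p => (p.fst, Additive.ofMul (Circle.exp p.snd))
      map_zero' := by simp
      map_add' := fun p q => by simp [Circle.exp_add] }
  have hπ : Continuous π := by
    have h1 : Continuous fun p : WithLp 2 (E × ℝ) => p.fst := by fun_prop
    have h2 : Continuous fun p : WithLp 2 (E × ℝ) => p.snd := by fun_prop
    exact h1.prodMk (continuous_ofMul.comp (Circle.exp.continuous.comp h2))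
  let Γ' := Γ.comap π
  have hΓ' : IsClosed (Γ' : Set (WithLp 2 (E × ℝ))) := hΓ.preimage hπ
  have hmem : ∀ p, p ∈ Γ' ↔ (p.fst, Additive.ofMul (Circle.exp p.snd)) ∈ Γ := fun p => Iff.rfl
  have hinner : ∀ p q : WithLp 2 (E × ℝ), inner ℝ p q = inner ℝ p.fst q.fst + q.snd * p.snd :=
    fun p q => by simp [WithLp.prod_inner_apply]
  -- the last coordinates of the annihilator of the lifted group
  let N : AddSubgroup ℤ :=
    { carrier := {n | ∃ q ∈ charAnnihilator Γ', q.snd = n}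
      add_mem' := by
        rintro a b ⟨p, hp, hpa⟩ ⟨q, hq, hqb⟩
        exact ⟨p + q, add_mem hp hq, by simp [hpa, hqb]⟩
      zero_mem' := ⟨0, zero_mem _, by simp⟩
      neg_mem' := by
        rintro a ⟨p, hp, hpa⟩
        exact ⟨-p, neg_mem hp, by simp [hpa]⟩ }
  have hint : ∀ q ∈ charAnnihilator Γ', ∃ n : ℤ, q.snd = n := by
    intro q hq
    -- The lifted group contains the period `(0, 2π)`, and this makes the last coordinates of its
    -- annihilator integral.
    have h := hq (WithLp.toLp 2 ((0 : E), 2 * Real.pi)) (by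
      change ((0 : E), Additive.ofMul (Circle.exp (2 * Real.pi))) ∈ Γ
      rw [show Circle.exp (2 * Real.pi) = 1 from Circle.exp_two_pi]
      exact Γ.zero_mem)
    rw [hinner] at h
    change Circle.exp (inner ℝ (0 : E) q.fst + q.snd * (2 * Real.pi)) = 1 at h
    rw [inner_zero_left, zero_add] at h
    obtain ⟨n, hn⟩ := circle_exp_eq_one_iff.1 h
    exact ⟨n, mul_right_cancel₀ (by positivity : (2 * Real.pi) ≠ 0) hn⟩
  obtain ⟨g, hg⟩ := Int.subgroup_cyclic N
  -- every point of the fibre over zero is detected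
  have hfib : ∀ a : ℝ, (∀ n ∈ N, Circle.exp (n * a) = 1) → Circle.exp a = 1 := by
    intro a ha
    refine hgraph _ ?_
    have : WithLp.toLp 2 ((0 : E), a) ∈ charAnnihilator (charAnnihilator Γ') := by
      intro q hq
      obtain ⟨n, hn⟩ := hint q hq
      rw [hinner]
      change Circle.exp (inner ℝ q.fst (0 : E) + a * q.snd) = 1
      rw [inner_zero_right, zero_add, hn, mul_comm]
      exact ha n ⟨q, hq, hn⟩
    rw [charAnnihilator_charAnnihilator hΓ', hmem] at this
    exact this
  have hdiv : ∀ n ∈ N, ∃ k : ℤ, n = k * g := by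
    intro n hn
    rw [hg, AddSubgroup.mem_closure_singleton] at hn
    obtain ⟨k, hk⟩ := hn
    exact ⟨k, by rw [← hk, smul_eq_mul]⟩
  -- The generator `g` of `N` is a unit. If `g = 0`, then `hfib` would apply to `π`; otherwise it
  -- applies to `2π / g`, which is therefore a multiple of `2π`.
  have hgu : ∃ j : ℤ, j * g = -1 := by
    have hg0 : g ≠ 0 := by
      rintro rfl
      exact circle_exp_pi_ne_one (hfib Real.pi (fun n hn => by
        obtain ⟨k, hk⟩ := hdiv n hn
        simp [hk]))
    have h := hfib (2 * Real.pi / g) (fun n hn => by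
      obtain ⟨k, hk⟩ := hdiv n hn
      rw [circle_exp_eq_one_iff]
      have : (g : ℝ) ≠ 0 := by exact_mod_cast hg0
      exact ⟨k, by rw [hk]; push_cast; field_simp⟩)
    obtain ⟨n, hn⟩ := circle_exp_eq_one_iff.1 h
    have hg' : (g : ℝ) ≠ 0 := by exact_mod_cast hg0
    have h1 : (n : ℝ) * g = 1 := by
      have hpi : (2 * Real.pi) ≠ 0 := by positivity
      field_simp at hn
      linarith
    refine ⟨-n, ?_⟩
    have : n * g = 1 := by exact_mod_cast h1
    linarith
  obtain ⟨j, hj⟩ := hgu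
  have hm1 : (-1 : ℤ) ∈ N := by
    rw [hg, AddSubgroup.mem_closure_singleton]
    exact ⟨j, by simpa using hj⟩
  obtain ⟨q, hq, hq1⟩ := hm1
  refine ⟨q.fst, fun t z htz => ?_⟩
  obtain ⟨a, rfl⟩ := Circle.exp_surjective z
  have h := hq (WithLp.toLp 2 (t, a)) htz
  rw [hinner, hq1] at h
  simp only [Int.cast_neg, Int.cast_one, neg_mul, one_mul, ← sub_eq_add_neg, Circle.exp_sub] at h
  exact (div_eq_one.1 h).symm

end ClosedSubgroups
end

/-! ### Circle-valued cohomology and the minimal lattice over an abstract system -/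

noncomputable section

instance : MeasurableSpace Circle := borel Circle

instance : BorelSpace Circle := ⟨rfl⟩

theorem continuous_circle_coe : Continuous fun z : Circle => (z : ℂ) := continuous_induced_dom

theorem measurable_circle_coe : Measurable fun z : Circle => (z : ℂ) :=
  continuous_circle_coe.measurable

section CohomologyClasses

variable {X : Type*} [MeasurableSpace X] {E : Type*} [NormedAddCommGroup E]
  [InnerProductSpace ℝ E] [FiniteDimensional ℝ E] [MeasurableSpace E] [BorelSpace E]
  {T : X → X} {ν : Measure X} {f g : X → E}

namespace Cohomologous

omit [InnerProductSpace ℝ E] [FiniteDimensional ℝ E] in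
theorem symm [SecondCountableTopology E] (h : Cohomologous T ν f g) : Cohomologous T ν g f := by
  obtain ⟨k, hk, h⟩ := h
  refine ⟨fun x => -k x, hk.neg, ?_⟩
  filter_upwards [h] with x hx
  rw [← neg_sub, hx]; abel

omit [InnerProductSpace ℝ E] [FiniteDimensional ℝ E] in
theorem trans [SecondCountableTopology E] {g' : X → E} (h : Cohomologous T ν f g)
    (h' : Cohomologous T ν g g') : Cohomologous T ν f g' := by
  obtain ⟨k, hk, h⟩ := h
  obtain ⟨k', hk', h'⟩ := h'
  refine ⟨fun x => k x + k' x, hk.add hk', ?_⟩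
  filter_upwards [h, h'] with x hx hx'
  rw [← sub_add_sub_cancel, hx, hx']; abel

omit [InnerProductSpace ℝ E] [FiniteDimensional ℝ E] in
theorem minimalLattice_eq [SecondCountableTopology E] (h : Cohomologous T ν f g) :
    minimalLattice T ν f = minimalLattice T ν g := by
  unfold minimalLattice
  congr 1
  ext A
  exact ⟨fun ⟨k, hk, hA⟩ => ⟨k, h.symm.trans hk, hA⟩, fun ⟨k, hk, hA⟩ => ⟨k, h.trans hk, hA⟩⟩

end Cohomologous

/-- `z` is cohomologous to `exp (i ⟨t, f⟩)` as a function with values in the circle. -/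
def IsCircleCohomologous (T : X → X) (ν : Measure X) (f : X → E) (t : E) (z : Circle) : Prop :=
  ∃ u : X → Circle, Measurable u ∧ ∀ᵐ x ∂ν, Circle.exp (inner ℝ t (f x)) * u x = z * u (T x)

namespace IsCircleCohomologous

omit [FiniteDimensional ℝ E] [MeasurableSpace E] [BorelSpace E] in
theorem zero : IsCircleCohomologous T ν f 0 1 :=
  ⟨fun _ => 1, measurable_const, by simp⟩

omit [FiniteDimensional ℝ E] [MeasurableSpace E] [BorelSpace E] in
theorem add {s t : E} {z w : Circle} (hs : IsCircleCohomologous T ν f s z)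
    (ht : IsCircleCohomologous T ν f t w) : IsCircleCohomologous T ν f (s + t) (z * w) := by
  obtain ⟨u, hu, h⟩ := hs
  obtain ⟨v, hv, h'⟩ := ht
  refine ⟨fun x => u x * v x, hu.mul hv, ?_⟩
  filter_upwards [h, h'] with x hx hx'
  rw [inner_add_left, Circle.exp_add, mul_mul_mul_comm, hx, hx', mul_mul_mul_comm]

omit [FiniteDimensional ℝ E] [MeasurableSpace E] [BorelSpace E] in
theorem neg {s : E} {z : Circle} (hs : IsCircleCohomologous T ν f s z) :
    IsCircleCohomologous T ν f (-s) z⁻¹ := by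
  obtain ⟨u, hu, h⟩ := hs
  refine ⟨fun x => (u x)⁻¹, hu.inv, ?_⟩
  filter_upwards [h] with x hx
  rw [inner_neg_left, Circle.exp_neg, ← mul_inv, hx, mul_inv]

end IsCircleCohomologous

/-- The graph of the cohomology relation on the circle, as a subgroup. -/
def circleCohomologyGraph (T : X → X) (ν : Measure X) (f : X → E) :
    AddSubgroup (E × Additive Circle) where
  carrier := {p | IsCircleCohomologous T ν f p.1 p.2.toMul}
  add_mem' := fun ha hb => ha.add hb
  zero_mem' := IsCircleCohomologous.zero
  neg_mem' := fun ha => ha.neg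

/-- The set of the frequencies `t` for which `exp (i ⟨t, f⟩)` is cohomologous to a constant. -/
def circleCohomologyGroup (T : X → X) (ν : Measure X) (f : X → E) : AddSubgroup E :=
  (circleCohomologyGraph T ν f).map (AddMonoidHom.fst E (Additive Circle))

omit [FiniteDimensional ℝ E] [MeasurableSpace E] [BorelSpace E] in
theorem mem_circleCohomologyGroup {t : E} :
    t ∈ circleCohomologyGroup T ν f ↔ ∃ z, IsCircleCohomologous T ν f t z := by
  constructor
  · rintro ⟨⟨t, z⟩, hz, rfl⟩
    exact ⟨z.toMul, hz⟩
  · rintro ⟨z, hz⟩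
    exact ⟨(t, Additive.ofMul z), hz, rfl⟩

-- The circle is compact, so projecting the closed relation along it gives a closed set.
omit [FiniteDimensional ℝ E] [MeasurableSpace E] [BorelSpace E] in
theorem isClosed_circleCohomologyGroup
    (hcl : IsClosed {p : E × Circle | IsCircleCohomologous T ν f p.1 p.2}) :
    IsClosed (circleCohomologyGroup T ν f : Set E) := by
  have := isClosedMap_fst_of_compactSpace (X := E) (Y := Circle) _ hcl
  convert this using 1
  ext t
  simp only [SetLike.mem_coe, mem_circleCohomologyGroup, mem_image, Prod.exists, exists_and_right,
    exists_eq_right]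
  rfl

omit [MeasurableSpace E] [BorelSpace E] in
theorem exists_character_circleCohomology
    (hcl : IsClosed {p : E × Circle | IsCircleCohomologous T ν f p.1 p.2})
    (huniq : ∀ z, IsCircleCohomologous T ν f 0 z → z = 1) :
    ∃ r : E, ∀ t z, IsCircleCohomologous T ν f t z → z = Circle.exp (inner ℝ t r) := by
  refine exists_character_of_isClosed_graph (circleCohomologyGraph T ν f) ?_ huniq
  exact hcl.preimage (continuous_fst.prodMk (continuous_toMul.comp continuous_snd))

/-- The values of a function cohomologous to `f` are supported by no set smaller than `G^⊥ + r`. -/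
theorem add_mem_minimalSupport [NeZero ν] {r : E}
    (hr : ∀ t z, IsCircleCohomologous T ν f t z → z = Circle.exp (inner ℝ t r))
    (hfg : Cohomologous T ν f g) {v : E} (hv : v ∈ charAnnihilator (circleCohomologyGroup T ν f)) :
    v + r ∈ minimalSupport ν g := by
  obtain ⟨⟨V, c, hV, hS⟩, hg⟩ := (isLeast_minimalSupport ν g).1
  obtain ⟨h, hh, hfg⟩ := hfg
  -- For `t` annihilating `V`, `exp (i⟨t, g⟩)` is the constant `exp (i⟨t, c⟩)`, and the transfer
  -- function `h` exponentiates. Thus `V^⊥ ⊆ G`, and comparison with `r` shows that `V^⊥` also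
  -- annihilates `r - c`; double annihilators bring both facts back to `V`.
  have key : ∀ t ∈ charAnnihilator V, IsCircleCohomologous T ν f t (Circle.exp (inner ℝ t c)) := by
    intro t ht
    refine ⟨fun x => Circle.exp (-inner ℝ t (h x)), ?_, ?_⟩
    · exact (Circle.exp.continuous.comp
        (continuous_const.inner continuous_id).neg).measurable.comp hh
    · filter_upwards [hfg, hg] with x hx hgx
      rw [hS] at hgx
      have h1 := ht _ hgx
      rw [real_inner_comm] at h1
      have h2 : inner ℝ t (f x) + -inner ℝ t (h x) =
          inner ℝ t (g x - c) + (inner ℝ t c + -inner ℝ t (h (T x))) := by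
        have h3 := congrArg (fun y => (inner ℝ t y : ℝ)) hx
        simp only [inner_sub_right] at h3 ⊢
        linarith
      rw [← Circle.exp_add, ← Circle.exp_add, h2, Circle.exp_add, h1, one_mul]
  have h1 : v ∈ V := by
    rw [← charAnnihilator_charAnnihilator hV]
    exact fun t ht => hv t (mem_circleCohomologyGroup.2 ⟨_, key t ht⟩)
  have h2 : r - c ∈ V := by
    rw [← charAnnihilator_charAnnihilator hV]
    intro t ht
    rw [inner_sub_right, Circle.exp_sub, ← hr t _ (key t ht), div_self']
  rw [hS]
  have : v + r - c = v + (r - c) := by abel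
  simpa only [mem_ofPred_eq, this] using V.add_mem h1 h2

/-- If the cohomology relation is closed and every one-parameter group of coboundaries comes from a
real coboundary, then some function cohomologous to `f` has its values in `G^⊥ + r`. -/
theorem exists_cohomologous_forall_mem (hT : Measurable T) (hf : Measurable f)
    (hcl : IsClosed {p : E × Circle | IsCircleCohomologous T ν f p.1 p.2}) {r : E}
    (hr : ∀ t z, IsCircleCohomologous T ν f t z → z = Circle.exp (inner ℝ t r))
    (hline : ∀ v, (∀ s : ℝ, IsCircleCohomologous T ν f (s • v) (Circle.exp (inner ℝ (s • v) r))) →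
      ∃ h : X → ℝ, Measurable h ∧ ∀ᵐ x ∂ν, inner ℝ v (f x - r) = h x - h (T x)) :
    ∃ g, Measurable g ∧ Cohomologous T ν f g ∧
      ∀ᵐ x ∂ν, g x - r ∈ charAnnihilator (circleCohomologyGroup T ν f) := by
  obtain ⟨α, κ, γ, _, _, _, b, hb⟩ :=
    exists_basis_of_isClosed (isClosed_circleCohomologyGroup hcl)
  classical
  have hG : ∀ t ∈ circleCohomologyGroup T ν f,
      IsCircleCohomologous T ν f t (Circle.exp (inner ℝ t r)) := by
    intro t ht
    obtain ⟨z, hz⟩ := mem_circleCohomologyGroup.1 ht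
    exact hr t z hz ▸ hz
  -- The transfer function is built coordinate by coordinate. The coefficient `a` ranges over the
  -- values that coordinate `i` takes on `G`: all reals, the integers, or only zero.
  have hcoord : ∀ i, ∃ h : X → ℝ, Measurable h ∧ ∀ᵐ x ∂ν, ∀ a : ℝ,
      (i ∈ range (Sum.inr : γ → (α ⊕ κ) ⊕ γ) → a = 0) →
      (i ∈ range (fun k : κ => (.inl (.inr k) : (α ⊕ κ) ⊕ γ)) → ∃ n : ℤ, a = n) →
      Circle.exp (a * (inner ℝ (b i) (f x - r) - (h x - h (T x)))) = 1 := by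
    rintro ((i | i) | i)
    · obtain ⟨h, hh, hx⟩ := hline (b (.inl (.inl i))) fun s => hG _ <| by
        rw [hb]
        refine ⟨fun k => ⟨0, ?_⟩, fun k => ?_⟩ <;> simp
      refine ⟨h, hh, ?_⟩
      filter_upwards [hx] with x hx a _ _
      rw [hx, sub_self, mul_zero, Circle.exp_zero]
    · obtain ⟨u, hu, hx⟩ := hG (b (.inl (.inr i))) <| by
        rw [hb]
        refine ⟨fun k => ⟨if i = k then 1 else 0, ?_⟩, fun k => ?_⟩ <;>
          simp [Finsupp.single_apply]
      -- The argument is a real logarithm of `u` only modulo `2π`; this suffices because the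
      -- coefficient is an integer.
      refine ⟨fun x => -Complex.arg (u x), ?_, ?_⟩
      · exact (Complex.measurable_arg.comp
          (measurable_circle_coe.comp hu)).neg
      · filter_upwards [hx] with x hx a _ ha
        obtain ⟨n, rfl⟩ := ha ⟨i, rfl⟩
        have h1 : Circle.exp (inner ℝ (b (.inl (.inr i))) (f x - r) -
            (-Complex.arg (u x) - -Complex.arg (u (T x)))) = 1 := by
          rw [inner_sub_right, Circle.exp_sub, Circle.exp_sub, Circle.exp_sub, Circle.exp_neg,
            Circle.exp_neg, Circle.exp_arg, Circle.exp_arg, eq_mul_inv_of_mul_eq hx]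
          rw [mul_assoc, mul_div_cancel_left, inv_div_inv, div_eq_mul_inv, div_eq_mul_inv,
            mul_inv_rev, inv_inv, mul_mul_mul_comm, mul_comm (u x)⁻¹, ← mul_assoc]
          simp
        obtain ⟨m, hm⟩ := circle_exp_eq_one_iff.1 h1
        rw [hm, circle_exp_eq_one_iff]
        exact ⟨n * m, by push_cast; ring⟩
    · refine ⟨fun _ => 0, measurable_const, ?_⟩
      refine Eventually.of_forall fun x a ha _ => ?_
      rw [ha ⟨i, rfl⟩, zero_mul, Circle.exp_zero]
  choose h hh hx using hcoord
  -- The dual basis, so that `H` has the prescribed inner products `h i` with the basis vectors `b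
  -- i`.
  let δ : (α ⊕ κ) ⊕ γ → E := fun i =>
    (InnerProductSpace.toDual ℝ E).symm (LinearMap.toContinuousLinearMap (b.coord i))
  have hδ : ∀ i j, inner ℝ (b j) (δ i) = if j = i then (1 : ℝ) else 0 := fun i j => by
    rw [real_inner_comm]
    simp [δ, Finsupp.single_apply]
  let H : X → E := fun x => ∑ i, h i x • δ i
  have hH : Measurable H := Finset.measurable_sum _ fun i _ => (hh i).smul_const _
  have hbH : ∀ i x, inner ℝ (b i) (H x) = h i x := fun i x => by
    simp only [H, inner_sum, inner_smul_right, hδ, mul_ite, mul_one, mul_zero]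
    rw [Finset.sum_ite_eq Finset.univ i]; simp
  refine ⟨fun x => f x - (H x - H (T x)), hf.sub (hH.sub (hH.comp hT)), ⟨H, hH, ?_⟩, ?_⟩
  · exact Eventually.of_forall fun x => sub_sub_cancel _ _
  · filter_upwards [ae_all_iff.2 hx] with x hx t ht
    have h1 : (inner ℝ t (f x - (H x - H (T x)) - r) : ℝ) =
        ∑ i, b.repr t i * (inner ℝ (b i) (f x - r) - (h i x - h i (T x))) := by
      conv_lhs => rw [← b.sum_repr t]
      rw [sum_inner]
      refine Finset.sum_congr rfl fun i _ => ?_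
      rw [real_inner_smul_left]
      congr 1
      rw [sub_right_comm, inner_sub_right, inner_sub_right _ (H x), hbH, hbH]
    have h2 : ∀ s : Finset ((α ⊕ κ) ⊕ γ), Circle.exp (∑ i ∈ s,
        b.repr t i * (inner ℝ (b i) (f x - r) - (h i x - h i (T x)))) = 1 := by
      intro s
      induction s using Finset.induction_on with
      | empty => simp
      | insert i s hi ih =>
        rw [Finset.sum_insert hi, Circle.exp_add, ih, mul_one]
        refine hx i _ ?_ ?_
        · rintro ⟨c, rfl⟩
          exact ((hb t).1 ht).2 c
        · rintro ⟨k, rfl⟩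
          exact ((hb t).1 ht).1 k
    rw [h1, h2]

omit [FiniteDimensional ℝ E] [InnerProductSpace ℝ E] [BorelSpace E] [MeasurableSpace E] in
theorem ae_mem_minimalSupport [SecondCountableTopology E] [NeZero ν] (g : X → E) :
    ∀ᵐ x ∂ν, g x ∈ minimalSupport ν g :=
  (isLeast_minimalSupport ν g).1.2

-- A minimal function stays minimal when a coboundary of a function with values in `A` is
-- subtracted. If `A` has a nonzero element `v`, uniqueness applied to `v 1_B` makes every
-- measurable set `B` invariant, hence trivial by ergodicity, and then every measurable function is
-- constant. If `A` is trivial, the support is one point. Conversely, a constant has a support of at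
-- most one point, which every other minimal function shares.
omit [InnerProductSpace ℝ E] [FiniteDimensional ℝ E] in
theorem minimalFunction_unique_iff [IsProbabilityMeasure ν] (hT : Ergodic T ν)
    (hf : Measurable f) {A : AddSubgroup E} {r : E} (hA : IsClosed (A : Set E))
    [SecondCountableTopology E]
    (hM : minimalLattice T ν f = {x | ∃ v ∈ A, x = v + r}) {g : X → E}
    (hfg : Cohomologous T ν f g) (hg : IsMinimalFunction T ν g) :
    (∀ g', Cohomologous T ν f g' → IsMinimalFunction T ν g' → g' =ᵐ[ν] g) ↔
      ∃ c : E, g =ᵐ[ν] fun _ => c := by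
  have hSg : minimalSupport ν g = {x | ∃ v ∈ A, x = v + r} := by
    rw [hg, ← hfg.minimalLattice_eq, hM]
  constructor
  · intro huniq
    by_cases hA0 : ∀ v ∈ A, v = 0
    · refine ⟨r, ?_⟩
      filter_upwards [ae_mem_minimalSupport (ν := ν) g] with x hx
      rw [hSg] at hx
      obtain ⟨v, hv, hx⟩ := hx
      rw [hx, hA0 v hv, zero_add]
    push Not at hA0
    obtain ⟨v, hv, hv0⟩ := hA0
    have hset : ∀ B, MeasurableSet B → (∀ᵐ x ∂ν, x ∈ B) ∨ ∀ᵐ x ∂ν, x ∉ B := by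
      intro B hB
      let k : X → E := B.indicator fun _ => v
      have hk : Measurable k := measurable_const.indicator hB
      have hkA : ∀ x, k x ∈ A := fun x => by
        by_cases hx : x ∈ B <;> simp [k, hx, hv, A.zero_mem]
      let g' : X → E := fun x => g x - (k x - k (T x))
      have hgg' : Cohomologous T ν g g' := ⟨k, hk, Eventually.of_forall fun x => sub_sub_cancel _ _⟩
      have hfg' := hfg.trans hgg'
      have hmin : IsMinimalFunction T ν g' := by
        rw [IsMinimalFunction, ← hfg'.minimalLattice_eq]
        refine Subset.antisymm ?_ ?_
        · rw [hM]
          refine sInter_subset_of_mem ⟨⟨A, r, hA, ?_⟩, ?_⟩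
          · ext x
            exact ⟨fun ⟨v, hv, hx⟩ => by simpa [hx] using hv, fun hx => ⟨x - r, hx, by abel⟩⟩
          · filter_upwards [ae_mem_minimalSupport (ν := ν) g] with x hx
            rw [hSg] at hx
            obtain ⟨w, hw, hx⟩ := hx
            refine ⟨w - (k x - k (T x)), A.sub_mem hw (A.sub_mem (hkA _) (hkA _)), ?_⟩
            simp only [g', hx]; abel
        · exact sInter_subset_of_mem ⟨g', hfg', rfl⟩
      have hae := huniq g' hfg' hmin
      have hinv : T ⁻¹' B =ᵐ[ν] B := by
        filter_upwards [hae] with x hx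
        have h1 : k x = k (T x) := by
          have : g x - (k x - k (T x)) = g x := hx
          rw [sub_eq_self, sub_eq_zero] at this
          exact this
        have h2 : (T x ∈ B) = (x ∈ B) := by
          by_cases ha : x ∈ B <;> by_cases hb : T x ∈ B <;>
            simp [k, ha, hb, hv0, hv0.symm] at h1 ⊢
        exact h2
      rcases hT.quasiErgodic.ae_empty_or_univ₀ hB.nullMeasurableSet hinv with h | h
      · right
        filter_upwards [h] with x hx hxB
        have : (x ∈ B) = False := hx
        exact this ▸ hxB
      · left
        filter_upwards [h] with x hx
        have : (x ∈ B) = True := hx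
        exact this ▸ trivial
    obtain ⟨k, hk, hkx⟩ := hfg
    -- `g` itself need not be measurable; this is a measurable function equal to it almost
    -- everywhere.
    have hg1 : Measurable fun x => f x - (k x - k (T x)) := hf.sub (hk.sub (hk.comp hT.measurable))
    obtain ⟨c, hc⟩ := exists_eventuallyEq_const_of_forall_separating (l := ae ν)
      (f := fun x => f x - (k x - k (T x))) MeasurableSet
      (fun U hU => hset _ (hg1 hU))
    refine ⟨c, ?_⟩
    filter_upwards [hc, hkx] with x hx hx'
    rw [← show f x - (k x - k (T x)) = c from hx, ← hx', sub_sub_cancel]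
  · rintro ⟨c, hc⟩ g' hfg' hg'
    have h1 : minimalSupport ν g ⊆ {c} := by
      refine sInter_subset_of_mem ⟨⟨⊥, c, by simp, ?_⟩, ?_⟩
      · ext x; simp [sub_eq_zero]
      · filter_upwards [hc] with x hx
        simp [hx]
    have h2 : minimalSupport ν g' = minimalSupport ν g := by
      rw [hg', hg, ← hfg'.minimalLattice_eq, ← hfg.minimalLattice_eq]
    filter_upwards [ae_mem_minimalSupport (ν := ν) g', hc] with x hx hcx
    rw [h2] at hx
    rw [hcx, h1 hx]

/-- The minimal lattice of `f`, when circle-valued cohomology has the stated regularity. -/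
theorem minimalLattice_of_circleCohomology [IsProbabilityMeasure ν] (hT : Ergodic T ν)
    (hf : Measurable f)
    (hcl : IsClosed {p : E × Circle | IsCircleCohomologous T ν f p.1 p.2}) {r : E}
    (hr : ∀ t z, IsCircleCohomologous T ν f t z → z = Circle.exp (inner ℝ t r))
    (hline : ∀ v, (∀ s : ℝ, IsCircleCohomologous T ν f (s • v) (Circle.exp (inner ℝ (s • v) r))) →
      ∃ h : X → ℝ, Measurable h ∧ ∀ᵐ x ∂ν, inner ℝ v (f x - r) = h x - h (T x)) :
    minimalLattice T ν f =
        {x | ∃ v ∈ dualOfQuotient (circleCohomologyGroup T ν f), x = v + r} ∧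
      (∃ g, Measurable g ∧ Cohomologous T ν f g ∧ IsMinimalFunction T ν g) ∧
      ∀ g, Cohomologous T ν f g → IsMinimalFunction T ν g →
        ((∀ g', Cohomologous T ν f g' → IsMinimalFunction T ν g' → g' =ᵐ[ν] g) ↔
          ∃ c : E, g =ᵐ[ν] fun _ => c) := by
  obtain ⟨g, hg, hfg, hgr⟩ := exists_cohomologous_forall_mem hT.measurable hf hcl hr hline
  set A := charAnnihilator (circleCohomologyGroup T ν f) with hA
  -- Every support in the class contains `A + r`, and the constructed `g` has its support inside `A
  -- + r`; both inclusions are therefore equalities for `g`.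
  have hlow : {x | ∃ v ∈ A, x = v + r} ⊆ minimalLattice T ν f := by
    rintro _ ⟨v, hv, rfl⟩ _ ⟨g', hg', rfl⟩
    exact add_mem_minimalSupport hr hg' hv
  have hup : minimalSupport ν g ⊆ {x | ∃ v ∈ A, x = v + r} := by
    refine sInter_subset_of_mem ⟨⟨A, r, isClosed_charAnnihilator _, ?_⟩, ?_⟩
    · ext x
      exact ⟨fun ⟨v, hv, hx⟩ => by simpa [hx] using hv, fun hx => ⟨x - r, hx, by abel⟩⟩
    · filter_upwards [hgr] with x hx using ⟨g x - r, hx, by abel⟩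
  have hMg : minimalLattice T ν f ⊆ minimalSupport ν g := sInter_subset_of_mem ⟨g, hfg, rfl⟩
  have hM : minimalLattice T ν f = {x | ∃ v ∈ A, x = v + r} :=
    Subset.antisymm (hMg.trans hup) hlow
  refine ⟨?_, ⟨g, hg, hfg, ?_⟩, fun g' hfg' hg' =>
    minimalFunction_unique_iff hT hf (isClosed_charAnnihilator _) hM hfg' hg'⟩
  · rw [hM, ← coe_charAnnihilator_eq_dualOfQuotient]
    rfl
  · rw [IsMinimalFunction, ← hfg.minimalLattice_eq]
    exact Subset.antisymm (hup.trans hlow) hMg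

end CohomologyClasses
end

/-! ### Combinatorics of the tower, separation times, measurability -/

noncomputable section

namespace TowerData

variable {Λ ι : Type*} {D : TowerData Λ ι}

variable (D) in
/-- The point of the base of the tower over a point of `Λ`. -/
def bottom (x : Λ) : D.Tower := ⟨(x, 0), D.R_pos _⟩

@[simp] theorem level_bottom (x : Λ) : level (D.bottom x) = 0 := rfl

theorem Tower.ext' {p q : D.Tower} (h : base p = base q) (h' : level p = level q) : p = q :=
  Subtype.ext (Prod.ext h h')

theorem level_lt (p : D.Tower) : level p < D.R (D.cell (base p)) := p.2

theorem F_of_lt {p : D.Tower} (h : level p + 1 < D.R (D.cell (base p))) :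
    D.F p = ⟨(base p, level p + 1), h⟩ := dif_pos h

theorem F_of_eq {p : D.Tower} (h : level p + 1 = D.R (D.cell (base p))) :
    D.F p = D.bottom (D.ret (base p)) := dif_neg h.not_lt

theorem lt_or_eq (p : D.Tower) :
    level p + 1 < D.R (D.cell (base p)) ∨ level p + 1 = D.R (D.cell (base p)) :=
  (Nat.succ_le_of_lt p.2).lt_or_eq

theorem iterate_F_bottom {x : Λ} {l : ℕ} (h : l < D.R (D.cell x)) :
    D.F^[l] (D.bottom x) = ⟨(x, l), h⟩ := by
  induction l with
  | zero => rfl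
  | succ l ih =>
    rw [Function.iterate_succ_apply', ih (Nat.lt_of_succ_lt h)]
    exact F_of_lt (p := ⟨(x, l), Nat.lt_of_succ_lt h⟩) h

theorem iterate_F_bottom_base (p : D.Tower) : D.F^[level p] (D.bottom (base p)) = p :=
  iterate_F_bottom p.2

theorem iterate_R_F_bottom (x : Λ) :
    D.F^[D.R (D.cell x)] (D.bottom x) = D.bottom (D.ret x) := by
  obtain ⟨l, hl⟩ := Nat.exists_eq_succ_of_ne_zero (D.R_pos (D.cell x)).ne'
  rw [hl, Function.iterate_succ_apply', iterate_F_bottom (hl ▸ Nat.lt_succ_self l)]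
  exact F_of_eq hl.symm

theorem sameElement_iff {p q : D.Tower} : D.SameElement p q ↔ level p = level q ∧
    D.label (level p) (D.cell (base p)) = D.label (level p) (D.cell (base q)) := by
  constructor
  · rintro ⟨l, j, ⟨rfl, rfl⟩, h, h'⟩
    exact ⟨h.symm, h'.symm⟩
  · rintro ⟨h, h'⟩
    exact ⟨level p, _, ⟨rfl, rfl⟩, h.symm, h'.symm⟩

variable (D) in
/-- The orbits of `p` and `q` lie in the same elements of the partition at all times before `k`. -/
def AgreeBefore (k : ℕ) (p q : D.Tower) : Prop :=
  ∀ j < k, D.SameElement (D.F^[j] p) (D.F^[j] q)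

theorem AgreeBefore.zero (p q : D.Tower) : D.AgreeBefore 0 p q := fun _ h => absurd h (by simp)

theorem AgreeBefore.iterate {k j : ℕ} {p q : D.Tower} (h : D.AgreeBefore k p q) :
    D.AgreeBefore (k - j) (D.F^[j] p) (D.F^[j] q) := fun i hi => by
  rw [← Function.iterate_add_apply, ← Function.iterate_add_apply]
  exact h _ (by omega)

theorem AgreeBefore.add {k l : ℕ} {p q : D.Tower} (h : D.AgreeBefore k p q)
    (h' : D.AgreeBefore l (D.F^[k] p) (D.F^[k] q)) : D.AgreeBefore (k + l) p q := fun i hi => by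
  by_cases hik : i < k
  · exact h i hik
  · have := h' (i - k) (by omega)
    rwa [← Function.iterate_add_apply, ← Function.iterate_add_apply, Nat.sub_add_cancel
      (not_lt.1 hik)] at this

theorem agreeBefore_bottom {x y : Λ} (h : D.cell x = D.cell y) :
    D.AgreeBefore (D.R (D.cell x)) (D.bottom x) (D.bottom y) := fun j hj => by
  rw [iterate_F_bottom hj, iterate_F_bottom (h ▸ hj), sameElement_iff]
  refine ⟨rfl, ?_⟩
  change D.label j (D.cell x) = D.label j (D.cell y)
  rw [h]

theorem natCast_le_sep {n : ℕ} {p q : D.Tower}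
    (h : ∀ i ≤ n, D.SameElement (D.F^[i] p) (D.F^[i] q)) : (n : ℕ∞) ≤ D.sep p q :=
  le_iSup₂ (f := fun (n : ℕ) (_ : ∀ i ≤ n, D.SameElement (D.F^[i] p) (D.F^[i] q)) => (n : ℕ∞)) n h

theorem sameElement_of_lt_sep {i : ℕ} {p q : D.Tower} (h : (i : ℕ∞) < D.sep p q) :
    D.SameElement (D.F^[i] p) (D.F^[i] q) := by
  simp only [sep, lt_iSup_iff] at h
  obtain ⟨n, hn, hi⟩ := h
  exact hn i (by exact_mod_cast hi.le)

theorem sepDist_nonneg {β : ℝ} (hβ : 0 ≤ β) (p q : D.Tower) : 0 ≤ D.sepDist β p q := by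
  unfold sepDist; split_ifs <;> positivity

theorem sepDist_le_one {β : ℝ} (hβ : 0 ≤ β) (hβ1 : β ≤ 1) (p q : D.Tower) :
    D.sepDist β p q ≤ 1 := by
  unfold sepDist; split_ifs
  · exact zero_le_one
  · exact pow_le_one₀ hβ hβ1

theorem sepDist_le_pow {β : ℝ} (hβ : 0 ≤ β) (hβ1 : β ≤ 1) {n : ℕ} {p q : D.Tower}
    (h : (n : ℕ∞) ≤ D.sep p q) : D.sepDist β p q ≤ β ^ n := by
  unfold sepDist; split_ifs with htop
  · positivity
  · refine pow_le_pow_of_le_one hβ hβ1 ?_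
    rw [← ENat.natCast_toNat htop] at h
    exact_mod_cast h

/-- Points that agree before time `k` are closer than their images by a factor `β ^ (k - 1)`. -/
theorem AgreeBefore.sepDist_le {β : ℝ} (hβ : 0 < β) (hβ1 : β ≤ 1) {k : ℕ} {p q : D.Tower}
    (h : D.AgreeBefore k p q) :
    D.sepDist β p q ≤ β ^ k / β * D.sepDist β (D.F^[k] p) (D.F^[k] q) := by
  -- The inequality is strict because separation time `0` does not tell whether the images share an
  -- element or not. One unit is lost, which is the reason for the division by `β`.
  have key : ∀ m : ℕ, (m : ℕ∞) < k + D.sep (D.F^[k] p) (D.F^[k] q) → (m : ℕ∞) ≤ D.sep p q := by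
    intro m hm
    refine natCast_le_sep fun i hi => ?_
    by_cases hik : i < k
    · exact h i hik
    · have : D.SameElement (D.F^[i - k] (D.F^[k] p)) (D.F^[i - k] (D.F^[k] q)) := by
        refine sameElement_of_lt_sep ?_
        have h1 : (i : ℕ∞) = k + (i - k : ℕ) := by
          rw [← Nat.cast_add]; congr 1; omega
        have h2 : (k : ℕ∞) + (i - k : ℕ) < k + D.sep (D.F^[k] p) (D.F^[k] q) := by
          rw [← h1]; exact lt_of_le_of_lt (by exact_mod_cast hi) hm
        exact lt_of_add_lt_add_left h2
      rwa [← Function.iterate_add_apply, ← Function.iterate_add_apply, Nat.sub_add_cancel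
        (not_lt.1 hik)] at this
  by_cases htop : D.sep (D.F^[k] p) (D.F^[k] q) = ⊤
  · have : D.sep p q = ⊤ := by
      rw [ENat.eq_top_iff_forall_ge]
      intro m
      exact key m (by rw [htop]; simp)
    simp [sepDist, this, htop]
  · obtain ⟨s, hs⟩ := ENat.ne_top_iff_exists.1 htop
    have h2 : D.sepDist β (D.F^[k] p) (D.F^[k] q) = β ^ s := by
      simp [sepDist, ← hs]
    rw [h2, div_mul_eq_mul_div, ← pow_add, le_div_iff₀ hβ]
    rcases Nat.eq_zero_or_pos (k + s) with h0 | h0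
    · rw [h0, pow_zero]
      exact mul_le_one₀ (sepDist_le_one hβ.le hβ1 p q) hβ.le hβ1
    · obtain ⟨m, hm⟩ := Nat.exists_eq_succ_of_ne_zero h0.ne'
      rw [hm, pow_succ]
      refine mul_le_mul_of_nonneg_right (sepDist_le_pow hβ.le hβ1 (key m ?_)) hβ.le
      rw [← hs, ← Nat.cast_add, hm]
      exact_mod_cast Nat.lt_succ_self m

/-- At time `j` the orbits still agree for `k - j` steps, so the terms are dominated by a geometric
series read backwards from time `k`. This bounds differences of Birkhoff sums of Lipschitz functions
uniformly in `k`. -/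
theorem AgreeBefore.sum_sepDist_le {β : ℝ} (hβ : 0 < β) (hβ1 : β < 1) {k : ℕ} {p q : D.Tower}
    (h : D.AgreeBefore k p q) :
    ∑ j ∈ Finset.range k, D.sepDist β (D.F^[j] p) (D.F^[j] q) ≤
      (1 - β)⁻¹ * D.sepDist β (D.F^[k] p) (D.F^[k] q) := by
  have h1 : ∀ j ∈ Finset.range k, D.sepDist β (D.F^[j] p) (D.F^[j] q) ≤
      β ^ (k - 1 - j) * D.sepDist β (D.F^[k] p) (D.F^[k] q) := by
    intro j hj
    have hjk := Finset.mem_range.1 hj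
    have h2 := (h.iterate (j := j)).sepDist_le hβ hβ1.le
    rw [← Function.iterate_add_apply, ← Function.iterate_add_apply,
      Nat.sub_add_cancel hjk.le] at h2
    have h3 : β ^ (k - j) / β = β ^ (k - 1 - j) := by
      rw [div_eq_iff hβ.ne', ← pow_succ]; congr 1; omega
    rwa [h3] at h2
  refine (Finset.sum_le_sum h1).trans ?_
  rw [← Finset.sum_mul, Finset.sum_range_reflect (fun i => β ^ i) k]
  refine mul_le_mul_of_nonneg_right ?_ (sepDist_nonneg hβ.le _ _)
  rw [← tsum_geometric_of_lt_one hβ.le hβ1]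
  exact (summable_geometric_of_lt_one hβ.le hβ1).sum_le_tsum _ fun i _ => by positivity

end TowerData

namespace QuotientTower

open TowerData

variable {Λ ι : Type*} [MeasurableSpace Λ] (Y : QuotientTower Λ ι)

instance : IsFiniteMeasure Y.m := Y.m_finite

/-- Points of the same element of the partition agree on the way up. -/
theorem agreeBefore_of_sameElement {p q : Y.Tower} (h : Y.SameElement p q) :
    Y.AgreeBefore (level p) (Y.bottom (base p)) (Y.bottom (base q)) := by
  obtain ⟨h1, h2⟩ := sameElement_iff.1 h
  have hp := level_lt p
  have hq := level_lt q
  rw [← h1] at hq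
  have key : ∀ k ≤ level p,
      Y.label (level p - k) (Y.cell (base p)) = Y.label (level p - k) (Y.cell (base q)) := by
    intro k hk
    induction k with
    | zero => exact h2
    | succ k ih =>
      refine Y.label_refines _ _ _ (by omega) (by omega) ?_
      rw [show level p - (k + 1) + 1 = level p - k by omega]
      exact ih (by omega)
  intro j hj
  rw [iterate_F_bottom (hj.trans hp), iterate_F_bottom (hj.trans hq), sameElement_iff]
  refine ⟨rfl, ?_⟩
  have := key (level p - j) (by omega)
  rwa [show level p - (level p - j) = j by omega] at this

section Measurability

variable [Countable ι]

theorem measurableSet_cell_preimage (s : Set ι) : MeasurableSet (Y.cell ⁻¹' s) := by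
  rw [← biUnion_preimage_singleton]
  exact MeasurableSet.biUnion s.to_countable fun i _ => Y.measurableSet_cell i

omit [Countable ι] in
theorem measurable_level : Measurable (level : Y.Tower → ℕ) :=
  measurable_snd.comp measurable_subtype_coe

omit [Countable ι] in
theorem measurable_base : Measurable (base : Y.Tower → Λ) :=
  measurable_fst.comp measurable_subtype_coe

omit [Countable ι] in
theorem measurable_bottom : Measurable Y.bottom :=
  (measurable_id.prodMk measurable_const).subtype_mk

theorem measurableSet_setOf_cell (P : ℕ → ι → Prop) :
    MeasurableSet {z : Λ × ℕ | P z.2 (Y.cell z.1)} := by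
  have : {z : Λ × ℕ | P z.2 (Y.cell z.1)} =
      ⋃ l : ℕ, (Y.cell ⁻¹' {i | P l i}) ×ˢ {l} := by
    ext ⟨x, l⟩; simp
  rw [this]
  exact MeasurableSet.iUnion fun l => (Y.measurableSet_cell_preimage _).prod
    (measurableSet_singleton l)

theorem measurableSet_setOf_level_cell (P : ℕ → ι → Prop) :
    MeasurableSet {p : Y.Tower | P (level p) (Y.cell (base p))} :=
  measurable_subtype_coe (Y.measurableSet_setOf_cell P)

theorem measurable_level_cell {α : Type*} [MeasurableSpace α] (g : ℕ → ι → α) :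
    Measurable fun p : Y.Tower => g (level p) (Y.cell (base p)) := fun s _ =>
  Y.measurableSet_setOf_level_cell fun l i => g l i ∈ s

theorem measurable_F : Measurable Y.F := by
  have h : ∀ p, (Y.F p).1 = if level p + 1 < Y.R (Y.cell (base p)) then (base p, level p + 1)
      else (Y.ret (base p), 0) := fun p => by
    unfold TowerData.F; split_ifs <;> rfl
  refine Measurable.of_comap_le ?_
  rw [Subtype.instMeasurableSpace, MeasurableSpace.comap_comp]
  refine Measurable.comap_le (f := Subtype.val ∘ Y.F) ?_
  have h' : (Subtype.val ∘ Y.F) = fun p => if level p + 1 < Y.R (Y.cell (base p)) then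
      (base p, level p + 1) else (Y.ret (base p), 0) := funext h
  rw [h']
  refine Measurable.ite (Y.measurableSet_setOf_level_cell fun l i => l + 1 < Y.R i) ?_ ?_
  · exact Y.measurable_base.prodMk (Y.measurable_level.add_const 1)
  · exact (Y.measurable_ret.comp Y.measurable_base).prodMk measurable_const

/-- The itinerary up to time `n` takes countably many values on measurable sets. Replacing a point
by a chosen point with the same itinerary changes `f` by at most `|C| β ^ n`, so `f` is a limit of
measurable functions. -/
theorem BoundedLipschitz.measurable {E : Type*} [NormedAddCommGroup E] [MeasurableSpace E]
    [BorelSpace E] {f : Y.Tower → E} (hf : Y.BoundedLipschitz f) : Measurable f := by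
  obtain ⟨-, C, hC⟩ := hf
  let code : ∀ n : ℕ, Y.Tower → (Fin (n + 1) → ℕ × ι) := fun n p i =>
    (level (Y.F^[i] p), Y.cell (base (Y.F^[i] p)))
  have hcode : ∀ n (s : Set (Fin (n + 1) → ℕ × ι)), MeasurableSet (code n ⁻¹' s) := by
    intro n s
    let _ : MeasurableSpace ι := ⊤
    have : DiscreteMeasurableSpace ι := ⟨fun _ => trivial⟩
    have h : Measurable (code n) := measurable_pi_lambda _ fun i =>
      (Y.measurable_level_cell fun l i => (l, i)).comp (Y.measurable_F.iterate i)
    exact h (MeasurableSet.of_discrete)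
  refine measurable_of_tendsto_metrizable
    (f := fun n p => f (@Function.invFun _ _ ⟨p⟩ (code n) (code n p))) (fun n s _ => ?_) ?_
  · let g : (Fin (n + 1) → ℕ × ι) → Set E := fun c => {e | ∃ h : Nonempty Y.Tower,
      e = f (@Function.invFun _ _ h (code n) c)}
    have : (fun p => f (@Function.invFun _ _ ⟨p⟩ (code n) (code n p))) ⁻¹' s =
        code n ⁻¹' {c | ∃ e ∈ s, e ∈ g c} := by
      ext p
      constructor
      · intro h; exact ⟨_, h, ⟨p⟩, rfl⟩
      · rintro ⟨e, he, _, rfl⟩; exact he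
    rw [this]
    exact hcode n _
  · rw [tendsto_pi_nhds]
    intro p
    rw [tendsto_iff_norm_sub_tendsto_zero]
    have hlim : Tendsto (fun n : ℕ => |C| * Y.β ^ n) atTop (𝓝 0) := by
      simpa using (tendsto_pow_atTop_nhds_zero_of_lt_one Y.β_pos.le Y.β_lt_one).const_mul |C|
    refine squeeze_zero (fun n => norm_nonneg _) (fun n => ?_) hlim
    set q := @Function.invFun _ _ ⟨p⟩ (code n) (code n p) with hq
    have : Nonempty Y.Tower := ⟨p⟩
    have hqp : code n q = code n p := Function.invFun_eq ⟨p, rfl⟩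
    refine (hC q p).trans ?_
    refine mul_le_mul (le_abs_self C) ?_ (sepDist_nonneg Y.β_pos.le _ _) (abs_nonneg C)
    refine sepDist_le_pow Y.β_pos.le Y.β_lt_one.le (natCast_le_sep fun i hi => ?_)
    have h1 := congrFun hqp ⟨i, by omega⟩
    simp only [code, Prod.mk.injEq] at h1
    exact sameElement_iff.2 ⟨h1.1, by rw [h1.2]⟩

end Measurability

end QuotientTower
end

/-! ### Inverse branches, changes of variables and the Perron-Frobenius operator -/

noncomputable section

namespace QuotientTower

open TowerData

variable {Λ ι : Type*} [MeasurableSpace Λ] (Y : QuotientTower Λ ι)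

/-- A function on the tower, restricted to the level `l` and extended by zero. -/
def slice (g : Y.Tower → ℝ≥0∞) (l : ℕ) (x : Λ) : ℝ≥0∞ :=
  if h : l < Y.R (Y.cell x) then g ⟨(x, l), h⟩ else 0

theorem slice_of_lt (g : Y.Tower → ℝ≥0∞) {l : ℕ} {x : Λ} (h : l < Y.R (Y.cell x)) :
    Y.slice g l x = g ⟨(x, l), h⟩ := dif_pos h

theorem slice_of_not_lt (g : Y.Tower → ℝ≥0∞) {l : ℕ} {x : Λ} (h : ¬ l < Y.R (Y.cell x)) :
    Y.slice g l x = 0 := dif_neg h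

theorem slice_level_base (g : Y.Tower → ℝ≥0∞) (p : Y.Tower) :
    Y.slice g (level p) (base p) = g p := Y.slice_of_lt g (level_lt p)

theorem slice_zero (g : Y.Tower → ℝ≥0∞) (x : Λ) : Y.slice g 0 x = g (Y.bottom x) :=
  dif_pos (Y.R_pos _)

/-- The inverse branch of the return map with values in the piece `i`. -/
def branch (i : ι) (z : Λ) : Λ := ((Y.bijOn_ret i).surjOn (mem_univ z)).choose

@[simp] theorem cell_branch (i : ι) (z : Λ) : Y.cell (Y.branch i z) = i :=
  ((Y.bijOn_ret i).surjOn (mem_univ z)).choose_spec.1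

@[simp] theorem ret_branch (i : ι) (z : Λ) : Y.ret (Y.branch i z) = z :=
  ((Y.bijOn_ret i).surjOn (mem_univ z)).choose_spec.2

theorem branch_ret (x : Λ) : Y.branch (Y.cell x) (Y.ret x) = x :=
  (Y.bijOn_ret (Y.cell x)).injOn (Y.cell_branch _ _) rfl (Y.ret_branch _ _)

/-- The preimages of a point of the base are indexed by the pieces. -/
def preimageBottomEquiv (z : Λ) : ι ≃ {y : Y.Tower // Y.F y = Y.bottom z} where
  toFun i := ⟨⟨(Y.branch i z, Y.R i - 1), by
      rw [cell_branch]; exact Nat.sub_lt (Y.R_pos i) one_pos⟩, by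
    rw [F_of_eq]
    · change Y.bottom (Y.ret (Y.branch i z)) = _
      rw [ret_branch]
    · change Y.R i - 1 + 1 = Y.R (Y.cell (Y.branch i z))
      rw [cell_branch]; exact Nat.sub_add_cancel (Y.R_pos i)⟩
  invFun y := Y.cell (base y.1)
  left_inv i := by
    change Y.cell (Y.branch i z) = i
    simp
  right_inv y := by
    obtain ⟨y, hy⟩ := y
    have htop : level y + 1 = Y.R (Y.cell (base y)) := by
      rcases lt_or_eq y with h | h
      · rw [F_of_lt h] at hy
        have h' : level y + 1 = 0 := congrArg level hy
        exact absurd h' (Nat.succ_ne_zero _)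
      · exact h
    have hz : Y.ret (base y) = z := by
      rw [F_of_eq htop] at hy
      exact congrArg base hy
    refine Subtype.ext (Tower.ext' ?_ ?_)
    · change Y.branch (Y.cell (base y)) z = base y
      rw [← hz, branch_ret]
    · change Y.R (Y.cell (base y)) - 1 = level y
      omega

theorem F_eq_up_iff {x : Λ} {l : ℕ} (h : l + 1 < Y.R (Y.cell x)) (y : Y.Tower) :
    Y.F y = ⟨(x, l + 1), h⟩ ↔ y = ⟨(x, l), Nat.lt_of_succ_lt h⟩ := by
  constructor
  · intro hy
    rcases lt_or_eq y with h' | h'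
    · rw [F_of_lt h'] at hy
      have h1 : base y = x := congrArg base hy
      have h2 : level y + 1 = l + 1 := congrArg level hy
      exact Tower.ext' h1 (by exact Nat.succ_injective h2)
    · rw [F_of_eq h'] at hy
      have h2 : 0 = l + 1 := congrArg level hy
      omega
  · rintro rfl
    exact F_of_lt (p := ⟨(x, l), Nat.lt_of_succ_lt h⟩) h

theorem JF_pos (p : Y.Tower) : 0 < Y.JF p := by
  unfold JF; split_ifs
  · exact one_pos
  · exact Y.J_pos _

/-- The Perron-Frobenius operator on functions with values in `[0, ∞]`. -/
def ltransfer (g : Y.Tower → ℝ≥0∞) (x : Y.Tower) : ℝ≥0∞ :=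
  ∑' y : {y : Y.Tower // Y.F y = x}, g y / ENNReal.ofReal (Y.JF y)

theorem ltransfer_up (g : Y.Tower → ℝ≥0∞) {x : Λ} {l : ℕ} (h : l + 1 < Y.R (Y.cell x)) :
    Y.ltransfer g ⟨(x, l + 1), h⟩ = g ⟨(x, l), Nat.lt_of_succ_lt h⟩ := by
  have h2 : Y.JF ⟨(x, l), Nat.lt_of_succ_lt h⟩ = 1 := if_pos h
  rw [ltransfer, tsum_eq_single ⟨⟨(x, l), Nat.lt_of_succ_lt h⟩, (Y.F_eq_up_iff h _).2 rfl⟩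
    (fun b hb => absurd (Subtype.ext ((Y.F_eq_up_iff h _).1 b.2)) hb), h2]
  simp

theorem ltransfer_bottom (g : Y.Tower → ℝ≥0∞) (z : Λ) :
    Y.ltransfer g (Y.bottom z) = ∑' i, Y.slice g (Y.R i - 1) (Y.branch i z) /
      ENNReal.ofReal (Y.J (Y.branch i z)) := by
  rw [ltransfer, ← (Y.preimageBottomEquiv z).tsum_eq]
  refine tsum_congr fun i => ?_
  have h1 : Y.R i - 1 < Y.R (Y.cell (Y.branch i z)) := by
    rw [cell_branch]; exact Nat.sub_lt (Y.R_pos i) one_pos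
  have h2 : ((Y.preimageBottomEquiv z i).1 : Y.Tower) = ⟨(Y.branch i z, Y.R i - 1), h1⟩ := rfl
  have h3 : Y.JF ⟨(Y.branch i z, Y.R i - 1), h1⟩ = Y.J (Y.branch i z) := if_neg (by
    change ¬ (Y.R i - 1 + 1 < Y.R (Y.cell (Y.branch i z)))
    rw [cell_branch]; omega)
  rw [h2, h3, slice, dif_pos h1]

section

variable [Countable ι]

theorem measurableSet_tower : MeasurableSet {p : Λ × ℕ | p.2 < Y.R (Y.cell p.1)} :=
  Y.measurableSet_setOf_cell fun l i => l < Y.R i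

theorem measurable_slice {g : Y.Tower → ℝ≥0∞} (hg : Measurable g) (l : ℕ) :
    Measurable (Y.slice g l) := by
  refine Measurable.dite (s := {x | l < Y.R (Y.cell x)}) (f := fun x => g ⟨(x.1, l), x.2⟩)
    (g := fun _ => 0) ?_ measurable_const (Y.measurableSet_cell_preimage {i | l < Y.R i})
  exact hg.comp (((measurable_subtype_coe).prodMk measurable_const).subtype_mk)

theorem lintegral_mbar {g : Y.Tower → ℝ≥0∞} (hg : Measurable g) :
    ∫⁻ p, g p ∂Y.mbar = ∑' l, ∫⁻ x, Y.slice g l x ∂Y.m := by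
  classical
  let G : Λ × ℕ → ℝ≥0∞ := fun z => Y.slice g z.2 z.1
  have hG : Measurable G := measurable_from_prod_countable_left fun l => Y.measurable_slice hg l
  have h1 : ∀ p : Y.Tower, g p = G p := fun p => (Y.slice_level_base g p).symm
  simp_rw [h1, mbar]
  refine (lintegral_subtype_comap Y.measurableSet_tower G).trans ?_
  rw [← lintegral_indicator Y.measurableSet_tower]
  have h2 : indicator {p : Λ × ℕ | p.2 < Y.R (Y.cell p.1)} G = G := by
    rw [indicator_eq_self]
    intro z hz
    by_contra hcon
    exact hz (dif_neg hcon)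
  rw [h2, lintegral_prod_symm _ hG.aemeasurable, lintegral_count]

theorem mbar_apply {A : Set Y.Tower} (hA : MeasurableSet A) :
    Y.mbar A = ∑' l, Y.m {x | ∃ h : l < Y.R (Y.cell x), ⟨(x, l), h⟩ ∈ A} := by
  rw [← lintegral_indicator_one hA, Y.lintegral_mbar (measurable_one.indicator hA)]
  refine tsum_congr fun l => ?_
  have hslice : Y.slice (A.indicator 1) l =
      indicator {x | ∃ h : l < Y.R (Y.cell x), ⟨(x, l), h⟩ ∈ A} 1 := by
    ext x
    by_cases h : l < Y.R (Y.cell x)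
    · by_cases hx : (⟨(x, l), h⟩ : Y.Tower) ∈ A <;> simp [slice, h, hx, indicator]
    · simp [slice, h, indicator]
  have hm : MeasurableSet {x | ∃ h : l < Y.R (Y.cell x), ⟨(x, l), h⟩ ∈ A} := by
    have := Y.measurable_slice (measurable_one.indicator hA) l (measurableSet_singleton 1)
    rw [hslice] at this
    convert this using 1
    ext x
    rw [mem_preimage, mem_singleton_iff]
    exact ⟨fun h => indicator_of_mem h 1, fun h => by
      by_contra hcon
      rw [indicator_of_notMem hcon] at h
      exact zero_ne_one h⟩
  rw [hslice, lintegral_indicator_one hm]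

theorem isFiniteMeasure_mbar : IsFiniteMeasure Y.mbar := by
  refine ⟨?_⟩
  rw [Y.mbar_apply MeasurableSet.univ]
  have h1 : ∀ l, Y.m {x | ∃ h : l < Y.R (Y.cell x), (⟨(x, l), h⟩ : Y.Tower) ∈ univ} ≤
      ENNReal.ofReal (Y.C₀ * Y.θ₀ ^ l) := fun l =>
    (measure_mono (fun x hx => (Exists.choose hx).le)).trans (Y.tail l)
  refine (ENNReal.tsum_le_tsum h1).trans_lt ?_
  rw [← ENNReal.ofReal_tsum_of_nonneg
    (fun n => mul_nonneg Y.C₀_pos.le (pow_nonneg Y.θ₀_pos.le _))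
    ((summable_geometric_of_lt_one Y.θ₀_pos.le Y.θ₀_lt_one).mul_left _)]
  exact ENNReal.ofReal_lt_top

theorem quasiMeasurePreserving_base : Measure.QuasiMeasurePreserving base Y.mbar Y.m := by
  refine ⟨Y.measurable_base, Measure.AbsolutelyContinuous.mk fun s hs h => ?_⟩
  rw [Measure.map_apply Y.measurable_base hs, Y.mbar_apply (Y.measurable_base hs),
    ENNReal.tsum_eq_zero]
  exact fun l => measure_mono_null (fun x hx => Exists.choose_spec hx) h

theorem quasiMeasurePreserving_bottom : Measure.QuasiMeasurePreserving Y.bottom Y.m Y.mbar := by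
  refine ⟨Y.measurable_bottom, Measure.AbsolutelyContinuous.mk fun s hs h => ?_⟩
  rw [Measure.map_apply Y.measurable_bottom hs]
  rw [Y.mbar_apply hs, ENNReal.tsum_eq_zero] at h
  exact measure_mono_null
    (fun x hx => (show ∃ h : 0 < Y.R (Y.cell x), (⟨(x, 0), h⟩ : Y.Tower) ∈ s from ⟨Y.R_pos _, hx⟩))
    (h 0)

variable [StandardBorelSpace Λ]

-- Preimages under the branch are images under the return map, which is injective on a piece;
-- injective measurable images in standard Borel spaces are measurable (Lusin–Souslin).
omit [Countable ι] in
theorem measurable_branch (i : ι) : Measurable (Y.branch i) := by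
  intro s hs
  have : Y.branch i ⁻¹' s = Y.ret '' (s ∩ Y.cell ⁻¹' {i}) := by
    ext z
    constructor
    · intro hz
      exact ⟨Y.branch i z, ⟨hz, Y.cell_branch i z⟩, Y.ret_branch i z⟩
    · rintro ⟨x, ⟨hx, rfl⟩, rfl⟩
      rw [mem_preimage, branch_ret]; exact hx
  rw [this]
  exact (hs.inter (Y.measurableSet_cell i)).image_of_measurable_injOn Y.measurable_ret
    ((Y.bijOn_ret i).injOn.mono inter_subset_right)

-- The Jacobian hypothesis says that the return map carries `J m`, restricted to one piece, to `m`.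
omit [Countable ι] [StandardBorelSpace Λ] in
theorem lintegral_ret (i : ι) {h : Λ → ℝ≥0∞} (hh : Measurable h) :
    ∫⁻ x in Y.cell ⁻¹' {i}, h (Y.ret x) * ENNReal.ofReal (Y.J x) ∂Y.m = ∫⁻ z, h z ∂Y.m := by
  have hJ : Measurable fun x => ENNReal.ofReal (Y.J x) := Y.measurable_J.ennreal_ofReal
  have key : Measure.map Y.ret ((Y.m.restrict (Y.cell ⁻¹' {i})).withDensity
      fun x => ENNReal.ofReal (Y.J x)) = Y.m := by
    ext s hs
    rw [Measure.map_apply Y.measurable_ret hs, withDensity_apply _ (Y.measurable_ret hs),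
      Measure.restrict_restrict (Y.measurable_ret hs),
      ← Y.measure_image_ret i _ inter_subset_right
        ((Y.measurable_ret hs).inter (Y.measurableSet_cell i))]
    congr 1
    ext z
    constructor
    · rintro ⟨x, ⟨hx, -⟩, rfl⟩; exact hx
    · intro hz
      exact ⟨Y.branch i z, ⟨by simpa using hz, Y.cell_branch i z⟩, Y.ret_branch i z⟩
  conv_rhs => rw [← key]
  rw [lintegral_map hh Y.measurable_ret,
    lintegral_withDensity_eq_lintegral_mul _ hJ (g := fun x => h (Y.ret x))
      (hh.comp Y.measurable_ret)]
  refine lintegral_congr fun x => ?_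
  simp [mul_comm]

omit [Countable ι] in
/-- Change of variables for an inverse branch of the return map. -/
theorem lintegral_branch (i : ι) {g : Λ → ℝ≥0∞} (hg : Measurable g) :
    ∫⁻ z, g (Y.branch i z) / ENNReal.ofReal (Y.J (Y.branch i z)) ∂Y.m =
      ∫⁻ x in Y.cell ⁻¹' {i}, g x ∂Y.m := by
  have hb := Y.measurable_branch i
  rw [← Y.lintegral_ret i (h := fun z => g (Y.branch i z) / ENNReal.ofReal (Y.J (Y.branch i z)))
    ((hg.comp hb).div ((Y.measurable_J.comp hb).ennreal_ofReal))]
  refine setLIntegral_congr_fun (Y.measurableSet_cell i) fun x hx => ?_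
  have hx' : Y.cell x = i := hx
  rw [← hx', branch_ret, ENNReal.div_mul_cancel]
  · simpa using Y.J_pos x
  · exact ENNReal.ofReal_ne_top

theorem measurable_ltransfer {g : Y.Tower → ℝ≥0∞} (hg : Measurable g) :
    Measurable (Y.ltransfer g) := by
  have h1 : ∀ p : Y.Tower, Y.ltransfer g p = if level p = 0 then
      ∑' i, Y.slice g (Y.R i - 1) (Y.branch i (base p)) /
        ENNReal.ofReal (Y.J (Y.branch i (base p)))
      else Y.slice g (level p - 1) (base p) := by
    rintro ⟨⟨x, l⟩, h⟩
    cases l with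
    | zero => exact Y.ltransfer_bottom g x
    | succ l =>
      rw [if_neg (by simp [level]), Y.ltransfer_up g h]
      exact (Y.slice_of_lt g (Nat.lt_of_succ_lt h)).symm
  rw [funext h1]
  refine Measurable.ite (Y.measurable_level (measurableSet_singleton 0)) ?_ ?_
  · refine Measurable.tsum fun i => ?_
    have hb := (Y.measurable_branch i).comp Y.measurable_base
    exact ((Y.measurable_slice hg _).comp hb).div ((Y.measurable_J.comp hb).ennreal_ofReal)
  · have : Measurable fun z : Λ × ℕ => Y.slice g z.2 z.1 :=
      measurable_from_prod_countable_left fun l => Y.measurable_slice hg l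
    exact this.comp (Y.measurable_base.prodMk
      ((measurable_from_nat (f := fun l => l - 1)).comp Y.measurable_level))

/-- The Perron-Frobenius operator preserves the integral. -/
theorem lintegral_ltransfer {g : Y.Tower → ℝ≥0∞} (hg : Measurable g) :
    ∫⁻ x, Y.ltransfer g x ∂Y.mbar = ∫⁻ x, g x ∂Y.mbar := by
  rw [Y.lintegral_mbar (Y.measurable_ltransfer hg), Y.lintegral_mbar hg,
    tsum_eq_zero_add' ENNReal.summable]
  -- Level `l + 1` of the image only copies the points of level `l` that move up; the base collects
  -- the top points of all columns, and the change of variables on each piece accounts for them.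
  have hbot : ∫⁻ z, Y.slice (Y.ltransfer g) 0 z ∂Y.m =
      ∑' l, ∫⁻ x in {x | l + 1 = Y.R (Y.cell x)}, Y.slice g l x ∂Y.m := by
    simp_rw [slice_zero, ltransfer_bottom]
    rw [lintegral_tsum]
    · have h1 : ∀ i, ∫⁻ z, Y.slice g (Y.R i - 1) (Y.branch i z) /
          ENNReal.ofReal (Y.J (Y.branch i z)) ∂Y.m =
          ∫⁻ x in Y.cell ⁻¹' {i}, Y.slice g (Y.R (Y.cell x) - 1) x ∂Y.m := fun i => by
        rw [Y.lintegral_branch i (Y.measurable_slice hg _)]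
        refine setLIntegral_congr_fun (Y.measurableSet_cell i) fun x hx => ?_
        have hx' : Y.cell x = i := hx
        simp only [hx']
      simp_rw [h1]
      rw [← lintegral_iUnion (fun i => Y.measurableSet_cell i)
        (fun i j hij => Disjoint.preimage _ (by simpa using hij)), ← preimage_iUnion,
        iUnion_of_singleton, preimage_univ]
      have hm : ∀ l, MeasurableSet {x | l + 1 = Y.R (Y.cell x)} := fun l =>
        Y.measurableSet_cell_preimage {i | l + 1 = Y.R i}
      have h2 : ∀ l, ∫⁻ x in {x | l + 1 = Y.R (Y.cell x)}, Y.slice g l x ∂Y.m =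
          ∫⁻ x in {x | l + 1 = Y.R (Y.cell x)}, Y.slice g (Y.R (Y.cell x) - 1) x ∂Y.m :=
        fun l => setLIntegral_congr_fun (hm l) fun x hx => by
          have hx' : l + 1 = Y.R (Y.cell x) := hx
          simp only [← hx', Nat.add_sub_cancel]
      simp_rw [h2]
      rw [← lintegral_iUnion hm]
      · congr 2
        ext x
        simp only [mem_univ, mem_iUnion, mem_ofPred_eq, true_iff]
        exact ⟨Y.R (Y.cell x) - 1, Nat.sub_add_cancel (Y.R_pos _)⟩
      · intro l l' hne
        refine disjoint_left.2 fun x hx hx' => hne ?_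
        have h1 : l + 1 = Y.R (Y.cell x) := hx
        have h2 : l' + 1 = Y.R (Y.cell x) := hx'
        omega
    · intro i
      exact (((Y.measurable_slice hg _).comp (Y.measurable_branch i)).div
        ((Y.measurable_J.comp (Y.measurable_branch i)).ennreal_ofReal)).aemeasurable
  rw [hbot, ← ENNReal.tsum_add]
  refine tsum_congr fun l => ?_
  have hm : MeasurableSet {x | l + 1 = Y.R (Y.cell x)} :=
    Y.measurableSet_cell_preimage {i | l + 1 = Y.R i}
  rw [← lintegral_add_compl (μ := Y.m) (Y.slice g l) hm]
  congr 1
  rw [← lintegral_indicator hm.compl]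
  refine lintegral_congr fun x => ?_
  by_cases h : l + 1 < Y.R (Y.cell x)
  · rw [indicator_of_mem (by simpa using h.ne), slice, dif_pos h, Y.ltransfer_up g h, slice,
      dif_pos (Nat.lt_of_succ_lt h)]
  · rw [slice, dif_neg h, indicator_apply, slice]
    split_ifs with h1 h2
    · have : l + 1 ≠ Y.R (Y.cell x) := h1
      omega
    · rfl
    · rfl

/-- Almost every point has all its preimages in a given set of full measure. -/
theorem ae_forall_preimage {Q : Y.Tower → Prop} (hQ : ∀ᵐ p ∂Y.mbar, Q p) :
    ∀ᵐ x ∂Y.mbar, ∀ y, Y.F y = x → Q y := by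
  obtain ⟨N, hN, hNm, hN0⟩ := exists_measurable_superset_of_null (ae_iff.1 hQ)
  -- Preservation of the integral applied to the indicator of a null set: the sum over preimages
  -- vanishes almost everywhere, and its weights are positive.
  have h1 : ∫⁻ x, Y.ltransfer (N.indicator 1) x ∂Y.mbar = 0 := by
    rw [Y.lintegral_ltransfer (measurable_one.indicator hNm), lintegral_indicator_one hNm, hN0]
  rw [lintegral_eq_zero_iff (Y.measurable_ltransfer (measurable_one.indicator hNm))] at h1
  filter_upwards [h1] with x hx y hy
  by_contra hcon
  have h2 := ENNReal.tsum_eq_zero.1 hx ⟨y, hy⟩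
  rw [ENNReal.div_eq_zero_iff] at h2
  rcases h2 with h2 | h2
  · simp [indicator_of_mem (hN hcon)] at h2
  · exact ENNReal.ofReal_ne_top h2

theorem ae_forall_iterate_preimage {Q : Y.Tower → Prop} (hQ : ∀ᵐ p ∂Y.mbar, Q p) :
    ∀ᵐ x ∂Y.mbar, ∀ n y, Y.F^[n] y = x → Q y := by
  rw [ae_all_iff]
  intro n
  induction n with
  | zero =>
    filter_upwards [hQ] with x hx y hy
    exact (show y = x from hy) ▸ hx
  | succ n ih =>
    filter_upwards [Y.ae_forall_preimage ih] with x hx y hy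
    rw [Function.iterate_succ_apply'] at hy
    exact hx _ hy y rfl

end

end QuotientTower
end

/-! ### Itineraries, bounded distortion and approximation on cylinders -/

noncomputable section

namespace QuotientTower

open TowerData

variable {Λ ι : Type*} [MeasurableSpace Λ] (Y : QuotientTower Λ ι)

/-- The first `n` symbols of the itinerary of a point under the return map. -/
def code : ℕ → Λ → List ι
  | 0, _ => []
  | n + 1, x => Y.cell x :: code n (Y.ret x)

@[simp] theorem length_code (n : ℕ) (x : Λ) : (Y.code n x).length = n := by
  induction n generalizing x with
  | zero => rfl
  | succ n ih => simp [code, ih]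

theorem take_code (n : ℕ) (x : Λ) : (Y.code (n + 1) x).take n = Y.code n x := by
  induction n generalizing x with
  | zero => rfl
  | succ n ih => rw [code, List.take_succ_cons, ih, code]

/-- Points with the same itinerary of length `n` agree in the tower for a time at least `n`. -/
theorem exists_agreeBefore_of_code_eq (n : ℕ) {x y : Λ} (h : Y.code n x = Y.code n y) :
    ∃ k ≥ n, Y.F^[k] (Y.bottom x) = Y.bottom (Y.ret^[n] x) ∧
      Y.F^[k] (Y.bottom y) = Y.bottom (Y.ret^[n] y) ∧
      Y.AgreeBefore k (Y.bottom x) (Y.bottom y) := by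
  induction n generalizing x y with
  | zero => exact ⟨0, le_rfl, rfl, rfl, AgreeBefore.zero _ _⟩
  | succ n ih =>
    simp only [code, List.cons.injEq] at h
    obtain ⟨k, hk, h1, h2, h3⟩ := ih h.2
    have hR := Y.R_pos (Y.cell x)
    refine ⟨Y.R (Y.cell x) + k, by omega, ?_, ?_, ?_⟩
    · rw [add_comm, Function.iterate_add_apply, iterate_R_F_bottom, h1, Function.iterate_succ_apply]
    · rw [add_comm, Function.iterate_add_apply, h.1, iterate_R_F_bottom, h2,
        Function.iterate_succ_apply]
    · refine (agreeBefore_bottom h.1).add ?_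
      rw [iterate_R_F_bottom, h.1, iterate_R_F_bottom]
      exact h3

theorem eq_of_forall_code_eq {x y : Λ} (h : ∀ n, Y.code n x = Y.code n y) : x = y := by
  have : Y.sep (Y.bottom x) (Y.bottom y) = ⊤ := by
    rw [ENat.eq_top_iff_forall_ge]
    intro m
    refine natCast_le_sep fun i hi => ?_
    obtain ⟨k, hk, -, -, h3⟩ := Y.exists_agreeBefore_of_code_eq (m + 1) (h (m + 1))
    exact h3 i (by omega)
  exact congrArg base (Y.eq_of_sep_eq_top _ _ this)

/-- The inverse branch of an iterate of the return map, indexed by a word. -/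
def wordBranch : List ι → Λ → Λ
  | [], z => z
  | i :: w, z => Y.branch i (wordBranch w z)

@[simp] theorem code_wordBranch (w : List ι) (z : Λ) :
    Y.code w.length (Y.wordBranch w z) = w := by
  induction w with
  | nil => rfl
  | cons i w ih => simp [code, wordBranch, ih]

@[simp] theorem ret_iterate_wordBranch (w : List ι) (z : Λ) :
    Y.ret^[w.length] (Y.wordBranch w z) = z := by
  induction w with
  | nil => rfl
  | cons i w ih => simp [wordBranch, ih]

/-- The Jacobian of the inverse branch indexed by a word. -/
def wordDensity : List ι → Λ → ℝ
  | [], _ => 1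
  | i :: w, z => wordDensity w z / Y.J (Y.branch i (Y.wordBranch w z))

theorem wordDensity_pos (w : List ι) (z : Λ) : 0 < Y.wordDensity w z := by
  induction w with
  | nil => exact one_pos
  | cons i w ih => exact div_pos ih (Y.J_pos _)

/-- The points at the top of column `i` over `a` and `b` lie in the same returning set, so the
distortion hypothesis compares their Jacobians. -/
theorem J_branch_le (i : ι) (a b : Λ) : Y.J (Y.branch i a) ≤
    (1 + Y.C₁ * Y.sepDist Y.β (Y.bottom a) (Y.bottom b)) * Y.J (Y.branch i b) := by
  set p := Y.preimageBottomEquiv a i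
  set q := Y.preimageBottomEquiv b i
  have hp : p.1 ∈ Y.returning (Y.R i - 1) (Y.label (Y.R i - 1) i) :=
    ⟨⟨rfl, by change Y.label _ (Y.cell (Y.branch i a)) = _; rw [cell_branch]⟩, by
      rw [mem_preimage, p.2]; rfl⟩
  have hq : q.1 ∈ Y.returning (Y.R i - 1) (Y.label (Y.R i - 1) i) :=
    ⟨⟨rfl, by change Y.label _ (Y.cell (Y.branch i b)) = _; rw [cell_branch]⟩, by
      rw [mem_preimage, q.2]; rfl⟩
  have h := Y.distortion _ _ p.1 hp q.1 hq
  rw [p.2, q.2] at h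
  change |Y.J (Y.branch i a) / Y.J (Y.branch i b) - 1| ≤ _ at h
  have h1 := (abs_le.1 h).2
  rw [← div_le_iff₀ (Y.J_pos _)]
  linarith

theorem sepDist_wordBranch_le (w : List ι) (z z' : Λ) :
    Y.sepDist Y.β (Y.bottom (Y.wordBranch w z)) (Y.bottom (Y.wordBranch w z')) ≤
      Y.β ^ w.length / Y.β := by
  obtain ⟨k, hk, -, -, h3⟩ := Y.exists_agreeBefore_of_code_eq w.length
    (x := Y.wordBranch w z) (y := Y.wordBranch w z') (by simp)
  refine (h3.sepDist_le Y.β_pos Y.β_lt_one.le).trans ?_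
  refine (mul_le_of_le_one_right (by have := Y.β_pos; positivity)
    (sepDist_le_one Y.β_pos.le Y.β_lt_one.le _ _)).trans ?_
  exact div_le_div_of_nonneg_right (pow_le_pow_of_le_one Y.β_pos.le Y.β_lt_one.le hk) Y.β_pos.le

/-- The bound of the distortion of the iterates of the return map. -/
def distortionBound : ℝ := Real.exp (Y.C₁ / Y.β * (1 - Y.β)⁻¹)

theorem distortionBound_pos : 0 < Y.distortionBound := Real.exp_pos _

/-- Bounded distortion for all the iterates of the return map. -/
theorem wordDensity_le (w : List ι) (z z' : Λ) :
    Y.wordDensity w z ≤ Y.distortionBound * Y.wordDensity w z' := by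
  have hβ := Y.β_pos
  have hC := Y.C₁_pos
  -- Prepending a letter to `w` costs a factor at most `1 + C₁ β ^ w.length / β`, since both points
  -- already share the itinerary `w`. The product of these factors converges.
  have key : Y.wordDensity w z ≤ Real.exp (∑ k ∈ Finset.range w.length, Y.C₁ / Y.β * Y.β ^ k) *
      Y.wordDensity w z' := by
    induction w with
    | nil => simp [wordDensity]
    | cons i w ih =>
      have hJ := Y.J_branch_le i (Y.wordBranch w z') (Y.wordBranch w z)
      have h1 : 1 + Y.C₁ * Y.sepDist Y.β (Y.bottom (Y.wordBranch w z'))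
          (Y.bottom (Y.wordBranch w z)) ≤ Real.exp (Y.C₁ / Y.β * Y.β ^ w.length) := by
        refine le_trans ?_ (Real.add_one_le_exp _)
        have h3 := mul_le_mul_of_nonneg_left (Y.sepDist_wordBranch_le w z' z) hC.le
        have h2 : Y.C₁ * (Y.β ^ w.length / Y.β) = Y.C₁ / Y.β * Y.β ^ w.length := by ring
        linarith
      have h2 : Y.J (Y.branch i (Y.wordBranch w z')) ≤
          Real.exp (Y.C₁ / Y.β * Y.β ^ w.length) * Y.J (Y.branch i (Y.wordBranch w z)) :=
        hJ.trans (mul_le_mul_of_nonneg_right h1 (Y.J_pos _).le)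
      rw [List.length_cons, Finset.sum_range_succ, Real.exp_add, wordDensity, wordDensity,
        div_le_iff₀ (Y.J_pos _), mul_div_assoc', div_mul_eq_mul_div, le_div_iff₀ (Y.J_pos _)]
      have hE := Real.exp_pos (∑ k ∈ Finset.range w.length, Y.C₁ / Y.β * Y.β ^ k)
      calc Y.wordDensity w z * Y.J (Y.branch i (Y.wordBranch w z'))
          ≤ (Real.exp (∑ k ∈ Finset.range w.length, Y.C₁ / Y.β * Y.β ^ k) *
              Y.wordDensity w z') * (Real.exp (Y.C₁ / Y.β * Y.β ^ w.length) *
              Y.J (Y.branch i (Y.wordBranch w z))) :=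
            mul_le_mul ih h2 (Y.J_pos _).le (mul_nonneg hE.le (Y.wordDensity_pos _ _).le)
        _ = _ := by ring
  refine key.trans (mul_le_mul_of_nonneg_right ?_ (Y.wordDensity_pos _ _).le)
  refine Real.exp_le_exp.2 ?_
  rw [← Finset.mul_sum]
  refine mul_le_mul_of_nonneg_left ?_ (by positivity)
  rw [← tsum_geometric_of_lt_one hβ.le Y.β_lt_one]
  exact (summable_geometric_of_lt_one hβ.le Y.β_lt_one).sum_le_tsum _ fun i _ => by positivity

/-- The points whose itinerary of length `n` is the word `w`. -/
def cylinder (n : ℕ) (w : List ι) : Set Λ := {x | Y.code n x = w}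

variable [Countable ι]

theorem measurableSet_code_preimage (n : ℕ) (s : Set (List ι)) :
    MeasurableSet (Y.code n ⁻¹' s) := by
  induction n generalizing s with
  | zero =>
    let _ : MeasurableSpace (List ι) := ⊤
    exact measurable_const (a := ([] : List ι)) (t := s) trivial
  | succ n ih =>
    have : Y.code (n + 1) ⁻¹' s = ⋃ i, Y.cell ⁻¹' {i} ∩ Y.ret ⁻¹' (Y.code n ⁻¹' {w | i :: w ∈ s}) := by
      ext x; simp [code]
    rw [this]
    exact MeasurableSet.iUnion fun i => (Y.measurableSet_cell i).inter (Y.measurable_ret (ih _))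

theorem measurableSet_cylinder (n : ℕ) (w : List ι) : MeasurableSet (Y.cylinder n w) :=
  Y.measurableSet_code_preimage n {w}

theorem lintegral_code (n : ℕ) (c : List ι → ℝ≥0∞) (B : Set Λ) :
    ∫⁻ x in B, c (Y.code n x) ∂Y.m = ∑' w, c w * Y.m (Y.cylinder n w ∩ B) := by
  let _ : MeasurableSpace (List ι) := ⊤
  have : DiscreteMeasurableSpace (List ι) := ⟨fun _ => trivial⟩
  have hc : Measurable (Y.code n) := fun s _ => Y.measurableSet_code_preimage n s
  rw [← lintegral_map (g := Y.code n) (measurable_of_countable c) hc, lintegral_countable']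
  refine tsum_congr fun w => ?_
  rw [Measure.map_apply hc (measurableSet_singleton w), Measure.restrict_apply
    (hc (measurableSet_singleton w))]
  rfl

variable [StandardBorelSpace Λ]

omit [Countable ι] in
theorem measurable_wordBranch (w : List ι) : Measurable (Y.wordBranch w) := by
  induction w with
  | nil => exact measurable_id
  | cons i w ih => exact (Y.measurable_branch i).comp ih

omit [Countable ι] in
theorem measurable_wordDensity (w : List ι) : Measurable (Y.wordDensity w) := by
  induction w with
  | nil => exact measurable_const
  | cons i w ih =>
    exact ih.div (Y.measurable_J.comp ((Y.measurable_branch i).comp (Y.measurable_wordBranch w)))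

/-- Change of variables for the inverse branches of the iterates of the return map. -/
theorem lintegral_wordBranch (w : List ι) {g : Λ → ℝ≥0∞} (hg : Measurable g) :
    ∫⁻ x in Y.cylinder w.length w, g x ∂Y.m =
      ∫⁻ z, g (Y.wordBranch w z) * ENNReal.ofReal (Y.wordDensity w z) ∂Y.m := by
  induction w generalizing g with
  | nil =>
    have : Y.cylinder ([] : List ι).length [] = univ := by ext x; simp [cylinder, code]
    rw [this]
    simp [wordBranch, wordDensity]
  | cons i w ih =>
    have h1 : Y.cylinder (i :: w).length (i :: w) =
        Y.cell ⁻¹' {i} ∩ Y.ret ⁻¹' Y.cylinder w.length w := by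
      ext x; simp [cylinder, code]
    have hm := Y.measurable_ret (Y.measurableSet_cylinder w.length w)
    have h2 : ∫⁻ x in Y.cylinder (i :: w).length (i :: w), g x ∂Y.m =
        ∫⁻ x in Y.cell ⁻¹' {i}, (Y.ret ⁻¹' Y.cylinder w.length w).indicator g x ∂Y.m := by
      rw [lintegral_indicator hm, Measure.restrict_restrict hm, h1, inter_comm]
    have hb := Y.measurable_branch i
    rw [h2, ← Y.lintegral_branch i (hg.indicator hm)]
    have h3 : ∀ z, (Y.ret ⁻¹' Y.cylinder w.length w).indicator g (Y.branch i z) /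
        ENNReal.ofReal (Y.J (Y.branch i z)) = (Y.cylinder w.length w).indicator
          (fun z => g (Y.branch i z) / ENNReal.ofReal (Y.J (Y.branch i z))) z := by
      intro z
      by_cases hz : z ∈ Y.cylinder w.length w
      · rw [indicator_of_mem hz, indicator_of_mem (by simpa using hz)]
      · rw [indicator_of_notMem hz, indicator_of_notMem (by simpa using hz), ENNReal.zero_div]
    simp_rw [h3]
    rw [lintegral_indicator (Y.measurableSet_cylinder _ _),
      ih (g := fun z => g (Y.branch i z) / ENNReal.ofReal (Y.J (Y.branch i z)))
        ((hg.comp hb).div ((Y.measurable_J.comp hb).ennreal_ofReal))]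
    refine lintegral_congr fun z => ?_
    simp only [wordBranch, wordDensity]
    rw [ENNReal.ofReal_div_of_pos (Y.J_pos _), ENNReal.div_eq_inv_mul, ENNReal.div_eq_inv_mul]
    ring

theorem measure_cylinder (w : List ι) :
    Y.m (Y.cylinder w.length w) = ∫⁻ z, ENNReal.ofReal (Y.wordDensity w z) ∂Y.m := by
  rw [← setLIntegral_one, Y.lintegral_wordBranch w (g := fun _ => 1) measurable_const]
  simp

theorem measure_cylinder_ne_zero (w : List ι) : Y.m (Y.cylinder w.length w) ≠ 0 := by
  rw [measure_cylinder, Ne, lintegral_eq_zero_iff (Y.measurable_wordDensity w).ennreal_ofReal]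
  intro h
  refine Y.m_ne_zero (ae_eq_bot.1 (eventually_false_iff_eq_bot.1 ?_))
  filter_upwards [h] with z hz
  have := Y.wordDensity_pos w z
  simp only [Pi.zero_apply, ENNReal.ofReal_eq_zero] at hz
  linarith

/-- By bounded distortion the Jacobian of an inverse branch is comparable to its mean `m(cylinder) /
m(Λ)`. So averages over a cylinder and over the whole base are comparable, uniformly in the word;
the next lemma gives the opposite direction. -/
theorem lintegral_cylinder_le (w : List ι) {g : Λ → ℝ≥0∞} (hg : Measurable g) :
    Y.m univ * ∫⁻ x in Y.cylinder w.length w, g x ∂Y.m ≤ ENNReal.ofReal Y.distortionBound *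
      Y.m (Y.cylinder w.length w) * ∫⁻ z, g (Y.wordBranch w z) ∂Y.m := by
  have hgw : Measurable fun z => g (Y.wordBranch w z) := hg.comp (Y.measurable_wordBranch w)
  have hD := (Y.measurable_wordDensity w).ennreal_ofReal
  rw [Y.lintegral_wordBranch w hg, ← lintegral_const_mul _ (f := fun z =>
    g (Y.wordBranch w z) * ENNReal.ofReal (Y.wordDensity w z)) (hgw.mul hD),
    ← lintegral_const_mul _ hgw]
  refine lintegral_mono fun z => ?_
  have h1 : Y.m univ * ENNReal.ofReal (Y.wordDensity w z) ≤
      ENNReal.ofReal Y.distortionBound * Y.m (Y.cylinder w.length w) := by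
    rw [measure_cylinder, ← lintegral_const_mul _ hD, mul_comm, ← lintegral_const]
    refine lintegral_mono fun z' => ?_
    rw [← ENNReal.ofReal_mul Y.distortionBound_pos.le]
    exact ENNReal.ofReal_le_ofReal (Y.wordDensity_le w z z')
  calc _ = g (Y.wordBranch w z) * (Y.m univ * ENNReal.ofReal (Y.wordDensity w z)) := by ring
    _ ≤ g (Y.wordBranch w z) * (ENNReal.ofReal Y.distortionBound *
        Y.m (Y.cylinder w.length w)) := by gcongr
    _ = _ := by ring

theorem le_lintegral_cylinder (w : List ι) {g : Λ → ℝ≥0∞} (hg : Measurable g) :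
    Y.m (Y.cylinder w.length w) * ∫⁻ z, g (Y.wordBranch w z) ∂Y.m ≤
      ENNReal.ofReal Y.distortionBound * Y.m univ *
        ∫⁻ x in Y.cylinder w.length w, g x ∂Y.m := by
  have hgw : Measurable fun z => g (Y.wordBranch w z) := hg.comp (Y.measurable_wordBranch w)
  have hD := (Y.measurable_wordDensity w).ennreal_ofReal
  rw [Y.lintegral_wordBranch w hg, ← lintegral_const_mul _ (f := fun z =>
    g (Y.wordBranch w z) * ENNReal.ofReal (Y.wordDensity w z)) (hgw.mul hD),
    ← lintegral_const_mul _ hgw]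
  refine lintegral_mono fun z => ?_
  have h1 : Y.m (Y.cylinder w.length w) ≤ ENNReal.ofReal Y.distortionBound * Y.m univ *
      ENNReal.ofReal (Y.wordDensity w z) := by
    rw [measure_cylinder]
    calc _ ≤ ∫⁻ _, ENNReal.ofReal Y.distortionBound *
          ENNReal.ofReal (Y.wordDensity w z) ∂Y.m := by
          refine lintegral_mono fun z' => ?_
          rw [← ENNReal.ofReal_mul Y.distortionBound_pos.le]
          exact ENNReal.ofReal_le_ofReal (Y.wordDensity_le w z' z)
      _ = _ := by rw [lintegral_const]; ring
  calc _ ≤ ENNReal.ofReal Y.distortionBound * Y.m univ *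
      ENNReal.ofReal (Y.wordDensity w z) * g (Y.wordBranch w z) := by gcongr
    _ = _ := by ring

/-- The itineraries generate the measurable sets. -/
theorem measurableSpace_le_iSup_comap_code :
    ‹MeasurableSpace Λ› ≤ ⨆ n, MeasurableSpace.comap (Y.code n) ⊤ := by
  let _ : MeasurableSpace (List ι) := ⊤
  have : DiscreteMeasurableSpace (List ι) := ⟨fun _ => trivial⟩
  let π : Λ → ℕ → List ι := fun x n => Y.code n x
  have hπ : Measurable π :=
    measurable_pi_lambda _ fun n s _ => Y.measurableSet_code_preimage n s
  have hinj : Function.Injective π := fun x y h => Y.eq_of_forall_code_eq fun n => congrFun h n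
  -- An injective measurable map between standard Borel spaces is a measurable embedding, so
  -- sequences of itineraries recover the whole σ-algebra.
  have h := (hπ.measurableEmbedding hinj).comap_eq
  refine h.symm.le.trans ?_
  rw [MeasurableSpace.pi, MeasurableSpace.comap_iSup]
  refine iSup_mono fun n => ?_
  rw [MeasurableSpace.comap_comp]
  exact le_rfl

/-- Integrable functions are approximated in mean by functions of finite itineraries. -/
theorem exists_code_approx {g : Λ → ℝ} (hg : Integrable g Y.m) (hgm : Measurable g) {δ : ℝ≥0∞}
    (hδ : 0 < δ) :
    ∃ (n : ℕ) (c : List ι → ℝ), ∫⁻ x, ‖g x - c (Y.code n x)‖ₑ ∂Y.m ≤ δ := by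
  let ℱ : Filtration ℕ ‹MeasurableSpace Λ› :=
    { seq := fun n => MeasurableSpace.comap (Y.code n) ⊤
      mono' := by
        refine monotone_nat_of_le_succ fun n => ?_
        rintro _ ⟨s, -, rfl⟩
        refine ⟨List.take n ⁻¹' s, trivial, ?_⟩
        ext x
        rw [mem_preimage, mem_preimage, take_code]; rfl
      le' := by
        rintro n _ ⟨s, -, rfl⟩
        exact Y.measurableSet_code_preimage n s }
  -- Lévy's upward theorem for the filtration by itineraries. A conditional expectation is
  -- measurable with respect to the itinerary and hence factors through it.
  have hlim := hg.tendsto_eLpNorm_condExp (ℱ := ℱ)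
    (hgm.mono Y.measurableSpace_le_iSup_comap_code le_rfl).stronglyMeasurable
  obtain ⟨n, hn⟩ := ((tendsto_order.1 hlim).2 δ hδ).exists
  have hm : Measurable[MeasurableSpace.comap (Y.code n) ⊤] (Y.m[g | ℱ n]) :=
    (stronglyMeasurable_condExp (μ := Y.m) (m := ℱ n) (f := g)).measurable
  have hf := @Measurable.factorsThrough _ _ _ ⊤ (Y.code n) (Y.m[g | ℱ n]) _ _ hm
  refine ⟨n, Function.extend (Y.code n) (Y.m[g | ℱ n]) 0, ?_⟩
  refine le_trans (le_of_eq ?_) hn.le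
  rw [eLpNorm_one_eq_lintegral_enorm]
  refine lintegral_congr fun x => ?_
  rw [hf.extend_apply, Pi.sub_apply, ← enorm_neg, neg_sub]

/-- Some inverse branch makes a given function almost constant in mean. -/
theorem exists_wordBranch_approx {g : Λ → ℝ} (hg : Integrable g Y.m) (hgm : Measurable g)
    {δ : ℝ≥0∞} (hδ : 0 < δ) :
    ∃ (w : List ι) (c : ℝ), ∫⁻ z, ‖g (Y.wordBranch w z) - c‖ₑ ∂Y.m ≤ δ := by
  have hm0 : Y.m univ ≠ 0 := by simpa using Y.m_ne_zero
  have hmt : Y.m univ ≠ ∞ := measure_ne_top _ _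
  set K := ENNReal.ofReal Y.distortionBound with hK
  have hK0 : K ≠ 0 := by
    rw [hK, Ne, ENNReal.ofReal_eq_zero, not_le]; exact Y.distortionBound_pos
  have hKt : K ≠ ∞ := ENNReal.ofReal_ne_top
  -- `δ'` is the mean error allowed on one cylinder; the factor `K m(Λ)` is the price of
  -- transporting the estimate to the whole base.
  obtain ⟨δ', hδ', hδ'1⟩ : ∃ δ' : ℝ≥0∞, 0 < δ' ∧ K * Y.m univ * δ' ≤ δ ∧ δ' ≠ ∞ := by
    refine ⟨min δ 1 / (K * Y.m univ), ?_, ?_, ?_⟩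
    · refine ENNReal.div_pos (lt_min hδ one_pos).ne' (ENNReal.mul_ne_top hKt hmt)
    · rw [ENNReal.mul_div_cancel (mul_ne_zero hK0 hm0) (ENNReal.mul_ne_top hKt hmt)]
      exact min_le_left _ _
    · exact (ENNReal.div_lt_top (by simp) (mul_ne_zero hK0 hm0)).ne
  have hpos : 0 < δ' * Y.m univ := ENNReal.mul_pos hδ'.ne' hm0
  obtain ⟨η, hη, hη'⟩ := exists_between hpos
  obtain ⟨n, c, hc⟩ := Y.exists_code_approx hg hgm hη
  have hc' : ∀ r : ℝ, Measurable fun x => ‖g x - r‖ₑ := fun r => (hgm.sub_const r).enorm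
  -- Pigeonhole: if every cylinder had a mean error above `δ'`, the total error would be at least
  -- `δ' m(Λ) > η`.
  obtain ⟨w, hwn, hw⟩ : ∃ w : List ι, w.length = n ∧
      ∫⁻ x in Y.cylinder n w, ‖g x - c w‖ₑ ∂Y.m ≤ δ' * Y.m (Y.cylinder n w) := by
    by_contra! hcon
    have h1 : ∀ w, δ' * Y.m (Y.cylinder n w ∩ univ) ≤
        ∫⁻ x in Y.cylinder n w, ‖g x - c (Y.code n x)‖ₑ ∂Y.m := by
      intro w
      rw [inter_univ]
      by_cases hw : w.length = n
      · refine (hcon w hw).le.trans (le_of_eq ?_)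
        refine setLIntegral_congr_fun (Y.measurableSet_cylinder n w) fun x hx => ?_
        have hx' : Y.code n x = w := hx
        simp only [hx']
      · have : Y.cylinder n w = ∅ := by
          ext x
          simp only [cylinder, mem_ofPred_eq, mem_empty_iff_false, iff_false]
          rintro rfl
          exact hw (Y.length_code n x)
        simp [this]
    have h2 := ENNReal.tsum_le_tsum h1
    rw [← Y.lintegral_code n (fun _ => δ') univ, setLIntegral_const,
      ← lintegral_iUnion (fun w => Y.measurableSet_cylinder n w)] at h2
    · have h3 : ⋃ w, Y.cylinder n w = univ := by
        ext x; simp [cylinder]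
      rw [h3, Measure.restrict_univ] at h2
      exact absurd (h2.trans hc) (not_le.2 hη')
    · intro w w' hne
      refine disjoint_left.2 fun x hx hx' => hne ?_
      exact (show Y.code n x = w from hx).symm.trans hx'
  subst hwn
  refine ⟨w, c w, ?_⟩
  have h1 := Y.le_lintegral_cylinder w (hc' (c w))
  have h2 : Y.m (Y.cylinder w.length w) * ∫⁻ z, ‖g (Y.wordBranch w z) - c w‖ₑ ∂Y.m ≤
      Y.m (Y.cylinder w.length w) * δ :=
    calc _ ≤ _ := h1
      _ ≤ K * Y.m univ * (δ' * Y.m (Y.cylinder w.length w)) := by gcongr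
      _ = Y.m (Y.cylinder w.length w) * (K * Y.m univ * δ') := by ring
      _ ≤ _ := by gcongr; exact hδ'1.1
  exact (ENNReal.mul_le_mul_iff_right (Y.measure_cylinder_ne_zero w) (measure_ne_top _ _)).1 h2

/-- Along some sequence of inverse branches, a given function becomes constant almost everywhere. -/
theorem exists_wordBranch_tendsto {g : Λ → ℝ} (hg : Integrable g Y.m) (hgm : Measurable g) :
    ∃ (w : ℕ → List ι) (c : ℕ → ℝ),
      ∀ᵐ z ∂Y.m, Tendsto (fun k => g (Y.wordBranch (w k) z) - c k) atTop (𝓝 0) := by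
  have hpos : ∀ k : ℕ, (0 : ℝ≥0∞) < 2⁻¹ ^ k := fun k => ENNReal.pow_pos (by simp) k
  choose w c h using fun k : ℕ => Y.exists_wordBranch_approx hg hgm (hpos k)
  have hm : ∀ k, Measurable fun z => ‖g (Y.wordBranch (w k) z) - c k‖ₑ := fun k =>
    ((hgm.comp (Y.measurable_wordBranch (w k))).sub_const _).enorm
  refine ⟨w, c, ?_⟩
  -- The errors `2 ^ (-k)` are summable, which upgrades convergence in mean to convergence almost
  -- everywhere.
  have h1 : ∫⁻ z, ∑' k, ‖g (Y.wordBranch (w k) z) - c k‖ₑ ∂Y.m ≠ ∞ := by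
    rw [lintegral_tsum fun k => (hm k).aemeasurable]
    refine ne_top_of_le_ne_top ?_ (ENNReal.tsum_le_tsum h)
    rw [ENNReal.tsum_geometric]
    simp
  filter_upwards [ae_lt_top (Measurable.tsum hm) h1] with z hz
  have h2 := ENNReal.tendsto_atTop_zero_of_tsum_ne_top hz.ne
  rw [tendsto_zero_iff_norm_tendsto_zero]
  have h3 := (ENNReal.tendsto_toReal ENNReal.zero_ne_top).comp h2
  simpa [Function.comp_def] using h3

/-- Invariant densities are bounded above and below. -/
theorem invariant_measure_bounds {μ : Measure Λ} [IsFiniteMeasure μ] (hμ : μ ≪ Y.m)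
    (hinv : MeasurePreserving Y.ret μ μ) {A : Set Λ} (hA : MeasurableSet A) :
    Y.m univ * μ A ≤ ENNReal.ofReal Y.distortionBound * μ univ * Y.m A ∧
      Y.m A * μ univ ≤ ENNReal.ofReal Y.distortionBound * Y.m univ * μ A := by
  set K := ENNReal.ofReal Y.distortionBound with hK
  have hKt : K ≠ ∞ := ENNReal.ofReal_ne_top
  set h := μ.rnDeriv Y.m with hh
  have hhm : Measurable h := Measure.measurable_rnDeriv _ _
  have hht : ∀ᵐ x ∂Y.m, h x < ∞ := Measure.rnDeriv_lt_top _ _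
  have hint : Integrable (fun x => (h x).toReal) Y.m := Measure.integrable_toReal_rnDeriv
  have hB : ∀ {B}, MeasurableSet B → ∫⁻ x in B, h x ∂Y.m = μ B := fun {B} hB => by
    rw [Measure.setLIntegral_rnDeriv hμ]
  -- The density is replaced, up to `η` in mean, by a function of the itinerary of length `n`.
  -- Invariance gives `μ A = μ (ret^{-n} A)`, and in each cylinder the set `ret^{-n} A` occupies, up
  -- to the factor `K`, the proportion `m A / m(Λ)`. Letting `η → 0` finishes.
  have key : ∀ η : ℝ≥0∞, 0 < η → Y.m univ * μ A ≤ K * Y.m A * (μ univ + η) + Y.m univ * η ∧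
      Y.m A * μ univ ≤ K * Y.m univ * (μ A + η) + Y.m A * η := by
    intro η hη
    obtain ⟨n, c, hc⟩ := Y.exists_code_approx hint hhm.ennreal_toReal hη
    set B := Y.ret^[n] ⁻¹' A with hBdef
    have hBm : MeasurableSet B := Y.measurable_ret.iterate n hA
    have hμB : μ B = μ A := (hinv.iterate n).measure_preimage hA.nullMeasurableSet
    have hcm : Measurable fun x => ‖c (Y.code n x)‖ₑ := fun s _ =>
      Y.measurableSet_code_preimage n ((fun w => ‖c w‖ₑ) ⁻¹' s)
    have herr : Measurable fun x => ‖(h x).toReal - c (Y.code n x)‖ₑ := by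
      refine Measurable.enorm (hhm.ennreal_toReal.sub fun s _ => ?_)
      exact Y.measurableSet_code_preimage n (c ⁻¹' s)
    have hup : ∀ {S}, MeasurableSet S → μ S ≤ ∫⁻ x in S, ‖c (Y.code n x)‖ₑ ∂Y.m + η := by
      intro S hS
      rw [← hB hS]
      calc _ ≤ ∫⁻ x in S, ‖c (Y.code n x)‖ₑ + ‖(h x).toReal - c (Y.code n x)‖ₑ ∂Y.m := by
            refine lintegral_mono_ae (ae_restrict_of_ae ?_)
            filter_upwards [hht] with x hx
            have h1 : h x = ‖(h x).toReal‖ₑ := by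
              rw [Real.enorm_of_nonneg ENNReal.toReal_nonneg, ENNReal.ofReal_toReal hx.ne]
            conv_lhs => rw [h1]
            have h2 := enorm_add_le (c (Y.code n x)) ((h x).toReal - c (Y.code n x))
            rwa [add_sub_cancel] at h2
        _ = _ := lintegral_add_left hcm _
        _ ≤ _ := by gcongr; exact (setLIntegral_le_lintegral _ _).trans hc
    have hlow : ∀ {S}, MeasurableSet S → ∫⁻ x in S, ‖c (Y.code n x)‖ₑ ∂Y.m ≤ μ S + η := by
      intro S hS
      rw [← hB hS]
      calc _ ≤ ∫⁻ x in S, h x + ‖(h x).toReal - c (Y.code n x)‖ₑ ∂Y.m := by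
            refine lintegral_mono_ae (ae_restrict_of_ae ?_)
            filter_upwards [hht] with x hx
            have h1 : h x = ‖(h x).toReal‖ₑ := by
              rw [Real.enorm_of_nonneg ENNReal.toReal_nonneg, ENNReal.ofReal_toReal hx.ne]
            have h2 := enorm_sub_le (E := ℝ) (a := (h x).toReal)
              (b := (h x).toReal - c (Y.code n x))
            rwa [sub_sub_cancel, ← h1] at h2
        _ = _ := lintegral_add_left hhm _
        _ ≤ _ := by gcongr; exact (setLIntegral_le_lintegral _ _).trans hc
    have hlen : ∀ w : List ι, w.length ≠ n → Y.cylinder n w = ∅ := fun w hw => by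
      ext x
      simp only [cylinder, mem_ofPred_eq, mem_empty_iff_false, iff_false]
      rintro rfl
      exact hw (Y.length_code n x)
    have hind : ∀ w : List ι, w.length = n →
        ∫⁻ x in Y.cylinder n w, B.indicator 1 x ∂Y.m = Y.m (Y.cylinder n w ∩ B) ∧
        ∫⁻ z, B.indicator 1 (Y.wordBranch w z) ∂Y.m = Y.m A := by
      rintro w rfl
      constructor
      · rw [lintegral_indicator_one hBm, Measure.restrict_apply hBm, inter_comm]
      · rw [← lintegral_indicator_one hA]
        refine lintegral_congr fun z => ?_
        have : Y.wordBranch w z ∈ B ↔ z ∈ A := by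
          rw [hBdef, mem_preimage, ret_iterate_wordBranch]
        by_cases hz : z ∈ A
        · rw [indicator_of_mem hz, indicator_of_mem (this.2 hz)]; rfl
        · rw [indicator_of_notMem hz, indicator_of_notMem (mt this.1 hz)]
    have hone : Measurable (B.indicator (1 : Λ → ℝ≥0∞)) := measurable_one.indicator hBm
    have h1 : ∀ w, Y.m univ * Y.m (Y.cylinder n w ∩ B) ≤
        K * Y.m A * Y.m (Y.cylinder n w ∩ univ) := by
      intro w
      by_cases hw : w.length = n
      · have := Y.lintegral_cylinder_le w hone
        rw [hw, (hind w hw).1, (hind w hw).2] at this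
        rw [inter_univ]
        exact this.trans (le_of_eq (by ring))
      · simp [hlen w hw]
    have h2 : ∀ w, Y.m A * Y.m (Y.cylinder n w ∩ univ) ≤
        K * Y.m univ * Y.m (Y.cylinder n w ∩ B) := by
      intro w
      by_cases hw : w.length = n
      · have := Y.le_lintegral_cylinder w hone
        rw [hw, (hind w hw).1, (hind w hw).2] at this
        rw [inter_univ, mul_comm]
        exact this
      · simp [hlen w hw]
    have hB' := Y.lintegral_code n (fun w => ‖c w‖ₑ) B
    have hU' := Y.lintegral_code n (fun w => ‖c w‖ₑ) univ
    constructor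
    · calc Y.m univ * μ A = Y.m univ * μ B := by rw [hμB]
        _ ≤ Y.m univ * (∑' w, ‖c w‖ₑ * Y.m (Y.cylinder n w ∩ B) + η) := by
            rw [← hB']; gcongr; exact hup hBm
        _ = ∑' w, ‖c w‖ₑ * (Y.m univ * Y.m (Y.cylinder n w ∩ B)) + Y.m univ * η := by
            rw [mul_add, ← ENNReal.tsum_mul_left]
            congr 1; exact tsum_congr fun w => by ring
        _ ≤ ∑' w, ‖c w‖ₑ * (K * Y.m A * Y.m (Y.cylinder n w ∩ univ)) + Y.m univ * η := by
            gcongr ?_ + _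
            exact ENNReal.tsum_le_tsum fun w => mul_le_mul_right (h1 w) _
        _ = K * Y.m A * ∑' w, ‖c w‖ₑ * Y.m (Y.cylinder n w ∩ univ) + Y.m univ * η := by
            rw [← ENNReal.tsum_mul_left]
            congr 1; exact tsum_congr fun w => by ring
        _ ≤ _ := by rw [← hU']; gcongr; exact hlow MeasurableSet.univ
    · calc Y.m A * μ univ ≤ Y.m A * (∑' w, ‖c w‖ₑ * Y.m (Y.cylinder n w ∩ univ) + η) := by
            rw [← hU']; gcongr; exact hup MeasurableSet.univ
        _ = ∑' w, ‖c w‖ₑ * (Y.m A * Y.m (Y.cylinder n w ∩ univ)) + Y.m A * η := by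
            rw [mul_add, ← ENNReal.tsum_mul_left]
            congr 1; exact tsum_congr fun w => by ring
        _ ≤ ∑' w, ‖c w‖ₑ * (K * Y.m univ * Y.m (Y.cylinder n w ∩ B)) + Y.m A * η := by
            gcongr ?_ + _
            exact ENNReal.tsum_le_tsum fun w => mul_le_mul_right (h2 w) _
        _ = K * Y.m univ * ∑' w, ‖c w‖ₑ * Y.m (Y.cylinder n w ∩ B) + Y.m A * η := by
            rw [← ENNReal.tsum_mul_left]
            congr 1; exact tsum_congr fun w => by ring
        _ ≤ _ := by rw [← hB', ← hμB]; gcongr; exact hlow hBm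
  have hlim : ∀ a b e d : ℝ≥0∞, a ≠ ∞ → d ≠ ∞ →
      Tendsto (fun η : ℝ≥0∞ => a * (b + η) + d * η) (𝓝[>] 0) (𝓝 (a * b)) := by
    intro a b _ d ha hd
    have h1 : Tendsto (fun η : ℝ≥0∞ => a * (b + η) + d * η) (𝓝 0) (𝓝 (a * (b + 0) + d * 0)) := by
      refine Tendsto.add ?_ ?_
      · exact ENNReal.Tendsto.const_mul (tendsto_const_nhds.add tendsto_id) (Or.inr ha)
      · exact ENNReal.Tendsto.const_mul tendsto_id (Or.inr hd)
    simpa using h1.mono_left nhdsWithin_le_nhds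
  have hAt : Y.m A ≠ ∞ := measure_ne_top _ _
  have hUt : Y.m univ ≠ ∞ := measure_ne_top _ _
  constructor
  · rw [mul_right_comm]
    exact ge_of_tendsto (hlim (K * Y.m A) (μ univ) 0 (Y.m univ) (ENNReal.mul_ne_top hKt hAt) hUt)
      (eventually_nhdsWithin_of_forall fun η hη => (key η hη).1)
  · exact ge_of_tendsto (hlim (K * Y.m univ) (μ A) 0 (Y.m A) (ENNReal.mul_ne_top hKt hUt) hAt)
      (eventually_nhdsWithin_of_forall fun η hη => (key η hη).2)

end QuotientTower
end

/-! ### Absolutely continuous invariant measures: comparison with the reference measure -/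

noncomputable section

namespace QuotientTower

open TowerData

variable {Λ ι : Type*} [MeasurableSpace Λ] (Y : QuotientTower Λ ι)

/-- The points of `Λ` below the part of a set on the level `l`. -/
def sliceSet (A : Set Y.Tower) (l : ℕ) : Set Λ :=
  {x | ∃ h : l < Y.R (Y.cell x), (⟨(x, l), h⟩ : Y.Tower) ∈ A}

/-- The part of a measure on the tower that lives on the base. -/
def baseMeasure (ν : Measure Y.Tower) : Measure Λ := (ν.restrict {p | level p = 0}).map base

variable {ν : Measure Y.Tower} [IsProbabilityMeasure ν]

instance : IsFiniteMeasure (Y.baseMeasure ν) := by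
  unfold baseMeasure; infer_instance

omit [IsProbabilityMeasure ν] in
theorem baseMeasure_apply {s : Set Λ} (hs : MeasurableSet s) :
    Y.baseMeasure ν s = ν {p | base p ∈ s ∧ level p = 0} := by
  rw [baseMeasure, Measure.map_apply Y.measurable_base hs,
    Measure.restrict_apply (Y.measurable_base hs)]
  rfl

variable [Countable ι]

theorem measurableSet_sliceSet {A : Set Y.Tower} (hA : MeasurableSet A) (l : ℕ) :
    MeasurableSet (Y.sliceSet A l) := by
  have : Y.sliceSet A l = Y.slice (A.indicator 1) l ⁻¹' {1} := by
    ext x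
    by_cases h : l < Y.R (Y.cell x)
    · by_cases hx : (⟨(x, l), h⟩ : Y.Tower) ∈ A <;>
        simp [sliceSet, Y.slice_of_lt _ h, h, hx]
    · simp [sliceSet, Y.slice_of_not_lt _ h, h]
  rw [this]
  exact Y.measurable_slice (measurable_one.indicator hA) l (measurableSet_singleton 1)

omit [IsProbabilityMeasure ν] in
/-- An invariant measure on the tower is determined by its part on the base. -/
theorem measure_inter_level (hinv : MeasurePreserving Y.F ν ν) (l : ℕ) {A : Set Y.Tower}
    (hA : MeasurableSet A) :
    ν (A ∩ {p | level p = l}) = Y.baseMeasure ν (Y.sliceSet A l) := by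
  induction l generalizing A with
  | zero =>
    rw [Y.baseMeasure_apply (Y.measurableSet_sliceSet hA 0)]
    congr 1
    ext p
    simp only [mem_inter_iff, mem_ofPred_eq, sliceSet]
    constructor
    · rintro ⟨h1, h2⟩
      have h3 : Y.bottom (base p) = p := Tower.ext' rfl h2.symm
      refine ⟨⟨Y.R_pos _, ?_⟩, h2⟩
      exact h3 ▸ h1
    · rintro ⟨⟨h, h1⟩, h2⟩
      have h3 : Y.bottom (base p) = p := Tower.ext' rfl h2.symm
      exact ⟨h3 ▸ h1, h2⟩
  | succ l ih =>
    have hlev : MeasurableSet {p : Y.Tower | level p = l + 1} :=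
      Y.measurable_level (measurableSet_singleton (l + 1))
    rw [← hinv.measure_preimage (hA.inter hlev).nullMeasurableSet]
    -- Only points of level `l` that do not return reach level `l + 1`, so invariance lowers the
    -- level by one.
    have h1 : Y.F ⁻¹' (A ∩ {p | level p = l + 1}) =
        (Y.F ⁻¹' A ∩ {p | level p + 1 < Y.R (Y.cell (base p))}) ∩ {p | level p = l} := by
      ext p
      simp only [mem_preimage, mem_inter_iff, mem_ofPred_eq, and_assoc, and_congr_right_iff]
      intro _
      rcases lt_or_eq p with h | h
      · rw [F_of_lt h]
        change level p + 1 = l + 1 ↔ _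
        simp [h]
      · rw [F_of_eq h]
        simp [h]
    rw [h1, ih ((Y.measurable_F hA).inter
      (Y.measurableSet_setOf_level_cell fun l i => l + 1 < Y.R i))]
    congr 1
    ext x
    constructor
    · rintro ⟨h, hx, hR⟩
      refine ⟨hR, ?_⟩
      rw [mem_preimage, F_of_lt hR] at hx
      exact hx
    · rintro ⟨h, hx⟩
      refine ⟨Nat.lt_of_succ_lt h, ?_, h⟩
      rw [mem_preimage, F_of_lt (p := ⟨(x, l), Nat.lt_of_succ_lt h⟩) h]
      exact hx

omit [IsProbabilityMeasure ν] in
theorem measure_eq_tsum (hinv : MeasurePreserving Y.F ν ν) {A : Set Y.Tower}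
    (hA : MeasurableSet A) : ν A = ∑' l, Y.baseMeasure ν (Y.sliceSet A l) := by
  have hlev : ∀ l, MeasurableSet {p : Y.Tower | level p = l} := fun l =>
    Y.measurable_level (measurableSet_singleton l)
  have h1 : A = ⋃ l, A ∩ {p | level p = l} := by ext p; simp
  conv_lhs => rw [h1]
  rw [measure_iUnion _ fun l => hA.inter (hlev l)]
  · exact tsum_congr fun l => Y.measure_inter_level hinv l hA
  · intro l l' hne
    refine disjoint_left.2 fun p hp hp' => hne ?_
    exact hp.2.symm.trans hp'.2

-- The preimage of a set on the base consists of the top points of the columns. Moving them down to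
-- the base by `measure_eq_tsum` and summing over the heights gives the preimage under the return
-- map.
omit [IsProbabilityMeasure ν] in
theorem measurePreserving_ret (hinv : MeasurePreserving Y.F ν ν) :
    MeasurePreserving Y.ret (Y.baseMeasure ν) (Y.baseMeasure ν) := by
  refine ⟨Y.measurable_ret, ?_⟩
  ext s hs
  have hm : MeasurableSet {p : Y.Tower | base p ∈ s ∧ level p = 0} :=
    (Y.measurable_base hs).inter (Y.measurable_level (measurableSet_singleton 0))
  rw [Measure.map_apply Y.measurable_ret hs, Y.baseMeasure_apply hs,
    ← hinv.measure_preimage hm.nullMeasurableSet, Y.measure_eq_tsum hinv (Y.measurable_F hm)]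
  have hl : ∀ l, MeasurableSet {x | l + 1 = Y.R (Y.cell x)} := fun l =>
    Y.measurableSet_cell_preimage {i | l + 1 = Y.R i}
  have h1 : Y.ret ⁻¹' s = ⋃ l, Y.ret ⁻¹' s ∩ {x | l + 1 = Y.R (Y.cell x)} := by
    ext x
    simp only [mem_iUnion, mem_inter_iff, mem_ofPred_eq, exists_and_left, iff_self_and]
    exact fun _ => ⟨Y.R (Y.cell x) - 1, Nat.sub_add_cancel (Y.R_pos _)⟩
  conv_lhs => rw [h1]
  rw [measure_iUnion _ fun l => (Y.measurable_ret hs).inter (hl l)]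
  · refine tsum_congr fun l => ?_
    congr 1
    ext x
    constructor
    · rintro ⟨hx, h⟩
      have h' : l + 1 = Y.R (Y.cell x) := h
      have hlt : l < Y.R (Y.cell x) := by omega
      refine ⟨hlt, ?_⟩
      rw [mem_preimage, F_of_eq (p := ⟨(x, l), hlt⟩) h']
      exact ⟨hx, rfl⟩
    · rintro ⟨h, hx⟩
      rcases lt_or_eq (⟨(x, l), h⟩ : Y.Tower) with h' | h'
      · rw [mem_preimage, F_of_lt h'] at hx
        exact absurd hx.2 (Nat.succ_ne_zero _)
      · rw [mem_preimage, F_of_eq h'] at hx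
        exact ⟨hx.1, h'⟩
  · intro l l' hne
    refine disjoint_left.2 fun p hp hp' => hne ?_
    have h1 : l + 1 = _ := hp.2
    have h2 : l' + 1 = _ := hp'.2
    omega

omit [IsProbabilityMeasure ν] in
theorem baseMeasure_absolutelyContinuous (hν : ν ≪ Y.mbar) : Y.baseMeasure ν ≪ Y.m := by
  refine Measure.AbsolutelyContinuous.mk fun s hs h0 => ?_
  rw [Y.baseMeasure_apply hs]
  exact measure_mono_null (fun p hp => hp.1)
    (hν (Y.quasiMeasurePreserving_base.preimage_null h0))

theorem baseMeasure_univ_ne_zero (hinv : MeasurePreserving Y.F ν ν) :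
    Y.baseMeasure ν univ ≠ 0 := by
  intro h
  have h1 := Y.measure_eq_tsum hinv MeasurableSet.univ
  have h2 : ∀ l, Y.baseMeasure ν (Y.sliceSet univ l) = 0 := fun l =>
    measure_mono_null (subset_univ _) h
  simp [h2] at h1

variable [StandardBorelSpace Λ]

/-- An absolutely continuous invariant measure is comparable to the reference measure. -/
theorem exists_measure_bounds (hν : ν ≪ Y.mbar) (hinv : MeasurePreserving Y.F ν ν) :
    ∃ a b : ℝ≥0∞, a ≠ ∞ ∧ b ≠ ∞ ∧ ∀ A, MeasurableSet A → ν A ≤ a * Y.mbar A ∧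
      Y.mbar A ≤ b * ν A := by
  have hac := Y.baseMeasure_absolutelyContinuous hν
  have hret := Y.measurePreserving_ret hinv
  set K := ENNReal.ofReal Y.distortionBound
  have hK : K ≠ ∞ := ENNReal.ofReal_ne_top
  have hm0 : Y.m univ ≠ 0 := by simpa using Y.m_ne_zero
  have hmt : Y.m univ ≠ ∞ := measure_ne_top _ _
  have hμ0 := Y.baseMeasure_univ_ne_zero hinv
  have hμt : Y.baseMeasure ν univ ≠ ∞ := measure_ne_top _ _
  refine ⟨K * Y.baseMeasure ν univ / Y.m univ, K * Y.m univ / Y.baseMeasure ν univ,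
    ENNReal.div_ne_top (ENNReal.mul_ne_top hK hμt) hm0,
    ENNReal.div_ne_top (ENNReal.mul_ne_top hK hmt) hμ0, fun A hA => ?_⟩
  rw [Y.measure_eq_tsum hinv hA, Y.mbar_apply hA, ← ENNReal.tsum_mul_left, ← ENNReal.tsum_mul_left]
  constructor <;> refine ENNReal.tsum_le_tsum fun l => ?_
  · have := (Y.invariant_measure_bounds hac hret (Y.measurableSet_sliceSet hA l)).1
    rw [ENNReal.div_eq_inv_mul, mul_assoc, ← ENNReal.div_eq_inv_mul, ENNReal.le_div_iff_mul_le
      (Or.inl hm0) (Or.inl hmt), mul_comm]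
    exact this
  · have := (Y.invariant_measure_bounds hac hret (Y.measurableSet_sliceSet hA l)).2
    rw [ENNReal.div_eq_inv_mul, mul_assoc, ← ENNReal.div_eq_inv_mul, ENNReal.le_div_iff_mul_le
      (Or.inl hμ0) (Or.inl hμt)]
    exact this

/-- Follows from the lower bound on the invariant density. From here on, null sets of the two
measures are interchanged freely. -/
theorem mbar_absolutelyContinuous (hν : ν ≪ Y.mbar) (hinv : MeasurePreserving Y.F ν ν) :
    Y.mbar ≪ ν := by
  obtain ⟨a, b, -, -, h⟩ := Y.exists_measure_bounds hν hinv
  refine Measure.AbsolutelyContinuous.mk fun s hs h0 => ?_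
  simpa [h0] using (h s hs).2

theorem ae_iff_ae_mbar (hν : ν ≪ Y.mbar) (hinv : MeasurePreserving Y.F ν ν)
    {Q : Y.Tower → Prop} : (∀ᵐ p ∂ν, Q p) ↔ ∀ᵐ p ∂Y.mbar, Q p :=
  ⟨fun h => (Y.mbar_absolutelyContinuous hν hinv).ae_le h, fun h => hν.ae_le h⟩

theorem rnDeriv_pos (hν : ν ≪ Y.mbar) (hinv : MeasurePreserving Y.F ν ν) :
    ∀ᵐ p ∂Y.mbar, 0 < ν.rnDeriv Y.mbar p := by
  have := Y.isFiniteMeasure_mbar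
  exact Measure.rnDeriv_pos' (Y.mbar_absolutelyContinuous hν hinv)

theorem exists_rnDeriv_le (hν : ν ≪ Y.mbar) (hinv : MeasurePreserving Y.F ν ν) :
    ∃ a : ℝ≥0∞, a ≠ ∞ ∧ ∀ᵐ p ∂Y.mbar, ν.rnDeriv Y.mbar p ≤ a := by
  have := Y.isFiniteMeasure_mbar
  obtain ⟨a, b, ha, -, h⟩ := Y.exists_measure_bounds hν hinv
  refine ⟨a, ha, ae_le_of_forall_setLIntegral_le_of_sigmaFinite
    (Measure.measurable_rnDeriv _ _) fun s hs _ => ?_⟩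
  rw [Measure.setLIntegral_rnDeriv hν, setLIntegral_const]
  exact (h s hs).1

/-- The density of an invariant measure is a fixed point of the Perron-Frobenius operator. -/
theorem ltransfer_rnDeriv (hν : ν ≪ Y.mbar) (hinv : MeasurePreserving Y.F ν ν) :
    Y.ltransfer (ν.rnDeriv Y.mbar) =ᵐ[Y.mbar] ν.rnDeriv Y.mbar := by
  have := Y.isFiniteMeasure_mbar
  have hm : Measurable (ν.rnDeriv Y.mbar) := Measure.measurable_rnDeriv _ _
  refine ae_eq_of_forall_setLIntegral_eq_of_sigmaFinite (Y.measurable_ltransfer hm) hm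
    fun s hs _ => ?_
  have h1 : ∀ x, s.indicator (Y.ltransfer (ν.rnDeriv Y.mbar)) x =
      Y.ltransfer ((Y.F ⁻¹' s).indicator (ν.rnDeriv Y.mbar)) x := by
    intro x
    by_cases hx : x ∈ s
    · rw [indicator_of_mem hx]
      refine tsum_congr fun y => ?_
      rw [indicator_of_mem (by rw [mem_preimage, y.2]; exact hx)]
    · rw [indicator_of_notMem hx, eq_comm, ltransfer, ENNReal.tsum_eq_zero]
      intro y
      rw [indicator_of_notMem (by rw [mem_preimage, y.2]; exact hx), ENNReal.zero_div]
  rw [← lintegral_indicator hs, lintegral_congr h1,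
    Y.lintegral_ltransfer (hm.indicator (Y.measurable_F hs)),
    lintegral_indicator (Y.measurable_F hs), Measure.setLIntegral_rnDeriv hν,
    Measure.setLIntegral_rnDeriv hν, hinv.measure_preimage hs.nullMeasurableSet]

end QuotientTower
end

/-! ### The cohomological equation on the circle: regularity, closedness, real logarithms -/

noncomputable section

section Circle

theorem circle_dist_eq (a b : Circle) : dist a b = ‖(a : ℂ) - b‖ := by
  rw [← dist_eq_norm]; rfl

theorem circle_dist_mul_left (a b c : Circle) : dist (a * b) (a * c) = dist b c := by
  rw [circle_dist_eq, circle_dist_eq, Circle.coe_mul, Circle.coe_mul, ← mul_sub, norm_mul,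
    Circle.norm_coe, one_mul]

theorem circle_dist_mul_right (a b c : Circle) : dist (b * a) (c * a) = dist b c := by
  rw [mul_comm b, mul_comm c, circle_dist_mul_left]

theorem circle_dist_mul_le (a b c d : Circle) : dist (a * b) (c * d) ≤ dist a c + dist b d :=
  (dist_triangle _ (c * b) _).trans (by rw [circle_dist_mul_right, circle_dist_mul_left])

theorem circle_dist_exp_le (x y : ℝ) : dist (Circle.exp x) (Circle.exp y) ≤ |x - y| := by
  have h := circle_dist_mul_right (Circle.exp y) (Circle.exp (x - y)) 1
  rw [← Circle.exp_add, sub_add_cancel, one_mul] at h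
  rw [h, circle_dist_eq, Circle.coe_exp, Circle.coe_one, mul_comm]
  exact Real.norm_exp_I_mul_ofReal_sub_one_le

theorem circle_dist_le_arg (a b : Circle) :
    dist a b ≤ |Complex.arg a - Complex.arg b| := by
  conv_lhs => rw [← Circle.exp_arg a, ← Circle.exp_arg b]
  exact circle_dist_exp_le _ _

/-- The argument of the square of a point near `1`. -/
theorem circle_arg_sq {z : Circle} (hz : dist z 1 ≤ 1) :
    Complex.arg ((z ^ 2 : Circle) : ℂ) = 2 * Complex.arg z := by
  -- Positive real part means an argument below `π / 2` in modulus, so doubling does not wrap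
  -- around.
  have hre : 0 < (z : ℂ).re := by
    have h1 : ‖(z : ℂ) - 1‖ ≤ 1 := by simpa [circle_dist_eq] using hz
    have h2 := Circle.normSq_coe z
    have h3 : Complex.normSq ((z : ℂ) - 1) ≤ 1 := by
      rw [Complex.normSq_eq_norm_sq]
      exact pow_le_one₀ (norm_nonneg _) h1
    rw [Complex.normSq_apply] at h2 h3
    simp only [Complex.sub_re, Complex.sub_im, Complex.one_re, Complex.one_im] at h3
    nlinarith
  have harg := abs_lt.1 (Complex.abs_arg_lt_pi_div_two_iff.2 (Or.inl hre))
  have h1 : z ^ 2 = Circle.exp (2 * Complex.arg z) := by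
    rw [two_mul, Circle.exp_add, Circle.exp_arg, sq]
  rw [h1, Circle.arg_exp (by linarith) (by linarith)]

end Circle

namespace QuotientTower

open TowerData

variable {Λ ι : Type*} [MeasurableSpace Λ] (Y : QuotientTower Λ ι)
  {E : Type*} [NormedAddCommGroup E] [InnerProductSpace ℝ E]

variable {Y} in
/-- Solutions of the cohomological equation vary along orbits like the Birkhoff sums. -/
theorem dist_iterate_le {f : Y.Tower → E} {u : Y.Tower → Circle} {t : E} {z : Circle}
    {a b : Y.Tower} {k : ℕ}
    (ha : ∀ j < k, Circle.exp (inner ℝ t (f (Y.F^[j] a))) * u (Y.F^[j] a) =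
      z * u (Y.F (Y.F^[j] a)))
    (hb : ∀ j < k, Circle.exp (inner ℝ t (f (Y.F^[j] b))) * u (Y.F^[j] b) =
      z * u (Y.F (Y.F^[j] b))) :
    dist (u (Y.F^[k] a)) (u (Y.F^[k] b)) ≤
      ∑ j ∈ Finset.range k, ‖t‖ * ‖f (Y.F^[j] a) - f (Y.F^[j] b)‖ + dist (u a) (u b) := by
  induction k with
  | zero => simp
  | succ k ih =>
    have h := ih (fun j hj => ha j (by omega)) fun j hj => hb j (by omega)
    rw [Function.iterate_succ_apply', Function.iterate_succ_apply', ← circle_dist_mul_left z,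
      ← ha k (by omega), ← hb k (by omega), Finset.sum_range_succ]
    refine (circle_dist_mul_le _ _ _ _).trans ?_
    have h1 : dist (Circle.exp (inner ℝ t (f (Y.F^[k] a))))
        (Circle.exp (inner ℝ t (f (Y.F^[k] b)))) ≤
        ‖t‖ * ‖f (Y.F^[k] a) - f (Y.F^[k] b)‖ := by
      refine (circle_dist_exp_le _ _).trans ?_
      rw [← inner_sub_right]
      exact abs_real_inner_le_norm _ _
    linarith

/-- `u` solves the cohomological equation for `exp (i ⟨t, f⟩)` and `z`. -/
def IsSolution (f : Y.Tower → E) (t : E) (z : Circle) (u : Y.Tower → Circle) : Prop :=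
  Measurable u ∧ ∀ᵐ p ∂Y.mbar, Circle.exp (inner ℝ t (f p)) * u p = z * u (Y.F p)

theorem IsSolution.div {f : Y.Tower → E} {s t : E} {z w : Circle} {u v : Y.Tower → Circle}
    (hu : Y.IsSolution f s z u) (hv : Y.IsSolution f t w v) :
    Y.IsSolution f (s - t) (z / w) fun p => u p / v p := by
  refine ⟨hu.1.div hv.1, ?_⟩
  filter_upwards [hu.2, hv.2] with p h1 h2
  rw [inner_sub_left, Circle.exp_sub, div_mul_div_comm, h1, h2, div_mul_div_comm]

variable [Countable ι] [StandardBorelSpace Λ]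

/-- Measurable solutions of the cohomological equation are Lipschitz off a null set, with a
constant that is uniform in the frequency. -/
theorem exists_lipschitz_solution {f : Y.Tower → E} (hf : Y.BoundedLipschitz f) :
    ∃ C : ℝ, 0 ≤ C ∧ ∀ {t : E} {z : Circle} {u : Y.Tower → Circle}, Y.IsSolution f t z u →
      ∃ S : Set Y.Tower, (∀ᵐ p ∂Y.mbar, p ∈ S) ∧ ∀ p ∈ S, ∀ q ∈ S,
        Y.AgreeBefore (level p) (Y.bottom (base p)) (Y.bottom (base q)) → level p = level q →
        dist (u p) (u q) ≤ C * ‖t‖ * Y.sepDist Y.β p q := by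
  obtain ⟨-, C, hC⟩ := hf
  have hβ := Y.β_pos
  have hβ1 := Y.β_lt_one
  have hβ2 : 0 ≤ (1 - Y.β)⁻¹ := inv_nonneg.2 (by linarith)
  refine ⟨|C| * (1 - Y.β)⁻¹, by positivity, fun {t z u} hu => ?_⟩
  obtain ⟨hum, hu⟩ := hu
  -- No regularity of `u` is assumed: the bounded measurable function `θ` becomes almost constant
  -- along suitable inverse branches. So `u` hardly differs at the remote preimages `a`, `b` of `p`,
  -- `q`, and the whole difference at `p`, `q` stems from the Birkhoff sums of `f`.
  let θ : Λ → ℝ := fun x => Complex.arg (u (Y.bottom x))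
  have hθm : Measurable θ :=
    Complex.measurable_arg.comp (measurable_circle_coe.comp (hum.comp Y.measurable_bottom))
  have hθ : Integrable θ Y.m := by
    refine Integrable.of_bound hθm.aestronglyMeasurable Real.pi (Eventually.of_forall fun x => ?_)
    exact Complex.abs_arg_le_pi _
  obtain ⟨w, c, hw⟩ := Y.exists_wordBranch_tendsto hθ hθm
  -- The equation is required along all backward orbits, because the comparison starts from
  -- preimages of unbounded order.
  refine ⟨{p | (∀ n y, Y.F^[n] y = p → Circle.exp (inner ℝ t (f y)) * u y = z * u (Y.F y)) ∧
    Tendsto (fun k => θ (Y.wordBranch (w k) (base p)) - c k) atTop (𝓝 0)}, ?_, ?_⟩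
  · filter_upwards [Y.ae_forall_iterate_preimage hu, Y.quasiMeasurePreserving_base.ae hw]
      with p h1 h2 using ⟨h1, h2⟩
  rintro p ⟨hp1, hp2⟩ q ⟨hq1, hq2⟩ hpq hlev
  have hlim := (((hp2.sub hq2).abs).const_add (|C| * (1 - Y.β)⁻¹ * ‖t‖ * Y.sepDist Y.β p q))
  rw [sub_zero, abs_zero, add_zero] at hlim
  refine ge_of_tendsto' hlim fun k => ?_
  rw [sub_sub_sub_cancel_right]
  obtain ⟨K, -, h1, h2, h3⟩ := Y.exists_agreeBefore_of_code_eq (w k).length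
    (x := Y.wordBranch (w k) (base p)) (y := Y.wordBranch (w k) (base q)) (by simp)
  rw [ret_iterate_wordBranch] at h1 h2
  set a := Y.bottom (Y.wordBranch (w k) (base p)) with ha
  set b := Y.bottom (Y.wordBranch (w k) (base q)) with hb
  have hap : Y.F^[K + level p] a = p := by
    rw [add_comm, Function.iterate_add_apply, h1, iterate_F_bottom_base]
  have hbq : Y.F^[K + level p] b = q := by
    rw [add_comm, Function.iterate_add_apply, h2, hlev, iterate_F_bottom_base]
  have hagree : Y.AgreeBefore (K + level p) a b := h3.add (by rw [h1, h2]; exact hpq)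
  have h4 := dist_iterate_le (f := f) (u := u) (t := t) (z := z) (a := a) (b := b)
    (k := K + level p)
    (fun j hj => hp1 (K + level p - j) _ (by
      rw [← Function.iterate_add_apply, Nat.sub_add_cancel hj.le, hap]))
    (fun j hj => hq1 (K + level p - j) _ (by
      rw [← Function.iterate_add_apply, Nat.sub_add_cancel hj.le, hbq]))
  rw [hap, hbq] at h4
  have h5 := hagree.sum_sepDist_le hβ hβ1
  rw [hap, hbq] at h5
  have h6 : ∑ j ∈ Finset.range (K + level p), ‖t‖ * ‖f (Y.F^[j] a) - f (Y.F^[j] b)‖ ≤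
      |C| * (1 - Y.β)⁻¹ * ‖t‖ * Y.sepDist Y.β p q :=
    calc _ ≤ ∑ j ∈ Finset.range (K + level p),
          ‖t‖ * (|C| * Y.sepDist Y.β (Y.F^[j] a) (Y.F^[j] b)) := by
          refine Finset.sum_le_sum fun j _ => mul_le_mul_of_nonneg_left ?_ (norm_nonneg _)
          exact (hC _ _).trans (mul_le_mul_of_nonneg_right (le_abs_self C)
            (sepDist_nonneg hβ.le _ _))
      _ = ‖t‖ * |C| * ∑ j ∈ Finset.range (K + level p),
          Y.sepDist Y.β (Y.F^[j] a) (Y.F^[j] b) := by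
          rw [Finset.mul_sum]; exact Finset.sum_congr rfl fun j _ => by ring
      _ ≤ ‖t‖ * |C| * ((1 - Y.β)⁻¹ * Y.sepDist Y.β p q) := by gcongr
      _ = _ := by ring
  have h7 : dist (u a) (u b) ≤ |θ (Y.wordBranch (w k) (base p)) -
      θ (Y.wordBranch (w k) (base q))| := circle_dist_le_arg _ _
  linarith

/-- On the base, solutions of the cohomological equation vary little if the frequency is small. -/
theorem exists_base_solution_bound {f : Y.Tower → E} (hf : Y.BoundedLipschitz f) :
    ∃ C : ℝ, 0 ≤ C ∧ ∀ {t : E} {z : Circle} {u : Y.Tower → Circle}, Y.IsSolution f t z u →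
      ∃ S : Set Λ, (∀ᵐ x ∂Y.m, x ∈ S) ∧ ∀ x ∈ S, ∀ y ∈ S,
        dist (u (Y.bottom x)) (u (Y.bottom y)) ≤ C * ‖t‖ := by
  obtain ⟨C, hC, h⟩ := Y.exists_lipschitz_solution hf
  refine ⟨C, hC, fun {t z u} hu => ?_⟩
  obtain ⟨S, hS, hlip⟩ := h hu
  refine ⟨Y.bottom ⁻¹' S, Y.quasiMeasurePreserving_bottom.ae hS, fun x hx y hy => ?_⟩
  refine (hlip _ hx _ hy (AgreeBefore.zero _ _) rfl).trans ?_
  exact mul_le_of_le_one_right (by positivity)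
    (sepDist_le_one Y.β_pos.le Y.β_lt_one.le _ _)

/-- A property that holds on the base and is preserved by the tower map holds everywhere. -/
theorem ae_of_base {Q : Y.Tower → Prop} (hbase : ∀ᵐ x ∂Y.m, Q (Y.bottom x))
    (hstep : ∀ᵐ p ∂Y.mbar, Q p → Q (Y.F p)) : ∀ᵐ p ∂Y.mbar, Q p := by
  filter_upwards [Y.ae_forall_iterate_preimage hstep, Y.quasiMeasurePreserving_base.ae hbase]
    with p h1 h2
  have key : ∀ j ≤ level p, Q (Y.F^[j] (Y.bottom (base p))) := by
    intro j hj
    induction j with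
    | zero => exact h2
    | succ j ih =>
      rw [Function.iterate_succ_apply']
      refine h1 (level p - j) _ ?_ (ih (by omega))
      rw [← Function.iterate_add_apply, Nat.sub_add_cancel (by omega), iterate_F_bottom_base]
  simpa [iterate_F_bottom_base] using key (level p) le_rfl

omit [Countable ι] [StandardBorelSpace Λ] in
theorem exists_of_ae_base {Q : Λ → Prop} (h : ∀ᵐ x ∂Y.m, Q x) : ∃ x, Q x := by
  have : NeZero Y.m := ⟨Y.m_ne_zero⟩
  exact h.exists

section

variable {ν : Measure Y.Tower} [IsProbabilityMeasure ν]

theorem isCircleCohomologous_iff (hν : ν ≪ Y.mbar) (hinv : MeasurePreserving Y.F ν ν)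
    {f : Y.Tower → E} {t : E} {z : Circle} :
    IsCircleCohomologous Y.F ν f t z ↔ ∃ u, Y.IsSolution f t z u :=
  exists_congr fun _ => and_congr_right fun _ => Y.ae_iff_ae_mbar hν hinv

/-- The iterates of the tower map are nonsingular. -/
theorem ae_forall_iterate (hν : ν ≪ Y.mbar) (hinv : MeasurePreserving Y.F ν ν)
    {Q : Y.Tower → Prop} (hQ : ∀ᵐ p ∂Y.mbar, Q p) : ∀ᵐ p ∂Y.mbar, ∀ n, Q (Y.F^[n] p) := by
  rw [← Y.ae_iff_ae_mbar hν hinv] at hQ ⊢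
  exact ae_all_iff.2 fun n => (hinv.iterate n).quasiMeasurePreserving.ae hQ

/-- The tower map has no eigenvalues on the circle besides `1`. -/
theorem eq_one_of_isCircleCohomologous_zero (hν : ν ≪ Y.mbar)
    (hergodic : ∀ n : ℕ, 1 ≤ n → Ergodic (Y.F^[n]) ν) {f : Y.Tower → E}
    (hf : Y.BoundedLipschitz f) {z : Circle} (h : IsCircleCohomologous Y.F ν f 0 z) : z = 1 := by
  have hinv : MeasurePreserving Y.F ν ν := (hergodic 1 le_rfl).toMeasurePreserving
  obtain ⟨u, hu⟩ := (Y.isCircleCohomologous_iff hν hinv).1 h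
  obtain ⟨C, -, hC⟩ := Y.exists_base_solution_bound hf
  obtain ⟨S, hS, hconst⟩ := hC hu
  have hit : ∀ᵐ p ∂Y.mbar, ∀ n, u p = z ^ n * u (Y.F^[n] p) := by
    filter_upwards [Y.ae_forall_iterate hν hinv hu.2] with p hp n
    induction n with
    | zero => simp
    | succ n ih =>
      have := hp n
      rw [inner_zero_left, Circle.exp_zero, one_mul] at this
      rw [ih, Function.iterate_succ_apply', this, pow_succ, mul_assoc]
  have hS' : ∀ᵐ p ∂Y.mbar, base p ∈ S := Y.quasiMeasurePreserving_base.ae hS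
  obtain ⟨x, hx1, hx2⟩ := Y.exists_of_ae_base (Y.quasiMeasurePreserving_bottom.ae
    (hit.and (Y.ae_forall_iterate hν hinv hS')))
  set n := Y.R (Y.cell x) with hn
  -- For frequency zero the Lipschitz constant is zero, so `u` is constant on the base; one return
  -- then gives `z ^ R = 1`, and `u` is invariant under `F^R`, which is ergodic.
  have hzn : z ^ n = 1 := by
    have h1 := hconst x (hx2 0) (Y.ret x) (by
      have h := hx2 n
      rw [hn, iterate_R_F_bottom] at h
      exact h)
    rw [norm_zero, mul_zero] at h1
    have h2 := hx1 n
    rw [hn, iterate_R_F_bottom, dist_le_zero.1 h1, ← hn] at h2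
    exact (mul_eq_right.1 h2.symm)
  have hν' := (Y.ae_iff_ae_mbar hν hinv).2 hit
  obtain ⟨c, hc⟩ := (hergodic n (Y.R_pos _)).ae_eq_const_of_ae_eq_comp₀
    hu.1.nullMeasurable (by
      filter_upwards [hν'] with p hp
      have := hp n
      rw [hzn, one_mul] at this
      exact this.symm)
  have hc' := hinv.quasiMeasurePreserving.ae hc
  obtain ⟨p, hp1, hp2, hp3⟩ := (hν'.and (hc.and hc')).exists
  have h1 := hp1 1
  rw [pow_one, Function.iterate_one, hp3, hp2] at h1
  exact mul_eq_right.1 h1.symm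

/-- The cohomology relation on the circle is closed in the frequency and the eigenvalue. -/
theorem isClosed_isCircleCohomologous (hν : ν ≪ Y.mbar) (hinv : MeasurePreserving Y.F ν ν)
    {f : Y.Tower → E} (hf : Y.BoundedLipschitz f) :
    IsClosed {p : E × Circle | IsCircleCohomologous Y.F ν f p.1 p.2} := by
  refine IsSeqClosed.isClosed ?_
  rintro s ⟨t, z⟩ hs hlim
  have ht : Tendsto (fun k => (s k).1) atTop (𝓝 t) := (continuous_fst.tendsto _).comp hlim
  have hz : Tendsto (fun k => (s k).2) atTop (𝓝 z) := (continuous_snd.tendsto _).comp hlim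
  choose u hu using fun k => (Y.isCircleCohomologous_iff hν hinv).1 (hs k)
  obtain ⟨C, hC0, hC⟩ := Y.exists_base_solution_bound hf
  -- Quotients of solutions solve the equation for the difference of the frequencies, so they
  -- oscillate by at most `C ‖t_k - t_l‖` on the base. Normalizing at `x₀` makes the solutions a
  -- Cauchy sequence there.
  choose S hS hdist using fun k l => hC ((hu k).div Y (hu l))
  have hS' : ∀ᵐ x ∂Y.m, ∀ k l, x ∈ S k l := ae_all_iff.2 fun k => ae_all_iff.2 fun l => hS k l
  obtain ⟨x₀, hx₀⟩ := Y.exists_of_ae_base hS'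
  let U : ℕ → Y.Tower → Circle := fun k p => u k p / u k (Y.bottom x₀)
  have hUeq : ∀ᵐ p ∂Y.mbar, ∀ k,
      Circle.exp (inner ℝ (s k).1 (f p)) * U k p = (s k).2 * U k (Y.F p) := by
    refine ae_all_iff.2 fun k => ?_
    filter_upwards [(hu k).2] with p hp
    simp only [U]
    rw [← mul_div_assoc, hp, mul_div_assoc]
  have hcauchy : ∀ᵐ x ∂Y.m, ∃ l, Tendsto (fun k => U k (Y.bottom x)) atTop (𝓝 l) := by
    filter_upwards [hS'] with x hx
    refine cauchySeq_tendsto_of_complete ?_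
    have hb : ∀ k l, dist (U k (Y.bottom x)) (U l (Y.bottom x)) ≤
        C * dist (s k).1 (s l).1 := by
      intro k l
      have h1 := hdist k l x (hx k l) x₀ (hx₀ k l)
      rw [dist_eq_norm]
      refine le_trans (le_of_eq ?_) h1
      have h2 : ∀ a b c d : Circle, dist (a / c) (b / d) = dist (a / b) (c / d) := by
        intro a b c d
        rw [← circle_dist_mul_right (c / b) (a / c) (b / d), div_mul_div_cancel,
          div_mul_div_comm, mul_comm b c, mul_div_mul_right_eq_div]
      exact h2 _ _ _ _
    have ht' : CauchySeq fun k => (s k).1 := ht.cauchySeq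
    rw [Metric.cauchySeq_iff] at ht'
    refine Metric.cauchySeq_iff.2 fun ε hε => ?_
    obtain ⟨N, hN⟩ := ht' (ε / (C + 1)) (by positivity)
    refine ⟨N, fun k hk l hl => (hb k l).trans_lt ?_⟩
    have h1 := hN k hk l hl
    rw [lt_div_iff₀ (by positivity)] at h1
    nlinarith [dist_nonneg (x := (s k).1) (y := (s l).1)]
  -- The equation itself carries convergence from the base up the tower.
  have hconv : ∀ᵐ p ∂Y.mbar, ∃ l, Tendsto (fun k => U k p) atTop (𝓝 l) := by
    refine Y.ae_of_base hcauchy ?_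
    filter_upwards [hUeq] with p hp
    rintro ⟨l, hl⟩
    have h1 : ∀ k, U k (Y.F p) =
        (s k).2⁻¹ * (Circle.exp (inner ℝ (s k).1 (f p)) * U k p) := fun k => by
      rw [hp k, inv_mul_cancel_left]
    simp_rw [h1]
    have h2 : Tendsto (fun k => Circle.exp (inner ℝ (s k).1 (f p))) atTop
        (𝓝 (Circle.exp (inner ℝ t (f p)))) :=
      (Circle.exp.continuous.tendsto _).comp (ht.inner tendsto_const_nhds)
    exact ⟨_, hz.inv.mul (h2.mul hl)⟩
  have hUm : ∀ k, Measurable (U k) := fun k => (hu k).1.div_const _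
  obtain ⟨V, hV, hVlim⟩ := measurable_limit_of_tendsto_metrizable_ae
    (fun k => (hUm k).aemeasurable) hconv
  refine (Y.isCircleCohomologous_iff hν hinv).2 ⟨V, hV, ?_⟩
  filter_upwards [Y.ae_forall_iterate hν hinv hVlim, hUeq] with p hp hpU
  have h0 := hp 0
  have h1 := hp 1
  rw [Function.iterate_zero, id] at h0
  rw [Function.iterate_one] at h1
  have h2 : Tendsto (fun k => (s k).2 * U k (Y.F p)) atTop
      (𝓝 (Circle.exp (inner ℝ t (f p)) * V p)) := by
    simp_rw [← hpU]
    exact ((Circle.exp.continuous.tendsto _).comp (ht.inner tendsto_const_nhds)).mul h0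
  exact tendsto_nhds_unique h2 (hz.mul h1)

/-- Points on the circle that are successive square roots near `1` are the exponentials of the
dyadic fractions of a real number. -/
theorem exists_eq_exp_div_two_pow {U : ℕ → Circle} (h1 : ∀ k, dist (U k) 1 ≤ 1)
    (h2 : ∀ k, U (k + 1) ^ 2 = U k) : ∃ a : ℝ, ∀ k, U k = Circle.exp (a / 2 ^ k) := by
  have harg : ∀ k, Complex.arg (U k) = Complex.arg (U 0) / 2 ^ k := by
    intro k
    induction k with
    | zero => simp
    | succ k ih =>
      have h := circle_arg_sq (h1 (k + 1))
      rw [h2 k, ih] at h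
      rw [pow_succ, ← div_div, h]
      ring
  exact ⟨Complex.arg (U 0), fun k => by rw [← harg k, Circle.exp_arg]⟩

/-- Once `|a| / 2 ^ k < π` the argument is exactly `a / 2 ^ k`, so the sequence is eventually
constant. Thus `a` is determined by `U`, and measurably so. -/
theorem tendsto_two_pow_mul_arg {U : ℕ → Circle} {a : ℝ}
    (ha : ∀ k, U k = Circle.exp (a / 2 ^ k)) :
    Tendsto (fun k => 2 ^ k * Complex.arg (U k)) atTop (𝓝 a) := by
  have h1 : Tendsto (fun k : ℕ => |a| * (1 / 2) ^ k) atTop (𝓝 0) := by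
    simpa using (tendsto_pow_atTop_nhds_zero_of_lt_one (r := (1 / 2 : ℝ)) (by norm_num)
      (by norm_num)).const_mul |a|
  refine tendsto_const_nhds.congr' ?_
  filter_upwards [(tendsto_order.1 h1).2 Real.pi Real.pi_pos] with k hk
  have h2 : |a / 2 ^ k| < Real.pi := by
    rw [abs_div, abs_of_pos (by positivity : (0 : ℝ) < 2 ^ k)]
    calc _ = |a| * (1 / 2) ^ k := by rw [div_pow, one_pow]; ring
      _ < _ := hk
  rw [ha k, Circle.arg_exp (abs_lt.1 h2).1 (abs_lt.1 h2).2.le]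
  field_simp

/-- Solutions of the cohomological equations for the dyadic fractions of `φ` that are compatible
on the base make `φ` a coboundary. -/
theorem exists_coboundary_of_dyadic (hν : ν ≪ Y.mbar) (hinv : MeasurePreserving Y.F ν ν)
    {φ : Y.Tower → ℝ} {U : ℕ → Y.Tower → Circle} (hUm : ∀ k, Measurable (U k))
    (hUF : ∀ᵐ p ∂Y.mbar, ∀ k : ℕ, U k (Y.F p) = Circle.exp (φ p / 2 ^ k) * U k p)
    (hbase : ∀ᵐ x ∂Y.m, ∀ k, dist (U k (Y.bottom x)) 1 ≤ 1 ∧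
      U (k + 1) (Y.bottom x) ^ 2 = U k (Y.bottom x)) :
    ∃ g : Y.Tower → ℝ, Measurable g ∧ ∀ᵐ p ∂ν, φ p = g (Y.F p) - g p := by
  have hstep : ∀ (p : Y.Tower) (a : ℝ),
      (∀ k : ℕ, U k (Y.F p) = Circle.exp (φ p / 2 ^ k) * U k p) →
      (∀ k, U k p = Circle.exp (a / 2 ^ k)) →
      ∀ k, U k (Y.F p) = Circle.exp ((φ p + a) / 2 ^ k) := by
    intro p a h1 h2 k
    rw [h1 k, h2 k, ← Circle.exp_add, add_div]
  -- Nearness to `1` is known only on the base; above it the real logarithm `a` is transported by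
  -- adding `φ`, without any smallness.
  have hall : ∀ᵐ p ∂Y.mbar, ∃ a : ℝ, ∀ k, U k p = Circle.exp (a / 2 ^ k) := by
    refine Y.ae_of_base ?_ ?_
    · filter_upwards [hbase] with x hx
      exact exists_eq_exp_div_two_pow (fun k => (hx k).1) fun k => (hx k).2
    · filter_upwards [hUF] with p hp
      rintro ⟨a, ha⟩
      exact ⟨_, hstep p a hp ha⟩
  have hm : ∀ k : ℕ, Measurable fun p => 2 ^ k * Complex.arg (U k p) := fun k =>
    (Complex.measurable_arg.comp (measurable_circle_coe.comp (hUm k))).const_mul _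
  obtain ⟨g, hg, hglim⟩ := measurable_limit_of_tendsto_metrizable_ae (μ := Y.mbar)
    (fun k => (hm k).aemeasurable) (by
      filter_upwards [hall] with p hp
      obtain ⟨a, ha⟩ := hp
      exact ⟨a, tendsto_two_pow_mul_arg ha⟩)
  refine ⟨g, hg, ?_⟩
  rw [Y.ae_iff_ae_mbar hν hinv]
  filter_upwards [hall, Y.ae_forall_iterate hν hinv hglim, hUF] with p hp hgp hpF
  obtain ⟨a, ha⟩ := hp
  have h0 := hgp 0
  have h1 := hgp 1
  rw [Function.iterate_zero, id] at h0
  rw [Function.iterate_one] at h1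
  have hga : g p = a := tendsto_nhds_unique h0 (tendsto_two_pow_mul_arg ha)
  have hgF : g (Y.F p) = φ p + a :=
    tendsto_nhds_unique h1 (tendsto_two_pow_mul_arg (hstep p a hpF ha))
  rw [hga, hgF, add_sub_cancel_right]

omit [Countable ι] [StandardBorelSpace Λ] [IsProbabilityMeasure ν] in
/-- Solutions for `φ` and for `φ / 2` are related by a constant. -/
theorem exists_sq_eq_const_mul (hergodic : Ergodic Y.F ν) {φ : Y.Tower → ℝ}
    {u w : Y.Tower → Circle} (hum : Measurable u) (hwm : Measurable w)
    (hu : ∀ᵐ p ∂ν, u (Y.F p) = Circle.exp (φ p) * u p)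
    (hw : ∀ᵐ p ∂ν, w (Y.F p) = Circle.exp (φ p / 2) * w p) :
    ∃ c : Circle, ∀ᵐ p ∂ν, w p ^ 2 = c * u p := by
  have hm : Measurable fun p => w p ^ 2 / u p := (hwm.pow_const 2).div hum
  have hexp : ∀ x : ℝ, Circle.exp (x / 2) ^ 2 = Circle.exp x := fun x => by
    rw [sq, ← Circle.exp_add, add_halves]
  have heq : (fun p => w p ^ 2 / u p) ∘ Y.F =ᵐ[ν] fun p => w p ^ 2 / u p := by
    filter_upwards [hu, hw] with p h1 h2
    rw [Function.comp_apply, h1, h2, mul_pow, hexp, mul_div_mul_left_eq_div]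
  obtain ⟨c, hc⟩ := hergodic.ae_eq_const_of_ae_eq_comp₀ hm.nullMeasurable heq
  refine ⟨c, ?_⟩
  filter_upwards [hc] with p hp
  exact div_eq_iff_eq_mul.1 hp

/-- A one-parameter group of coboundaries on the circle comes from a real coboundary. -/
theorem exists_real_coboundary (hν : ν ≪ Y.mbar) (hergodic : Ergodic Y.F ν)
    {f : Y.Tower → E} (hf : Y.BoundedLipschitz f) (v r : E)
    (h : ∀ s : ℝ, IsCircleCohomologous Y.F ν f (s • v) (Circle.exp (inner ℝ (s • v) r))) :
    ∃ g : Y.Tower → ℝ, Measurable g ∧ ∀ᵐ p ∂ν, inner ℝ v (f p - r) = g p - g (Y.F p) := by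
  have hinv : MeasurePreserving Y.F ν ν := hergodic.toMeasurePreserving
  obtain ⟨C, hC0, hC⟩ := Y.exists_base_solution_bound hf
  -- The scale is so small that normalized solutions for all frequencies `(s₀ / 2 ^ k) v` stay
  -- within distance `1` of `1` on the base.
  obtain ⟨s₀, hs₀, hs₀C⟩ : ∃ s₀ : ℝ, 0 < s₀ ∧ C * (s₀ * ‖v‖) ≤ 1 := by
    refine ⟨(C * ‖v‖ + 1)⁻¹, by positivity, ?_⟩
    rw [mul_left_comm, inv_mul_le_iff₀ (by positivity)]
    linarith
  choose u hu using fun k : ℕ =>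
    (Y.isCircleCohomologous_iff hν hinv).1 (h (s₀ / 2 ^ k))
  choose S hS hdist using fun k => hC (hu k)
  obtain ⟨φ, hφdef⟩ : ∃ φ : Y.Tower → ℝ, ∀ p, φ p = s₀ * inner ℝ v (f p - r) := ⟨_, fun _ => rfl⟩
  have hφ : ∀ k : ℕ, ∀ᵐ p ∂Y.mbar, u k (Y.F p) = Circle.exp (φ p / 2 ^ k) * u k p := by
    intro k
    filter_upwards [(hu k).2] with p hp
    have h1 : φ p / 2 ^ k =
        inner ℝ ((s₀ / 2 ^ k) • v) (f p) - inner ℝ ((s₀ / 2 ^ k) • v) r := by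
      rw [← inner_sub_right, real_inner_smul_left, hφdef]
      ring
    rw [h1, Circle.exp_sub, div_mul_eq_mul_div, hp, mul_div_assoc, mul_div_cancel]
  -- By ergodicity consecutive solutions are square roots up to a constant, and division by the
  -- values at `x₀` removes the constant.
  have hratio : ∀ k, ∃ c : Circle, ∀ᵐ p ∂ν, u (k + 1) p ^ 2 = c * u k p := fun k =>
    Y.exists_sq_eq_const_mul hergodic (φ := fun p => φ p / 2 ^ k) (hu k).1 (hu (k + 1)).1
      ((Y.ae_iff_ae_mbar hν hinv).2 (hφ k)) ((Y.ae_iff_ae_mbar hν hinv).2 (by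
        filter_upwards [hφ (k + 1)] with p hp
        rw [hp, pow_succ, div_div]))
  choose c hc using hratio
  have hgood : ∀ᵐ x ∂Y.m, ∀ k, x ∈ S k ∧ u (k + 1) (Y.bottom x) ^ 2 = c k * u k (Y.bottom x) :=
    ae_all_iff.2 fun k => (hS k).and
      (Y.quasiMeasurePreserving_bottom.ae ((Y.ae_iff_ae_mbar hν hinv).1 (hc k)))
  obtain ⟨x₀, hx₀⟩ := Y.exists_of_ae_base hgood
  obtain ⟨g, hg, hgφ⟩ := Y.exists_coboundary_of_dyadic hν hinv (φ := φ)
    (U := fun k p => u k p / u k (Y.bottom x₀)) (fun k => (hu k).1.div_const _) (by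
      refine ae_all_iff.2 fun k => ?_
      filter_upwards [hφ k] with p hp
      rw [hp, mul_div_assoc]) (by
      filter_upwards [hgood] with x hx k
      constructor
      · have h1 := hdist k x (hx k).1 x₀ (hx₀ k).1
        rw [← circle_dist_mul_right (u k (Y.bottom x₀)), div_mul_cancel, one_mul]
        refine h1.trans ?_
        have h3 : s₀ / 2 ^ k ≤ s₀ := div_le_self hs₀.le (one_le_pow₀ one_le_two)
        have h4 : 0 ≤ s₀ / 2 ^ k := by positivity
        rw [norm_smul, Real.norm_of_nonneg h4]
        refine le_trans ?_ hs₀C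
        gcongr
      · rw [div_pow, (hx k).2, (hx₀ k).2, mul_div_mul_left_eq_div])
  refine ⟨fun p => -(g p / s₀), (hg.div_const _).neg, ?_⟩
  filter_upwards [hgφ] with p hp
  rw [hφdef] at hp
  field_simp
  linarith

end

end QuotientTower
end

/-! ### Unimodular eigenvalues and solutions of the cohomological equation -/

noncomputable section

/-- The variance identity for weighted means of complex numbers. -/
theorem hasSum_mul_norm_sub_sq {κ : Type*} {w : κ → ℝ} {a : κ → ℂ} {W S : ℝ}
    (hw : ∀ y, 0 ≤ w y) (hW : HasSum w W) (hW0 : W ≠ 0)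
    (hS : HasSum (fun y => w y * ‖a y‖ ^ 2) S) {b : ℂ}
    (hb : (W : ℂ)⁻¹ * ∑' y, (w y : ℂ) * a y = b) :
    HasSum (fun y => w y * ‖a y - b‖ ^ 2) (S - W * ‖b‖ ^ 2) := by
  have hsum : Summable fun y => (w y : ℂ) * a y := by
    refine Summable.of_norm_bounded (hW.summable.add hS.summable) fun y => ?_
    rw [norm_mul, Complex.norm_real, Real.norm_of_nonneg (hw y)]
    nlinarith [hw y, mul_nonneg (hw y) (sq_nonneg (‖a y‖ - 1)), norm_nonneg (a y),
      mul_nonneg (hw y) (norm_nonneg (a y))]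
  have hWb : ∑' y, (w y : ℂ) * a y = W * b := by
    rw [← hb, mul_inv_cancel_left₀ (by exact_mod_cast hW0)]
  have h1 : HasSum (fun y => (w y : ℂ) * a y) (W * b) := hWb ▸ hsum.hasSum
  have h2 : HasSum (fun y => ((w y : ℂ) * a y * (starRingEnd ℂ) b).re)
      ((W * b * (starRingEnd ℂ) b).re) :=
    Complex.hasSum_re (h1.mul_right _)
  have h3 := (hS.sub (h2.mul_left 2)).add (hW.mul_right (‖b‖ ^ 2))
  have h4 : (W * b * (starRingEnd ℂ) b).re = W * ‖b‖ ^ 2 := by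
    rw [mul_assoc, Complex.mul_conj, Complex.normSq_eq_norm_sq, ← Complex.ofReal_mul,
      Complex.ofReal_re]
  rw [h4] at h3
  have h6 : (fun y => w y * ‖a y - b‖ ^ 2) = fun y => w y * ‖a y‖ ^ 2 -
      2 * ((w y : ℂ) * a y * (starRingEnd ℂ) b).re + w y * ‖b‖ ^ 2 := by
    funext y
    have h5 : ((w y : ℂ) * a y * (starRingEnd ℂ) b).re =
        w y * (a y * (starRingEnd ℂ) b).re := by
      rw [mul_assoc, Complex.re_ofReal_mul]
    rw [h5, ← Complex.normSq_eq_norm_sq, Complex.normSq_sub, Complex.normSq_eq_norm_sq,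
      Complex.normSq_eq_norm_sq]
    ring
  rw [h6, show S - W * ‖b‖ ^ 2 = S - 2 * (W * ‖b‖ ^ 2) + W * ‖b‖ ^ 2 by ring]
  exact h3

namespace QuotientTower

open TowerData

variable {Λ ι : Type*} [MeasurableSpace Λ] (Y : QuotientTower Λ ι)

theorem toReal_div_ofReal_JF (a : ℝ≥0∞) (y : Y.Tower) :
    (a / ENNReal.ofReal (Y.JF y)).toReal = a.toReal / Y.JF y := by
  rw [ENNReal.toReal_div, ENNReal.toReal_ofReal (Y.JF_pos y).le]

theorem density_div_JF_nonneg (ν : Measure Y.Tower) (y : Y.Tower) :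
    0 ≤ Y.density ν y / Y.JF y := div_nonneg ENNReal.toReal_nonneg (Y.JF_pos y).le

theorem hasSum_toReal_ltransfer {g : Y.Tower → ℝ≥0∞} {x : Y.Tower} (h : Y.ltransfer g x ≠ ∞) :
    HasSum (fun y : {y : Y.Tower // Y.F y = x} => (g y).toReal / Y.JF y)
      (Y.ltransfer g x).toReal := by
  have h1 := ENNReal.hasSum_toReal (f := fun y : {y : Y.Tower // Y.F y = x} =>
    g y / ENNReal.ofReal (Y.JF y)) h
  rw [← ENNReal.tsum_toReal_eq fun y => ENNReal.ne_top_of_tsum_ne_top h y] at h1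
  simp_rw [toReal_div_ofReal_JF] at h1
  exact h1

theorem fourierTransfer_eq {d : ℕ} (ν : Measure Y.Tower)
    (f : Y.Tower → EuclideanSpace ℝ (Fin d)) (t : EuclideanSpace ℝ (Fin d)) (φ : Y.Tower → ℂ)
    (x : Y.Tower) :
    Y.fourierTransfer ν f t φ x = (Y.density ν x : ℂ)⁻¹ * ∑' y : {y : Y.Tower // Y.F y = x},
      ((Y.density ν y / Y.JF y : ℝ) : ℂ) *
        (Complex.exp (Complex.I * (inner ℝ t (f y) : ℝ)) * φ y) := by
  unfold fourierTransfer transfer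
  congr 1
  refine tsum_congr fun y => ?_
  push_cast
  ring

theorem norm_exp_I_mul (x : ℝ) : ‖Complex.exp (Complex.I * x)‖ = 1 := by
  rw [mul_comm]; exact Complex.norm_exp_ofReal_mul_I x

variable [Countable ι]

theorem measurableSet_element (l j : ℕ) : MeasurableSet (Y.element l j) :=
  Y.measurableSet_setOf_level_cell fun l' i => l' = l ∧ Y.label l i = j

variable {Y} in
/-- Functions in `ℒ` grow at most like `e^{lε}` with the level. -/
theorem ae_enorm_le_of_normC {ε : ℝ} {φ : Y.Tower → ℂ} :
    ∀ᵐ p ∂Y.mbar, ‖φ p‖ₑ ≤ Y.normC ε φ * ENNReal.ofReal (Real.exp (level p * ε)) := by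
  have h : ∀ l j, ∀ᵐ p ∂Y.mbar, p ∈ Y.element l j →
      ‖φ p‖ₑ ≤ Y.normC ε φ * ENNReal.ofReal (Real.exp (l * ε)) := by
    intro l j
    rw [← ae_restrict_iff' (Y.measurableSet_element l j)]
    filter_upwards [ENNReal.ae_le_essSup (μ := Y.mbar.restrict (Y.element l j))
      fun p => ‖φ p‖ₑ] with p hp
    have h1 : essSup (fun p => ‖φ p‖ₑ) (Y.mbar.restrict (Y.element l j)) *
        ENNReal.ofReal (Real.exp (-(l * ε))) ≤ Y.normC ε φ :=
      le_iSup₂_of_le (f := fun (l j : ℕ) =>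
        essSup (fun p => ‖φ p‖ₑ) (Y.mbar.restrict (Y.element l j)) *
          ENNReal.ofReal (Real.exp (-(l * ε)))) l j le_rfl
    refine hp.trans ?_
    calc _ = essSup (fun p => ‖φ p‖ₑ) (Y.mbar.restrict (Y.element l j)) *
          ENNReal.ofReal (Real.exp (-(l * ε))) * ENNReal.ofReal (Real.exp (l * ε)) := by
          rw [mul_assoc, ← ENNReal.ofReal_mul (Real.exp_pos _).le, ← Real.exp_add, neg_add_cancel,
            Real.exp_zero, ENNReal.ofReal_one, mul_one]
      _ ≤ _ := by gcongr
  filter_upwards [ae_all_iff.2 fun l => ae_all_iff.2 (h l)] with p hp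
  exact hp (level p) _ ⟨rfl, rfl⟩

/-- The squared weight `e^{2lε}` on level `l` is beaten by the tail `C₀ θ₀ ^ l`. Together with the
bounded density this puts `ℒ` inside `L²(ν)`. -/
theorem lintegral_exp_level_ne_top {ε : ℝ} (hε : Real.exp (2 * ε) * Y.θ₀ < 1) :
    ∫⁻ p, ENNReal.ofReal (Real.exp (level p * ε)) ^ 2 ∂Y.mbar ≠ ∞ := by
  have hm : Measurable fun p : Y.Tower => ENNReal.ofReal (Real.exp (level p * ε)) ^ 2 :=
    (measurable_from_nat (f := fun l : ℕ => ENNReal.ofReal (Real.exp (l * ε)) ^ 2)).comp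
      Y.measurable_level
  rw [Y.lintegral_mbar hm]
  have hθ := Y.θ₀_pos
  have hC := Y.C₀_pos
  have h1 : ∀ l : ℕ, ∫⁻ x, Y.slice (fun p => ENNReal.ofReal (Real.exp (level p * ε)) ^ 2) l x ∂Y.m ≤
      ENNReal.ofReal (Y.C₀ * (Real.exp (2 * ε) * Y.θ₀) ^ l) := by
    intro l
    have h2 : Y.slice (fun p => ENNReal.ofReal (Real.exp (level p * ε)) ^ 2) l ≤
        {x | l ≤ Y.R (Y.cell x)}.indicator
          fun _ => ENNReal.ofReal (Real.exp (l * ε)) ^ 2 := by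
      intro x
      by_cases h : l < Y.R (Y.cell x)
      · rw [Y.slice_of_lt _ h, indicator_of_mem (show x ∈ {x | l ≤ Y.R (Y.cell x)} from h.le)]
        rfl
      · rw [Y.slice_of_not_lt _ h]; exact zero_le
    have h3 : ENNReal.ofReal (Real.exp (l * ε)) ^ 2 =
        ENNReal.ofReal (Real.exp (2 * ε) ^ l) := by
      rw [← ENNReal.ofReal_pow (Real.exp_pos _).le, ← Real.exp_nat_mul, ← Real.exp_nat_mul]
      congr 2; push_cast; ring
    refine (lintegral_mono h2).trans ((lintegral_indicator_const_le _ _).trans ?_)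
    rw [h3]
    refine (mul_le_mul_right (Y.tail l) _).trans ?_
    rw [← ENNReal.ofReal_mul (by positivity)]
    refine ENNReal.ofReal_le_ofReal (le_of_eq ?_)
    rw [mul_pow]; ring
  refine ((ENNReal.tsum_le_tsum h1).trans_lt ?_).ne
  rw [← ENNReal.ofReal_tsum_of_nonneg (fun n => by positivity)
    ((summable_geometric_of_lt_one (by positivity) hε).mul_left _)]
  exact ENNReal.ofReal_lt_top

variable [StandardBorelSpace Λ] {ν : Measure Y.Tower} [IsProbabilityMeasure ν]

theorem lintegral_enorm_sq_ne_top (hν : ν ≪ Y.mbar) (hinv : MeasurePreserving Y.F ν ν)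
    {ε : ℝ} (hε : Real.exp (2 * ε) * Y.θ₀ < 1) {φ : Y.Tower → ℂ} (hφ : Y.normC ε φ ≠ ∞) :
    ∫⁻ p, ‖φ p‖ₑ ^ 2 ∂ν ≠ ∞ := by
  have := Y.isFiniteMeasure_mbar
  obtain ⟨a, ha, hρ⟩ := Y.exists_rnDeriv_le hν hinv
  have hm : Measurable fun p : Y.Tower => ENNReal.ofReal (Real.exp (level p * ε)) ^ 2 :=
    (measurable_from_nat (f := fun l : ℕ => ENNReal.ofReal (Real.exp (l * ε)) ^ 2)).comp
      Y.measurable_level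
  have h1 : ∫⁻ p, ‖φ p‖ₑ ^ 2 ∂ν ≤
      ∫⁻ p, Y.normC ε φ ^ 2 * ENNReal.ofReal (Real.exp (level p * ε)) ^ 2 ∂ν := by
    refine lintegral_mono_ae (hν.ae_le ?_)
    filter_upwards [ae_enorm_le_of_normC (Y := Y) (ε := ε) (φ := φ)] with p hp
    rw [← mul_pow]
    gcongr
  refine (h1.trans_lt ?_).ne
  rw [lintegral_const_mul _ hm, ← lintegral_rnDeriv_mul hν hm.aemeasurable]
  refine ENNReal.mul_lt_top (ENNReal.pow_lt_top hφ.lt_top) ?_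
  refine lt_of_le_of_lt (b := ∫⁻ p, a * ENNReal.ofReal (Real.exp (level p * ε)) ^ 2 ∂Y.mbar) ?_ ?_
  · refine lintegral_mono_ae ?_
    filter_upwards [hρ] with p hp
    gcongr
  · rw [lintegral_const_mul _ hm]
    exact ENNReal.mul_lt_top ha.lt_top (Y.lintegral_exp_level_ne_top hε).lt_top

/-- The density of the invariant measure is a positive fixed point of the Perron-Frobenius
operator. -/
theorem ae_hasSum_density (hν : ν ≪ Y.mbar) (hinv : MeasurePreserving Y.F ν ν) :
    ∀ᵐ x ∂Y.mbar, 0 < Y.density ν x ∧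
      HasSum (fun y : {y : Y.Tower // Y.F y = x} => Y.density ν y / Y.JF y) (Y.density ν x) := by
  have := Y.isFiniteMeasure_mbar
  filter_upwards [Y.rnDeriv_pos hν hinv, Measure.rnDeriv_lt_top ν Y.mbar,
    Y.ltransfer_rnDeriv hν hinv] with x h1 h2 h3
  refine ⟨ENNReal.toReal_pos h1.ne' h2.ne, ?_⟩
  have h4 := Y.hasSum_toReal_ltransfer (g := ν.rnDeriv Y.mbar) (x := x) (by rw [h3]; exact h2.ne)
  rw [h3] at h4
  exact h4

/-- An eigenfunction of the weighted transfer operator for a unimodular eigenvalue solves the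
cohomological equation. -/
theorem ae_eq_of_fourierTransfer_eq {d : ℕ} (hν : ν ≪ Y.mbar) (hinv : MeasurePreserving Y.F ν ν)
    {f : Y.Tower → EuclideanSpace ℝ (Fin d)} {t : EuclideanSpace ℝ (Fin d)} {lam : ℂ}
    (hlam : ‖lam‖ = 1) {φ : Y.Tower → ℂ} (hφ : Measurable φ) (hφ2 : ∫⁻ p, ‖φ p‖ₑ ^ 2 ∂ν ≠ ∞)
    (heq : ∀ᵐ x ∂Y.mbar, Y.fourierTransfer ν f t φ x = lam * φ x) :
    ∀ᵐ p ∂ν, Complex.exp (Complex.I * (inner ℝ t (f p) : ℝ)) * φ p = lam * φ (Y.F p) := by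
  have := Y.isFiniteMeasure_mbar
  have hρm : Measurable (ν.rnDeriv Y.mbar) := Measure.measurable_rnDeriv _ _
  have hgm : Measurable fun p => ν.rnDeriv Y.mbar p * ‖φ p‖ₑ ^ 2 :=
    hρm.mul (hφ.enorm.pow_const 2)
  set g : Y.Tower → ℝ≥0∞ := fun p => ν.rnDeriv Y.mbar p * ‖φ p‖ₑ ^ 2 with hg
  have hint : ∫⁻ p, g p ∂Y.mbar ≠ ∞ := by
    rw [lintegral_rnDeriv_mul hν (hφ.enorm.pow_const 2).aemeasurable]
    exact hφ2
  have hgR : ∀ p, (g p).toReal = Y.density ν p * ‖φ p‖ ^ 2 := fun p => by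
    rw [hg]
    rw [ENNReal.toReal_mul, ENNReal.toReal_pow, toReal_enorm]
    rfl
  have hfin : ∀ᵐ x ∂Y.mbar, Y.ltransfer g x < ∞ :=
    ae_lt_top (Y.measurable_ltransfer hgm) (by rwa [Y.lintegral_ltransfer hgm])
  -- The left side is the weighted variance over the preimages of `x`, and the right side is `P g -
  -- g` for `g = ρ |φ|²`. This is nonnegative with zero integral, so it vanishes almost everywhere
  -- and with it every term of the sum.
  have hvar : ∀ᵐ x ∂Y.mbar, HasSum (fun y : {y : Y.Tower // Y.F y = x} =>
      Y.density ν y / Y.JF y *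
        ‖Complex.exp (Complex.I * (inner ℝ t (f y) : ℝ)) * φ y - lam * φ x‖ ^ 2)
      ((Y.ltransfer g x).toReal - (g x).toReal) := by
    filter_upwards [hfin, Y.ae_hasSum_density hν hinv, heq] with x h1 h2 h3
    have h4 := Y.hasSum_toReal_ltransfer h1.ne
    rw [fourierTransfer_eq] at h3
    have h5 := hasSum_mul_norm_sub_sq
      (a := fun y : {y : Y.Tower // Y.F y = x} =>
        Complex.exp (Complex.I * (inner ℝ t (f y) : ℝ)) * φ y)
      (S := (Y.ltransfer g x).toReal)
      (fun y => Y.density_div_JF_nonneg ν y) h2.2 h2.1.ne' (by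
        have h6 : (fun y : {y : Y.Tower // Y.F y = x} => Y.density ν y / Y.JF y *
            ‖Complex.exp (Complex.I * (inner ℝ t (f y) : ℝ)) * φ y‖ ^ 2) =
            fun y : {y : Y.Tower // Y.F y = x} => (g y).toReal / Y.JF y := by
          funext y
          rw [hgR, norm_mul, norm_exp_I_mul, one_mul, div_mul_eq_mul_div]
        rw [h6]
        exact h4) h3
    rwa [norm_mul, hlam, one_mul, ← hgR] at h5
  have hle : g ≤ᵐ[Y.mbar] Y.ltransfer g := by
    filter_upwards [hvar, hfin, Measure.rnDeriv_lt_top ν Y.mbar] with x h1 h2 h3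
    have h4 : 0 ≤ (Y.ltransfer g x).toReal - (g x).toReal :=
      h1.nonneg fun y : {y : Y.Tower // Y.F y = x} => mul_nonneg (Y.density_div_JF_nonneg ν y) (sq_nonneg _)
    have h5 : g x ≠ ∞ := ENNReal.mul_ne_top h3.ne (ENNReal.pow_ne_top enorm_ne_top)
    exact (ENNReal.toReal_le_toReal h5 h2.ne).1 (sub_nonneg.1 h4)
  have hge : g =ᵐ[Y.mbar] Y.ltransfer g :=
    ae_eq_of_ae_le_of_lintegral_le hle hint (Y.measurable_ltransfer hgm).aemeasurable
      (Y.lintegral_ltransfer hgm).le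
  have hall : ∀ᵐ x ∂Y.mbar, ∀ y, Y.F y = x →
      Complex.exp (Complex.I * (inner ℝ t (f y) : ℝ)) * φ y = lam * φ x := by
    filter_upwards [hvar, hge, Y.ae_forall_preimage (Y.ae_hasSum_density hν hinv)]
      with x h1 h2 h3 y hy
    rw [← h2, sub_self, hasSum_zero_iff_of_nonneg fun y : {y : Y.Tower // Y.F y = x} =>
      mul_nonneg (Y.density_div_JF_nonneg ν y) (sq_nonneg _)] at h1
    have h4 := congrFun h1 ⟨y, hy⟩
    have h5 : Y.density ν y / Y.JF y ≠ 0 := (div_pos (h3 y hy).1 (Y.JF_pos y)).ne'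
    exact sub_eq_zero.1 (norm_eq_zero.1 (pow_eq_zero_iff two_ne_zero |>.1
      ((mul_eq_zero.1 h4).resolve_left h5)))
  filter_upwards [hinv.quasiMeasurePreserving.ae (hν.ae_le hall)] with p hp
  exact hp p rfl

/-- Unimodular eigenvalues of the weighted transfer operator come from solutions of the
cohomological equation. -/
theorem isCircleCohomologous_of_isUnimodularEigenvalue {d : ℕ} (hν : ν ≪ Y.mbar)
    (hergodic : Ergodic Y.F ν) {f : Y.Tower → EuclideanSpace ℝ (Fin d)} {ε : ℝ}
    (hε : Real.exp (2 * ε) * Y.θ₀ < 1) {t : EuclideanSpace ℝ (Fin d)} {z : Circle}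
    (h : Y.IsUnimodularEigenvalue ν f ε t z) : IsCircleCohomologous Y.F ν f t z := by
  have hinv : MeasurePreserving Y.F ν ν := hergodic.toMeasurePreserving
  obtain ⟨hz, φ₀, ⟨hφ₀, hfin⟩, hne, heq₀⟩ := h
  obtain ⟨φ, hφ, hφφ⟩ := hφ₀
  have hφ2 : ∫⁻ p, ‖φ p‖ₑ ^ 2 ∂ν ≠ ∞ := by
    have h1 : ∫⁻ p, ‖φ p‖ₑ ^ 2 ∂ν = ∫⁻ p, ‖φ₀ p‖ₑ ^ 2 ∂ν :=
      lintegral_congr_ae ((hν.ae_eq hφφ).symm.fun_comp fun w => ‖w‖ₑ ^ 2)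
    rw [h1]
    exact Y.lintegral_enorm_sq_ne_top hν hinv hε (lt_of_le_of_lt le_self_add hfin).ne
  have heq : ∀ᵐ x ∂Y.mbar, Y.fourierTransfer ν f t φ x = z * φ x := by
    filter_upwards [heq₀, hφφ, Y.ae_forall_preimage hφφ] with x h1 h2 h3
    rw [← h2, ← h1, fourierTransfer_eq, fourierTransfer_eq]
    congr 1
    exact tsum_congr fun y => by rw [h3 y y.2]
  have hcoh := Y.ae_eq_of_fourierTransfer_eq hν hinv hz hφ hφ2 heq
  -- The equation makes `‖φ‖` invariant, hence a nonzero constant, and the phase of `φ` is then a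
  -- solution on the circle.
  obtain ⟨c, hc⟩ := hergodic.ae_eq_const_of_ae_eq_comp₀ (g := fun p => ‖φ p‖)
    hφ.norm.nullMeasurable (by
      filter_upwards [hcoh] with p hp
      have h1 := congrArg norm hp
      rw [norm_mul, norm_mul, norm_exp_I_mul, Circle.norm_coe, one_mul, one_mul] at h1
      exact h1.symm)
  have hc0 : c ≠ 0 := by
    rintro rfl
    refine hne ?_
    filter_upwards [hφφ, (Y.ae_iff_ae_mbar hν hinv).1 hc] with p h1 h2
    rw [h1]
    exact norm_eq_zero.1 h2
  refine ⟨fun p => Circle.exp (Complex.arg (φ p)),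
    Circle.exp.continuous.measurable.comp (Complex.measurable_arg.comp hφ), ?_⟩
  filter_upwards [hcoh, hc, hinv.quasiMeasurePreserving.ae hc] with p h1 h2 h3
  have h4 := Complex.norm_mul_exp_arg_mul_I (φ p)
  have h5 := Complex.norm_mul_exp_arg_mul_I (φ (Y.F p))
  simp only [Function.const_apply] at h2 h3
  rw [h2] at h4
  rw [h3] at h5
  refine Circle.ext (mul_left_cancel₀ (Complex.ofReal_ne_zero.2 hc0) ?_)
  rw [Circle.coe_mul, Circle.coe_mul, Circle.coe_exp, Circle.coe_exp, Circle.coe_exp,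
    mul_left_comm, h4, mul_left_comm, h5, mul_comm _ Complex.I, h1]

/-- Solutions of the cohomological equation are eigenfunctions in `ℒ` of the weighted transfer
operator. -/
theorem isUnimodularEigenvalue_of_isCircleCohomologous {d : ℕ} (hν : ν ≪ Y.mbar)
    (hinv : MeasurePreserving Y.F ν ν) {f : Y.Tower → EuclideanSpace ℝ (Fin d)}
    (hf : Y.BoundedLipschitz f) {ε : ℝ} (hε : 0 ≤ ε) {t : EuclideanSpace ℝ (Fin d)} {z : Circle}
    (h : IsCircleCohomologous Y.F ν f t z) : Y.IsUnimodularEigenvalue ν f ε t z := by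
  have := Y.isFiniteMeasure_mbar
  obtain ⟨u, hu⟩ := (Y.isCircleCohomologous_iff hν hinv).1 h
  obtain ⟨C, hC0, hC⟩ := Y.exists_lipschitz_solution hf
  obtain ⟨S, hS, hlip⟩ := hC hu
  have hexp : ∀ l : ℕ, ENNReal.ofReal (Real.exp (-(l * ε))) ≤ 1 := fun l => by
    rw [ENNReal.ofReal_le_one, Real.exp_le_one_iff]
    have : 0 ≤ l * ε := by positivity
    linarith
  refine ⟨Circle.norm_coe z, fun p => u p, ⟨(measurable_circle_coe.comp hu.1).aemeasurable, ?_⟩,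
    fun h0 => ?_, ?_⟩
  · refine ENNReal.add_lt_top.2 ⟨lt_of_le_of_lt (b := 1) ?_ ENNReal.one_lt_top,
      lt_of_le_of_lt (b := ENNReal.ofReal (C * ‖t‖)) ?_ ENNReal.ofReal_lt_top⟩
    · refine iSup₂_le fun l j => mul_le_one' (essSup_le_of_ae_le _ ?_) (hexp l)
      refine Eventually.of_forall fun p => ?_
      change ‖(u p : ℂ)‖ₑ ≤ 1
      rw [← ofReal_norm, Circle.norm_coe, ENNReal.ofReal_one]
    · refine iSup₂_le fun l j => ?_
      refine (mul_le_mul' (essSup_le_of_ae_le (ENNReal.ofReal (C * ‖t‖)) ?_) (hexp l)).trans_eq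
        (mul_one _)
      refine (ae_restrict_iff' ((Y.measurableSet_element l j).prod
        (Y.measurableSet_element l j))).2 ?_
      filter_upwards [Measure.quasiMeasurePreserving_fst.ae hS,
        Measure.quasiMeasurePreserving_snd.ae hS] with q h1 h2 hq
      refine ENNReal.div_le_of_le_mul ?_
      rw [← ENNReal.ofReal_mul (by positivity), ← ofReal_norm, ← circle_dist_eq]
      exact ENNReal.ofReal_le_ofReal (hlip _ h1 _ h2
        (Y.agreeBefore_of_sameElement ⟨l, j, hq.1, hq.2⟩) (hq.1.1.trans hq.2.1.symm))
  · obtain ⟨p, hp⟩ := (hν.ae_eq h0).exists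
    exact (u p).coe_ne_zero hp
  · filter_upwards [Y.ae_hasSum_density hν hinv, Y.ae_forall_preimage hu.2] with x h1 h2
    -- All preimages contribute the same value `z * u x`, and the weights sum to `ρ(x)` because `ρ`
    -- is a fixed point of `P`.
    have h3 : ∀ y : {y : Y.Tower // Y.F y = x},
        ((Y.density ν y / Y.JF y : ℝ) : ℂ) *
          (Complex.exp (Complex.I * (inner ℝ t (f y) : ℝ)) * u y) =
        ((Y.density ν y / Y.JF y : ℝ) : ℂ) * (z * u x) := by
      intro y
      have h4 := congrArg (fun w : Circle => (w : ℂ)) (h2 y y.2)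
      simp only [Circle.coe_mul, Circle.coe_exp] at h4
      rw [mul_comm Complex.I, h4, y.2]
    rw [fourierTransfer_eq, tsum_congr h3, tsum_mul_right, ← Complex.ofReal_tsum, h1.2.tsum_eq,
      inv_mul_cancel_left₀ (Complex.ofReal_ne_zero.2 h1.1.ne')]

end QuotientTower
end

theorem theorem3p1 {Λ ι : Type*} [MeasurableSpace Λ] [StandardBorelSpace Λ] [Countable ι]
    (Y : QuotientTower Λ ι)
    (ν : Measure Y.Tower) [IsProbabilityMeasure ν] (hν : ν ≪ Y.mbar)
    (hergodic : ∀ n : ℕ, 1 ≤ n → Ergodic (Y.F^[n]) ν)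
    {d : ℕ} (f : Y.Tower → EuclideanSpace ℝ (Fin d)) (hf : Y.BoundedLipschitz f)
    (ε : ℝ) (hε : Y.AdmissibleWeight ε) :
    ∃ (G : AddSubgroup (EuclideanSpace ℝ (Fin d))) (r : EuclideanSpace ℝ (Fin d)),
      IsClosed (G : Set (EuclideanSpace ℝ (Fin d))) ∧
      (∀ t, t ∈ G ↔ ∃ lam : ℂ, Y.IsUnimodularEigenvalue ν f ε t lam) ∧
      (∀ t lam, Y.IsUnimodularEigenvalue ν f ε t lam →
        lam = Complex.exp (Complex.I * (inner ℝ t r : ℝ))) ∧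
      minimalLattice Y.F ν f = {x | ∃ v ∈ dualOfQuotient G, x = v + r} ∧
      (∃ g, Measurable g ∧ Cohomologous Y.F ν f g ∧ IsMinimalFunction Y.F ν g) ∧
      (∀ g, Cohomologous Y.F ν f g → IsMinimalFunction Y.F ν g →
        ((∀ g', Cohomologous Y.F ν f g' → IsMinimalFunction Y.F ν g' → g' =ᵐ[ν] g) ↔
          ∃ c : EuclideanSpace ℝ (Fin d), g =ᵐ[ν] fun _ => c)) := by
  have herg : Ergodic Y.F ν := hergodic 1 le_rfl
  have hinv : MeasurePreserving Y.F ν ν := herg.toMeasurePreserving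
  have hcl := Y.isClosed_isCircleCohomologous hν hinv hf
  have heig : ∀ {t lam}, Y.IsUnimodularEigenvalue ν f ε t lam →
      ∃ z : Circle, lam = z ∧ IsCircleCohomologous Y.F ν f t z := fun {t lam} h =>
    ⟨⟨lam, mem_sphere_zero_iff_norm.2 h.1⟩, rfl,
      Y.isCircleCohomologous_of_isUnimodularEigenvalue hν herg hε.2.1 h⟩
  -- Triviality of the fibre over `t = 0` makes the closed relation a graph, and duality then
  -- supplies a single `r` for all frequencies.
  obtain ⟨r, hr⟩ := exists_character_circleCohomology hcl fun z hz =>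
    Y.eq_one_of_isCircleCohomologous_zero hν hergodic hf hz
  refine ⟨circleCohomologyGroup Y.F ν f, r, isClosed_circleCohomologyGroup hcl, fun t => ?_,
    fun t lam h => ?_, ?_⟩
  · rw [mem_circleCohomologyGroup]
    constructor
    · rintro ⟨z, hz⟩
      exact ⟨z, Y.isUnimodularEigenvalue_of_isCircleCohomologous hν hinv hf hε.1.le hz⟩
    · rintro ⟨lam, h⟩
      obtain ⟨z, -, hz⟩ := heig h
      exact ⟨z, hz⟩
  · obtain ⟨z, rfl, hz⟩ := heig h
    rw [hr t z hz, Circle.coe_exp, mul_comm]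
  · exact minimalLattice_of_circleCohomology herg (QuotientTower.BoundedLipschitz.measurable Y hf) hcl hr
      fun v hv => Y.exists_real_coboundary hν herg hf v r hv
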